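/- Let $0<\eta<1$ be real and let $\tau$ be purely imaginary with $\operatorname{Im}\tau>0$. Put $\tilde\tau=-1/\tau$, $\tilde\eta=-\eta/\tau$, and let $\theta_1(z)=-i\sum_{k\in\mathbb Z}(-1)^k e^{i\pi\tilde\tau(k+1/2)^2}e^{2i\pi(k+1/2)z}$ be the theta function with quasi-periods $1$ and $\tilde\tau$. For real $z$ let $$p_0(z)=i\log\frac{\theta_1(\tilde\eta/2+z)}{\theta_1(\tilde\eta/2-z)},\qquad \vartheta(z)=i\log\frac{\theta_1(\tilde\eta+z)}{\theta_1(\tilde\eta-z)},$$ where the logarithms are the continuous determinations with $p_0(0)=\vartheta(0)=0$ (so $p_0,\vartheta$ are real-valued and equal to the integrals from $0$ of their derivatives $p_0'(z)=i\{\frac{\theta_1'}{\theta_1}(z+\tilde\eta/2)-\frac{\theta_1'}{\theta_1}(z-\tilde\eta/2)\}$ and $\vartheta'(z)=i\{\frac{\theta_1'}{\theta_1}(z+\tilde\eta)-\frac{\theta_1'}{\theta_1}(z-\tilde\eta)\}$), and let $K(z)=\vartheta'(z)/2\pi$. For $n\ge1$ and $N=2n$, call $(x_1,\dots,x_n)\in\mathbb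 R^n$ the Bethe roots of a degenerate ground state if there are $\beta\in\mathbb R$ and integers $n_1,\dots,n_n$ with $n_{j+1}-n_j=1$ for $1\le j\le n-1$ such that $$N p_0(x_j)-\sum_{l=1}^n\vartheta(x_j-x_l)=2\pi\Big(n_j-\frac{n+1}2+\beta+2\eta\sum_{l=1}^n x_l\Big),\qquad j=1,\dots,n.$$ A quantity depending on $N$ and on such a ground state is $O(N^{-\infty})$ if for every $k\in\mathbb N$ there is a constant $C$, independent of $N$ and of the ground state, such that it is bounded in absolute value by $C N^{-k}$ for all even $N\ge2$ and all ground states. Then the integral equation $$\rho(z)+\int_{-1/2}^{1/2}K(z-w)\rho(w)\,dw=\frac{p_0'(z)}{2\pi},\qquad z\in[-1/2,1/2],$$ has a solution $\rho$, unique on $[-1/2,1/2]$ among integrable functions, which extends to a continuous, positive, $1$-periodic function on $\mathbb R$, and: (i) for every $\mathcal C^\infty$ $1$-periodic function $f:\mathbb R\to\mathbb C$, $$\frac1N\sum_{j=1}^n f(x_j)=\int_{-1/2}^{1/2}f(z)\rho(z)\,dz+O(N^{-\infty});$$ (ii) for every $\mathcal C^\infty$ function $g:\mathbb R\to\mathbb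 C$ such that $g'$ is $1$-periodic, $$\frac1N\sum_{j=1}^n g(x_j)=\int_{-1/2}^{1/2}g(z)\rho(z)\,dz+\frac{c_g}{N}\sum_{j=1}^n x_j+O(N^{-\infty}),\qquad c_g=\int_{-1/2}^{1/2}g'(z)\,dz=g(1/2)-g(-1/2).$$ -/

import Mathlib

open scoped ContDiff

noncomputable section

namespace CyclicSOS

open Complex MeasureTheory

/-- The theta function `θ₁(z;τ)` with quasi-periods `1` and `τ`, `Im τ > 0`:
`θ₁(z;τ) = -i ∑_{k ∈ ℤ} (-1)^k e^{iπτ(k+1/2)²} e^{2iπ(k+1/2)z}`. -/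
def theta1 (τ z : ℂ) : ℂ :=
  -I * ∑' k : ℤ, (-1 : ℂ) ^ k * cexp (I * Real.pi * τ * ((k : ℂ) + 1 / 2) ^ 2) *
    cexp (2 * I * Real.pi * ((k : ℂ) + 1 / 2) * z)

/-- The dual modular parameter `τ̃ = -1/τ`. -/
def dualTau (τ : ℂ) : ℂ := -1 / τ

/-- The dual crossing parameter `η̃ = -η/τ`. -/
def dualEta (η : ℝ) (τ : ℂ) : ℂ := -(η : ℂ) / τ

/-- For a modular parameter `τ` and a shift `a`, both purely imaginary, the (real) value at
`z ∈ ℝ` of `i (θ₁'(z+a;τ)/θ₁(z+a;τ) - θ₁'(z-a;τ)/θ₁(z-a;τ))`, which is the derivative of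
`z ↦ i log (θ₁(a+z;τ)/θ₁(a-z;τ))`. The imaginary part of the expression vanishes, see
`ofReal_phaseDeriv`. -/
def phaseDeriv (τ a : ℂ) (z : ℝ) : ℝ :=
  (I * (logDeriv (theta1 τ) ((z : ℂ) + a) - logDeriv (theta1 τ) ((z : ℂ) - a))).re

/-- `i log (θ₁(a+z;τ)/θ₁(a-z;τ))` for `z ∈ ℝ`, in the continuous determination of the logarithm
that vanishes at `z = 0`; see `exp_phase`. -/
def phase (τ a : ℂ) (z : ℝ) : ℝ := ∫ w in (0 : ℝ)..z, phaseDeriv τ a w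

/-- The bare momentum `p₀`. -/
def p0 (η : ℝ) (τ : ℂ) : ℝ → ℝ := phase (dualTau τ) (dualEta η τ / 2)

/-- The derivative `p₀'` of the bare momentum. -/
def p0Deriv (η : ℝ) (τ : ℂ) : ℝ → ℝ := phaseDeriv (dualTau τ) (dualEta η τ / 2)

/-- The bare phase `ϑ`. -/
def bareTheta (η : ℝ) (τ : ℂ) : ℝ → ℝ := phase (dualTau τ) (dualEta η τ)

/-- The kernel `K = ϑ' / 2π`. -/
def kernelK (η : ℝ) (τ : ℂ) (z : ℝ) : ℝ :=
  phaseDeriv (dualTau τ) (dualEta η τ) z / (2 * Real.pi)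

/-- The integrable function `ρ` solves the integral equation
`ρ(z) + ∫_{-1/2}^{1/2} K(z-w) ρ(w) dw = p₀'(z) / 2π` on `[-1/2,1/2]`. -/
def IsLiebSolution (η : ℝ) (τ : ℂ) (ρ : ℝ → ℝ) : Prop :=
  IntervalIntegrable ρ volume (-1 / 2) (1 / 2) ∧
    ∀ z ∈ Set.Icc (-1 / 2 : ℝ) (1 / 2),
      ρ z + ∫ w in (-1 / 2 : ℝ)..(1 / 2), kernelK η τ (z - w) * ρ w
        = p0Deriv η τ z / (2 * Real.pi)

/-- The logarithmic Bethe equations (homogeneous chain of length `N`, `n` real roots `x_j`,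
quantum numbers `q_j ∈ ℤ`, twist `ω = e^{iπβ}`): for `j = 1, …, n`,
`N p₀(x_j) - ∑_l ϑ(x_j - x_l) = 2π (q_j - (n+1)/2 + β + 2η ∑_l x_l)`. -/
def LogBethe (η : ℝ) (τ : ℂ) (N n : ℕ) (β : ℝ) (q : Fin n → ℤ) (x : Fin n → ℝ) : Prop :=
  ∀ j : Fin n,
    (N : ℝ) * p0 η τ (x j) - ∑ l, bareTheta η τ (x j - x l)
      = 2 * Real.pi * ((q j : ℝ) - ((n : ℝ) + 1) / 2 + β + 2 * η * ∑ l, x l)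

/-- `x_1, …, x_n` are the Bethe roots of one of the degenerate ground states of the chain of
length `N = 2n`: they form a real solution of the logarithmic Bethe equations, for some twist
`ω = e^{iπβ}`, with quantum numbers such that `q_{j+1} - q_j = 1` for `j = 1, …, n-1`. -/
def IsGroundState (η : ℝ) (τ : ℂ) (n : ℕ) (x : Fin n → ℝ) : Prop :=
  ∃ (β : ℝ) (q : Fin n → ℤ),
    (∀ i j : Fin n, (j : ℕ) = (i : ℕ) + 1 → q j - q i = 1) ∧
      LogBethe η τ (2 * n) n β q x

/-- The family of quantities `err n x`, indexed by the degenerate ground states `x` of the chains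
of even length `N = 2n ≥ 2`, is `O(N^{-∞})`, that is `O(N^{-k})` for every `k`. -/
def IsBigONegInfty (η : ℝ) (τ : ℂ) (err : (n : ℕ) → (Fin n → ℝ) → ℂ) : Prop :=
  ∀ k : ℕ, ∃ C : ℝ, ∀ n : ℕ, 0 < n → ∀ x : Fin n → ℝ, IsGroundState η τ n x →
    ‖err n x‖ ≤ C / ((2 * n : ℕ) : ℝ) ^ k

/-! Checks that the real-valued functions above are the intended ones. -/

theorem theta1_eq_jacobi (τ z : ℂ) :
    theta1 τ z = -I * cexp (I * Real.pi * τ / 4 + I * Real.pi * z) *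
      jacobiTheta₂ (z + τ / 2 + 1 / 2) τ := by
  rw [theta1, jacobiTheta₂, mul_assoc (-I), ← tsum_mul_left (a := cexp _)]
  congr 2
  funext k
  have h : (-1 : ℂ) ^ k = cexp (Real.pi * I * k) := by
    rw [mul_comm, Complex.exp_int_mul, Complex.exp_pi_mul_I]
  rw [h, jacobiTheta₂_term, ← Complex.exp_add, ← Complex.exp_add, ← Complex.exp_add]
  congr 1
  ring

theorem differentiable_theta1 {τ : ℂ} (hτ : 0 < τ.im) : Differentiable ℂ (theta1 τ) := by
  have h : theta1 τ = fun z => -I * cexp (I * Real.pi * τ / 4 + I * Real.pi * z) *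
      jacobiTheta₂ (z + τ / 2 + 1 / 2) τ := funext (theta1_eq_jacobi τ)
  rw [h]
  intro z
  have h2 : DifferentiableAt ℂ (fun z : ℂ => jacobiTheta₂ (z + τ / 2 + 1 / 2) τ) z :=
    DifferentiableAt.comp z (g := fun w => jacobiTheta₂ w τ)
      (differentiableAt_jacobiTheta₂_fst _ hτ) (by fun_prop)
  exact DifferentiableAt.mul (by fun_prop) h2

theorem theta1_neg (τ z : ℂ) : theta1 τ (-z) = -theta1 τ z := by
  rw [theta1, theta1, ← mul_neg, ← tsum_neg, ← (Equiv.subLeft (-1 : ℤ)).tsum_eq]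
  congr 2
  funext k
  have h : (-1 : ℂ) ^ (-1 - k) = -(-1 : ℂ) ^ k := by
    rw [zpow_sub₀ (by norm_num)]
    rcases Int.even_or_odd k with hk | hk
    · simp [hk.neg_one_zpow]
    · simp [hk.neg_one_zpow]
  simp only [Equiv.subLeft_apply, h]
  push_cast
  rw [show ((-1 : ℂ) - k + 1 / 2) = -((k : ℂ) + 1 / 2) by ring]
  rw [neg_sq, show 2 * I * Real.pi * -((k : ℂ) + 1 / 2) * -z
    = 2 * I * Real.pi * ((k : ℂ) + 1 / 2) * z by ring]
  ring

theorem theta1_conj {τ : ℂ} (hτ : τ.re = 0) (z : ℂ) :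
    theta1 τ (starRingEnd ℂ z) = starRingEnd ℂ (theta1 τ z) := by
  have hc : starRingEnd ℂ τ = -τ := by
    apply Complex.ext <;> simp [hτ]
  rw [← neg_neg (theta1 τ (starRingEnd ℂ z)), ← theta1_neg, theta1, theta1, map_mul,
    Complex.conj_tsum, map_neg, conj_I, neg_neg, ← neg_mul, neg_neg]
  congr 2
  funext k
  simp only [map_mul, ← Complex.exp_conj, map_zpow₀, map_neg, map_one, map_pow, map_add, conj_I,
    conj_ofReal, hc, map_intCast, map_div₀, map_ofNat]
  congr 2 <;> ring_nf

theorem logDeriv_theta1_conj {τ : ℂ} (hτ : τ.re = 0) (z : ℂ) :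
    logDeriv (theta1 τ) (starRingEnd ℂ z) = starRingEnd ℂ (logDeriv (theta1 τ) z) := by
  have h : (starRingEnd ℂ) ∘ theta1 τ ∘ (starRingEnd ℂ) = theta1 τ := by
    funext w
    simp [theta1_conj hτ]
  have hd := congrFun (deriv_conj_conj (f := theta1 τ)) (starRingEnd ℂ z)
  rw [h, Function.comp_apply, Function.comp_apply, conj_conj] at hd
  rw [logDeriv_apply, logDeriv_apply, hd, theta1_conj hτ, map_div₀]

/-- The imaginary part dropped in `phaseDeriv` vanishes. -/
theorem ofReal_phaseDeriv {τ a : ℂ} (hτ : τ.re = 0) (ha : a.re = 0) (z : ℝ) :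
    (phaseDeriv τ a z : ℂ)
      = I * (logDeriv (theta1 τ) ((z : ℂ) + a) - logDeriv (theta1 τ) ((z : ℂ) - a)) := by
  have hc : starRingEnd ℂ a = -a := by
    apply Complex.ext <;> simp [ha]
  rw [phaseDeriv]
  apply Complex.conj_eq_iff_re.mp
  have h := logDeriv_theta1_conj hτ ((z : ℂ) + a)
  rw [map_add, conj_ofReal, hc, ← sub_eq_add_neg] at h
  rw [map_mul, map_sub, h, ← h, conj_I, h, conj_conj]
  ring

theorem theta1_sub_ne {τ a : ℂ} (hne : ∀ w : ℝ, theta1 τ ((w : ℂ) + a) ≠ 0) (z : ℝ) :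
    theta1 τ ((z : ℂ) - a) ≠ 0 := by
  have h := hne (-z)
  rw [show (((-z : ℝ) : ℂ) + a) = -((z : ℂ) - a) by push_cast; ring, theta1_neg] at h
  exact neg_ne_zero.mp h

theorem continuous_phaseDeriv {τ a : ℂ} (hτ' : 0 < τ.im)
    (hne : ∀ w : ℝ, theta1 τ ((w : ℂ) + a) ≠ 0) : Continuous (phaseDeriv τ a) := by
  have hd := differentiable_theta1 hτ'
  have hdd : Continuous (deriv (theta1 τ)) :=
    (hd.contDiff (n := 1)).continuous_deriv le_rfl
  have h1 : Continuous fun z : ℝ => logDeriv (theta1 τ) ((z : ℂ) + a) := by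
    simp only [logDeriv_apply]
    exact (hdd.comp (by fun_prop)).div (hd.continuous.comp (by fun_prop)) hne
  have h2 : Continuous fun z : ℝ => logDeriv (theta1 τ) ((z : ℂ) - a) := by
    simp only [logDeriv_apply]
    exact (hdd.comp (by fun_prop)).div (hd.continuous.comp (by fun_prop)) (theta1_sub_ne hne)
  exact Complex.continuous_re.comp (continuous_const.mul (h1.sub h2))

/-- `phase` is a determination of `i log (θ₁(a+z)/θ₁(a-z))`. -/
theorem exp_phase {τ a : ℂ} (hτ : τ.re = 0) (hτ' : 0 < τ.im) (ha : a.re = 0)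
    (hne : ∀ w : ℝ, theta1 τ ((w : ℂ) + a) ≠ 0) (z : ℝ) :
    cexp (-I * phase τ a z) = theta1 τ (a + z) / theta1 τ (a - z) := by
  have hd := differentiable_theta1 hτ'
  have hne' := theta1_sub_ne hne
  have hcont := continuous_phaseDeriv hτ' hne
  have key : ∀ w : ℝ, HasDerivAt
      (fun w : ℝ => cexp (I * phase τ a w) * (theta1 τ ((w : ℂ) + a) / theta1 τ ((w : ℂ) - a)))
      0 w := by
    intro w
    have e1 : HasDerivAt (phase τ a) (phaseDeriv τ a w) w :=
      intervalIntegral.integral_hasDerivAt_right (hcont.intervalIntegrable _ _)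
        hcont.stronglyMeasurable.stronglyMeasurableAtFilter hcont.continuousAt
    have e2 := (e1.ofReal_comp.const_mul I).cexp
    have c1 : HasDerivAt (fun w : ℝ => (w : ℂ) + a) 1 w :=
      (Complex.ofRealCLM.hasDerivAt (x := w)).add_const a
    have c2 : HasDerivAt (fun w : ℝ => (w : ℂ) - a) 1 w :=
      (Complex.ofRealCLM.hasDerivAt (x := w)).sub_const a
    have t1 := (hd ((w : ℂ) + a)).hasDerivAt.comp w c1
    have t2 := (hd ((w : ℂ) - a)).hasDerivAt.comp w c2
    have t := e2.mul (t1.div t2 (hne' w))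
    refine t.congr_deriv ?_
    rw [ofReal_phaseDeriv hτ ha, logDeriv_apply, logDeriv_apply]
    have n1 := hne w
    have n2 := hne' w
    simp only [Function.comp_apply, Pi.div_apply]
    field_simp
    linear_combination cexp (I * phase τ a w) * (theta1 τ (↑w - a) * deriv (theta1 τ) (↑w + a) -
      theta1 τ (↑w + a) * deriv (theta1 τ) (↑w - a)) * I_sq
  have hdiff : Differentiable ℝ
      (fun w : ℝ => cexp (I * phase τ a w) *
        (theta1 τ ((w : ℂ) + a) / theta1 τ ((w : ℂ) - a))) :=
    fun w => (key w).differentiableAt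
  have hc := is_const_of_deriv_eq_zero hdiff (fun w => (key w).deriv) z 0
  have n0 := hne 0
  have m0 := hne' z
  simp only [phase, intervalIntegral.integral_same, ofReal_zero, mul_zero, Complex.exp_zero,
    zero_add, zero_sub, one_mul, theta1_neg] at hc n0
  rw [div_neg, div_self n0] at hc
  rw [← neg_sub (z : ℂ) a, theta1_neg, neg_mul, Complex.exp_neg, add_comm a]
  rw [phase, div_neg, eq_neg_iff_add_eq_zero]
  have he := Complex.exp_ne_zero (I * ((∫ w in (0 : ℝ)..z, phaseDeriv τ a w : ℝ) : ℂ))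
  field_simp at hc ⊢
  linear_combination hc

end CyclicSOS

end

/-! Put `s = 1 / Im τ`, so that `τ̃ = is` and `η̃ = isη`. The product formula for `θ₁` turns
logarithmic derivatives into Lambert series, hence into Fourier series. `K` has mean 1 and, for `m ≠
0`, coefficients `sinh(πs(1-2η)m) / sinh(πsm)`; for `p₀'/2π` replace `η` by `η/2`. The integral
equation is a convolution equation, diagonal in Fourier modes, and `1 + K̂(m)` never vanishes. The
solution has coefficients `1 / (2 cosh(πsηm))`, so up to a constant it is again a phase derivative,
with other parameters (`rootDensity`).

Signs are invisible in this series but not in the dual one: after the modular transformation, the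
normalized phase derivative with shift `isκ` is `2κ` plus a sum whose terms all have the sign of
`sin 2πκ`. It therefore exceeds `2κ` for `κ < 1/2` and is at most `2κ` for `κ ≥ 1/2`. This gives the
positivity of `ρ`, of the resolvent below and of `p₀'/2π - η`.

For a ground state, the normalized counting function `U` satisfies `U(x_j) = j/n` and `U(z+1) =
U(z)+1`, and `U' = 2σ` with `σ` the counting density. The twist and `∑ x_l` only enter an additive
constant of `U`. The main difficulty is that `σ` is bounded below, uniformly over all ground states
with `n` large (`exists_pos_le_countingDensity`); the roots are not known beforehand to be ordered
or to lie in one period. For `η ≥ 1/2` it is immediate from the signs. For `η < 1/2`, a nonnegative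
resolvent `R` gives `σ - R*σ = ρ - (1/2n) ∑ R(· - x_l)`. The points have distinct integer heights
`nU` even after reduction modulo 1, so the variation of `U` controls how many can lie in a short
interval, and the last sum is at most `R*|σ|` plus a small error. At a minimum of `σ`, where only
the negative part of `σ` remains, this is a contraction estimate because `2∫R ≤ 1`.

Once `U` is a diffeomorphism with controlled derivatives, the `x_j` are the images of equidistant
points, and sums of a smooth periodic function over them are Riemann sums of a smooth periodic
function: they equal the integral against `σ` up to `O(n^{-∞})` (`norm_riemannSum_sub_integral_le`,
`exists_norm_average_sub_integral_le`). To pass from `σ` to `ρ`, apply this not to `f` but to the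
smooth solution `ψ` of `ψ + K*ψ = f`: by the evenness of `K`, the error for `f` against `ρ` is
exactly the error for `ψ` against `σ` (`average_sub_integral_eq`). Finally (ii) is (i) for the
periodic function `g(z) - c_g z`, since `ρ` is even and `∫ zρ = 0`. -/

noncomputable section

namespace CyclicSOS

open Complex MeasureTheory

/-! ### Fourier coefficients of functions of period one -/

/-- The character `x ↦ e^{2πimx}`. -/
def char (m : ℤ) (x : ℝ) : ℂ := cexp (2 * Real.pi * I * m * x)

/-- The `m`-th Fourier coefficient of a function of period one. -/
def coeff (f : ℝ → ℂ) (m : ℤ) : ℂ := ∫ x in (-1 / 2 : ℝ)..(1 / 2), char (-m) x * f x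

theorem char_zero (x : ℝ) : char 0 x = 1 := by simp [char]

theorem continuous_char (m : ℤ) : Continuous (char m) := by
  unfold char
  fun_prop

theorem norm_char (m : ℤ) (x : ℝ) : ‖char m x‖ = 1 := by
  rw [char, show (2 * Real.pi * I * m * x : ℂ) = ((2 * Real.pi * m * x : ℝ) : ℂ) * I by
    push_cast; ring, Complex.norm_exp_ofReal_mul_I]

theorem char_add (m : ℤ) (x y : ℝ) : char m (x + y) = char m x * char m y := by
  simp only [char, ← Complex.exp_add]
  push_cast
  ring_nf

theorem char_mul (m k : ℤ) (x : ℝ) : char m x * char k x = char (m + k) x := by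
  simp only [char, ← Complex.exp_add]
  push_cast
  ring_nf

theorem char_periodic (m : ℤ) : Function.Periodic (char m) 1 := by
  intro x
  have h : char m 1 = 1 := by
    rw [char, Complex.exp_eq_one_iff]
    exact ⟨m, by push_cast; ring⟩
  rw [char_add, h, mul_one]

theorem integral_char (m : ℤ) :
    ∫ x in (-1 / 2 : ℝ)..(1 / 2), char m x = if m = 0 then 1 else 0 := by
  split_ifs with h
  · subst h
    norm_num [char_zero]
  · have hc : (2 * Real.pi * I * m : ℂ) ≠ 0 := by simp [h, Real.pi_ne_zero]
    simp only [char]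
    rw [integral_exp_mul_complex hc]
    have := char_periodic m (-1 / 2)
    simp only [char] at this
    rw [show (-1 / 2 + 1 : ℝ) = 1 / 2 by norm_num] at this
    rw [this, sub_self, zero_div]

/-- The integral of a `1`-periodic function over a period. -/
theorem integral_period {E : Type*} [NormedAddCommGroup E] [NormedSpace ℝ E] {f : ℝ → E}
    (hf : Function.Periodic f 1) (a : ℝ) :
    ∫ x in a..a + 1, f x = ∫ x in (-1 / 2 : ℝ)..(1 / 2), f x := by
  rw [hf.intervalIntegral_add_eq a (-1 / 2)]
  norm_num

theorem integral_period_sub {E : Type*} [NormedAddCommGroup E] [NormedSpace ℝ E] {f : ℝ → E}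
    (hf : Function.Periodic f 1) (a : ℝ) :
    ∫ x in (-1 / 2 : ℝ)..(1 / 2), f (x - a) = ∫ x in (-1 / 2 : ℝ)..(1 / 2), f x := by
  rw [intervalIntegral.integral_comp_sub_right, ← integral_period hf (-1 / 2 - a)]
  congr 1
  ring

/-- Vanishing coefficients are summable, so the Fourier series converges pointwise to the function.
Identities between periodic functions are verified mode by mode through this. -/
theorem eq_zero_of_coeff_eq_zero {f : ℝ → ℂ} (hf : Continuous f) (hp : Function.Periodic f 1)
    (h : ∀ m, coeff f m = 0) : f = 0 := by
  let F : C(UnitAddCircle, ℂ) := ⟨hp.lift, continuous_coinduced_dom.mpr hf⟩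
  have hF : ∀ x : ℝ, F (x : UnitAddCircle) = f x := fun x => rfl
  have hc : ∀ m, fourierCoeff F m = 0 := by
    intro m
    rw [fourierCoeff_eq_intervalIntegral F m (-1 / 2), ← h m, coeff, one_div_one, one_smul,
      show (-1 / 2 + 1 : ℝ) = 1 / 2 by norm_num]
    refine intervalIntegral.integral_congr fun x _ => ?_
    simp only [hF, char, fourier_coe_apply, smul_eq_mul, ofReal_one, div_one]
  have hs : Summable (fourierCoeff F) := by
    rw [show fourierCoeff F = fun _ => 0 from funext hc]
    exact summable_zero
  funext x
  have := has_pointwise_sum_fourier_series_of_summable hs (x : UnitAddCircle)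
  simp only [hc, zero_smul] at this
  rw [← hF x]
  exact this.unique hasSum_zero

theorem eq_of_coeff_eq {f g : ℝ → ℂ} (hf : Continuous f) (hfp : Function.Periodic f 1)
    (hg : Continuous g) (hgp : Function.Periodic g 1) (h : ∀ m, coeff f m = coeff g m) :
    f = g := by
  rw [← sub_eq_zero]
  refine eq_zero_of_coeff_eq_zero (hf.sub hg) (hfp.sub hgp) fun m => ?_
  have := h m
  simp only [coeff, Pi.sub_apply, mul_sub] at this ⊢
  rw [intervalIntegral.integral_sub, this, sub_self]
  · exact ((continuous_char _).mul hf).intervalIntegrable _ _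
  · exact ((continuous_char _).mul hg).intervalIntegrable _ _

theorem coeff_add {f g : ℝ → ℂ} (hf : Continuous f) (hg : Continuous g) (m : ℤ) :
    coeff (fun x => f x + g x) m = coeff f m + coeff g m := by
  simp only [coeff, mul_add]
  exact intervalIntegral.integral_add (((continuous_char _).mul hf).intervalIntegrable _ _)
    (((continuous_char _).mul hg).intervalIntegrable _ _)

theorem coeff_sub {f g : ℝ → ℂ} (hf : Continuous f) (hg : Continuous g) (m : ℤ) :
    coeff (fun x => f x - g x) m = coeff f m - coeff g m := by
  simp only [coeff, mul_sub]
  exact intervalIntegral.integral_sub (((continuous_char _).mul hf).intervalIntegrable _ _)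
    (((continuous_char _).mul hg).intervalIntegrable _ _)

theorem coeff_const_mul (c : ℂ) (f : ℝ → ℂ) (m : ℤ) :
    coeff (fun x => c * f x) m = c * coeff f m := by
  simp only [coeff]
  rw [← intervalIntegral.integral_const_mul]
  congr 1
  funext x
  ring

theorem coeff_const (c : ℂ) (m : ℤ) : coeff (fun _ => c) m = if m = 0 then c else 0 := by
  simp only [coeff]
  rw [intervalIntegral.integral_mul_const, integral_char]
  simp

theorem coeff_zero_index (f : ℝ → ℂ) : coeff f 0 = ∫ x in (-1 / 2 : ℝ)..(1 / 2), f x := by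
  simp [coeff, char_zero]

/-! ### Absolutely convergent Fourier series -/

section Series

variable {c : ℤ → ℂ}

theorem continuous_charSeries (hc : Summable fun m => ‖c m‖) :
    Continuous fun x : ℝ => ∑' m, c m * char m x :=
  continuous_tsum (fun m => continuous_const.mul (continuous_char m)) hc
    fun m x => by rw [norm_mul, norm_char, mul_one]

theorem periodic_charSeries (c : ℤ → ℂ) :
    Function.Periodic (fun x : ℝ => ∑' m, c m * char m x) 1 := fun x => by
  simp only [char_periodic _ x]

theorem coeff_charSeries (hc : Summable fun m => ‖c m‖) (k : ℤ) :
    coeff (fun x : ℝ => ∑' m, c m * char m x) k = c k := by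
  have hs : HasSum (fun m => ∫ x in (-1 / 2 : ℝ)..(1 / 2), char (-k) x * (c m * char m x))
      (coeff (fun x : ℝ => ∑' m, c m * char m x) k) := by
    refine intervalIntegral.hasSum_integral_of_dominated_convergence (fun m _ => ‖c m‖)
      (fun m => Continuous.aestronglyMeasurable ((continuous_char _).mul
        (continuous_const.mul (continuous_char m)))) ?_ ?_ ?_ ?_
    · refine fun m => Filter.Eventually.of_forall fun x _ => ?_
      rw [norm_mul, norm_mul, norm_char, norm_char, one_mul, mul_one]
    · exact Filter.Eventually.of_forall fun x _ => hc
    · exact intervalIntegrable_const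
    · refine Filter.Eventually.of_forall fun x _ => HasSum.mul_left _ (Summable.hasSum ?_)
      refine Summable.of_norm ?_
      simpa only [norm_mul, norm_char, mul_one] using hc
  refine hs.unique ?_
  convert hasSum_ite_eq k (c k) using 2 with m
  have : ∀ x, char (-k) x * (c m * char m x) = c m * char (m - k) x := fun x => by
    rw [mul_left_comm, char_mul, neg_add_eq_sub]
  simp only [this]
  rw [intervalIntegral.integral_const_mul, integral_char]
  simp only [sub_eq_zero]
  split_ifs with h
  · rw [h, mul_one]
  · rw [mul_zero]

end Series

/-! ### Convolution over a period -/

theorem integral_integral_swap_of_continuous {E : Type*} [NormedAddCommGroup E] [NormedSpace ℝ E]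
    {F : ℝ → ℝ → E} (hF : Continuous (Function.uncurry F)) (a b c d : ℝ) :
    ∫ x in a..b, ∫ y in c..d, F x y = ∫ y in c..d, ∫ x in a..b, F x y := by
  refine intervalIntegral_intervalIntegral_swap ?_
  exact (hF.continuousOn.integrableOn_compact (isCompact_uIcc.prod isCompact_uIcc)).mono_set
    (Set.prod_mono Set.uIoc_subset_uIcc Set.uIoc_subset_uIcc)

/-- Convolution over a period. -/
def conv (f g : ℝ → ℂ) (z : ℝ) : ℂ := ∫ w in (-1 / 2 : ℝ)..(1 / 2), f (z - w) * g w

theorem periodic_conv {f : ℝ → ℂ} (hf : Function.Periodic f 1) (g : ℝ → ℂ) :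
    Function.Periodic (conv f g) 1 := fun z => by
  simp only [conv, show ∀ w, z + 1 - w = z - w + 1 from fun w => by ring, hf _]

theorem continuous_conv {f g : ℝ → ℂ} (hf : Continuous f) (hg : Continuous g) :
    Continuous (conv f g) := by
  unfold conv
  fun_prop

/-- Fubini and translation invariance of the integral over a period; only the translated factor has
to be periodic. -/
theorem coeff_conv {f g : ℝ → ℂ} (hf : Continuous f) (hfp : Function.Periodic f 1)
    (hg : Continuous g) (m : ℤ) : coeff (conv f g) m = coeff f m * coeff g m := by
  have h1 : coeff (conv f g) m = ∫ x in (-1 / 2 : ℝ)..(1 / 2), ∫ w in (-1 / 2 : ℝ)..(1 / 2),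
      char (-m) x * (f (x - w) * g w) := by
    simp only [coeff, conv, intervalIntegral.integral_const_mul]
  rw [h1, integral_integral_swap_of_continuous]
  · have h2 : ∀ w : ℝ, ∫ x in (-1 / 2 : ℝ)..(1 / 2), char (-m) x * (f (x - w) * g w)
        = coeff f m * (char (-m) w * g w) := by
      intro w
      have : ∀ x : ℝ, char (-m) x * (f (x - w) * g w)
          = (fun y => char (-m) y * f y) (x - w) * (char (-m) w * g w) := fun x => by
        have := char_add (-m) (x - w) w
        rw [sub_add_cancel] at this
        rw [this]
        ring
      simp only [this]
      rw [intervalIntegral.integral_mul_const,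
        integral_period_sub (f := fun y => char (-m) y * f y) ((char_periodic _).mul hfp)]
      rfl
    simp only [h2, intervalIntegral.integral_const_mul]
    rfl
  · have := continuous_char (-m)
    fun_prop

/-! ### The infinite product of the theta function -/

/-- The infinite product `∏_{n ≥ 0} (1 - Qⁿ w)`. -/
def qProd (Q : ℝ) (w : ℂ) : ℂ := ∏' n : ℕ, (1 - (Q : ℂ) ^ n * w)

/-- The series `∑_{n ≥ 0} Qⁿ w / (1 - Qⁿ w)`. -/
def lambertSum (Q : ℝ) (w : ℂ) : ℂ := ∑' n : ℕ, (Q : ℂ) ^ n * w / (1 - (Q : ℂ) ^ n * w)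

section QProd

variable {Q : ℝ} (hQ0 : 0 < Q) (hQ1 : Q < 1)
include hQ0 hQ1

theorem summable_norm_pow_mul (w : ℂ) : Summable fun n : ℕ => ‖(Q : ℂ) ^ n * w‖ := by
  simp only [norm_mul, norm_pow, norm_real, Real.norm_of_nonneg hQ0.le]
  exact (summable_geometric_of_lt_one hQ0.le hQ1).mul_right _

theorem multipliable_qProd (w : ℂ) : Multipliable fun n : ℕ => 1 - (Q : ℂ) ^ n * w := by
  simp only [sub_eq_add_neg]
  refine multipliable_one_add_of_summable ?_
  simpa only [norm_neg] using summable_norm_pow_mul hQ0 hQ1 w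

/-- Locally uniform convergence is what makes the product entire and allows its logarithmic
derivative to be taken factor by factor. -/
theorem multipliableLocallyUniformlyOn_qProd :
    MultipliableLocallyUniformlyOn (fun (n : ℕ) (w : ℂ) => 1 - (Q : ℂ) ^ n * w) Set.univ := by
  use fun w => ∏' n : ℕ, (1 - (Q : ℂ) ^ n * w)
  simp only [sub_eq_add_neg]
  refine hasProdLocallyUniformlyOn_of_forall_compact isOpen_univ fun K _ hK => ?_
  obtain ⟨C, hC⟩ := hK.isBounded.exists_norm_le
  refine (((summable_geometric_of_lt_one hQ0.le hQ1).mul_right C)).hasProdUniformlyOn_nat_one_add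
    hK (.of_forall fun n w hw => ?_) (fun _ => by fun_prop)
  rw [norm_neg, norm_mul, norm_pow, norm_real, Real.norm_of_nonneg hQ0.le]
  gcongr
  exact hC w hw

theorem differentiable_qProd : Differentiable ℂ (qProd Q) := by
  rw [← differentiableOn_univ]
  exact (multipliableLocallyUniformlyOn_qProd hQ0 hQ1).hasProdLocallyUniformlyOn.differentiableOn
    (.of_forall fun _ => by simpa [Finset.prod_fn] using
      DifferentiableOn.finsetProd (fun _ _ => by fun_prop)) isOpen_univ

theorem qProd_eq_mul (w : ℂ) : qProd Q w = (1 - w) * qProd Q (Q * w) := by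
  have he : ∀ n : ℕ, 1 - (Q : ℂ) ^ (n + 1) * w = 1 - (Q : ℂ) ^ n * (Q * w) := fun n => by ring
  have h : Multipliable fun n : ℕ => 1 - (Q : ℂ) ^ (n + 1) * w := by
    simpa only [he] using multipliable_qProd hQ0 hQ1 (Q * w)
  have h2 := tprod_eq_zero_mul' (f := fun n : ℕ => 1 - (Q : ℂ) ^ n * w) h
  simp only [he, pow_zero, one_mul] at h2
  exact h2

theorem qProd_ne_zero {w : ℂ} (hw : ∀ n : ℕ, (Q : ℂ) ^ n * w ≠ 1) : qProd Q w ≠ 0 := by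
  simp only [qProd, sub_eq_add_neg]
  refine tprod_one_add_ne_zero_of_summable (fun n h => hw n ?_) ?_
  · linear_combination -h
  · simpa only [norm_neg] using summable_norm_pow_mul hQ0 hQ1 w

omit hQ0 hQ1 in
theorem pow_mul_ne_one {w : ℂ} (hw : qProd Q w ≠ 0) (n : ℕ) : (Q : ℂ) ^ n * w ≠ 1 :=
  fun h => hw (tprod_of_exists_eq_zero ⟨n, by rw [h, sub_self]⟩)

theorem pow_mul_ne_one_of_norm_lt {w : ℂ} (hw : ‖w‖ < 1) (n : ℕ) : (Q : ℂ) ^ n * w ≠ 1 := by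
  intro h
  have h1 : ‖(Q : ℂ) ^ n * w‖ = 1 := by rw [h, norm_one]
  rw [norm_mul, norm_pow, norm_real, Real.norm_of_nonneg hQ0.le] at h1
  have h2 : Q ^ n ≤ 1 := pow_le_one₀ hQ0.le hQ1.le
  nlinarith [norm_nonneg w]

/-- No restriction on `w` is needed: the denominators are at least `1/2` in modulus for large `n`,
and a vanishing denominator gives the term `0`. -/
theorem summable_lambertSum {w : ℂ} : Summable fun n : ℕ =>
    (Q : ℂ) ^ n * w / (1 - (Q : ℂ) ^ n * w) := by
  have hs := summable_norm_pow_mul hQ0 hQ1 w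
  have ht : ∀ᶠ n : ℕ in Filter.cofinite, ‖(Q : ℂ) ^ n * w‖ ≤ 1 / 2 := by
    rw [Nat.cofinite_eq_atTop]
    exact (hs.tendsto_atTop_zero.eventually_lt_const (by norm_num : (0 : ℝ) < 1 / 2)).mono
      fun _ => le_of_lt
  refine Summable.of_norm_bounded_eventually (hs.mul_left 2) (ht.mono fun n hn => ?_)
  have h1 : 1 / 2 ≤ ‖1 - (Q : ℂ) ^ n * w‖ := by
    have := norm_sub_norm_le 1 ((Q : ℂ) ^ n * w)
    rw [norm_one] at this
    linarith
  rw [norm_div, div_le_iff₀ (by linarith)]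
  nlinarith [norm_nonneg ((Q : ℂ) ^ n * w)]

theorem mul_logDeriv_qProd {w : ℂ} (hw : qProd Q w ≠ 0) :
    w * logDeriv (qProd Q) w = -lambertSum Q w := by
  have hl : ∀ n : ℕ, logDeriv (fun w : ℂ => 1 - (Q : ℂ) ^ n * w) w
      = -((Q : ℂ) ^ n / (1 - (Q : ℂ) ^ n * w)) := fun n => by
    rw [logDeriv_apply]
    simp [neg_div]
  have hs : Summable fun n : ℕ => logDeriv (fun w : ℂ => 1 - (Q : ℂ) ^ n * w) w := by
    simp only [hl]
    refine Summable.neg ?_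
    rcases eq_or_ne w 0 with rfl | h0
    · simpa using (summable_norm_pow_mul hQ0 hQ1 1).of_norm
    · have := (summable_lambertSum hQ0 hQ1 (w := w)).mul_right w⁻¹
      refine this.congr fun n => ?_
      field_simp
  have h : logDeriv (qProd Q) w = ∑' n : ℕ, logDeriv (fun w : ℂ => 1 - (Q : ℂ) ^ n * w) w :=
    logDeriv_tprod_eq_tsum (f := fun (n : ℕ) (w : ℂ) => 1 - (Q : ℂ) ^ n * w) isOpen_univ
      (Set.mem_univ w) (fun n => sub_ne_zero.mpr (pow_mul_ne_one hw n).symm)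
      (fun n => by fun_prop) hs (multipliableLocallyUniformlyOn_qProd hQ0 hQ1) hw
  rw [h, ← tsum_mul_left, lambertSum, ← tsum_neg]
  congr 1
  funext n
  rw [hl]
  ring

/-- Used to bring an argument of modulus greater than one back into the unit disc, where the power
series converges. -/
theorem lambertSum_eq_add (w : ℂ) : lambertSum Q w = w / (1 - w) + lambertSum Q (Q * w) := by
  have h := summable_lambertSum hQ0 hQ1 (w := w)
  rw [lambertSum, h.tsum_eq_zero_add, lambertSum]
  simp only [pow_zero, one_mul, pow_succ, mul_assoc]

/-- The Lambert series of `∑ Qⁿ w / (1 - Qⁿ w)`. -/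
theorem hasSum_lambertSum {w : ℂ} (hw : ‖w‖ < 1) :
    HasSum (fun k : ℕ => w ^ (k + 1) / (1 - (Q : ℂ) ^ (k + 1))) (lambertSum Q w) := by
  have hQn : ∀ k : ℕ, ‖(Q : ℂ) ^ (k + 1)‖ < 1 := fun k => by
    rw [norm_pow, norm_real, Real.norm_of_nonneg hQ0.le]
    exact pow_lt_one₀ hQ0.le hQ1 (by omega)
  -- Each term is a geometric series in `Qⁿ w`. Summing the resulting double series over `n` first
  -- gives the Lambert series.
  have hsum : Summable fun p : ℕ × ℕ => ((Q : ℂ) ^ p.1 * w) ^ (p.2 + 1) := by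
    refine Summable.of_norm ?_
    have hb := (summable_geometric_of_lt_one hQ0.le hQ1).mul_of_nonneg
      ((summable_geometric_of_lt_one (norm_nonneg w) hw))
      (fun n => pow_nonneg hQ0.le n) (fun n => pow_nonneg (norm_nonneg w) n)
    refine hb.of_nonneg_of_le (fun p => norm_nonneg _) fun p => ?_
    rw [mul_pow, norm_mul, norm_pow, norm_pow, norm_pow, norm_real, Real.norm_of_nonneg hQ0.le]
    have h1 : (Q ^ p.1) ^ (p.2 + 1) ≤ Q ^ p.1 :=
      pow_le_of_le_one (pow_nonneg hQ0.le _) (pow_le_one₀ hQ0.le hQ1.le) (by omega)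
    have h2 : ‖w‖ ^ (p.2 + 1) ≤ ‖w‖ ^ p.2 :=
      pow_le_pow_of_le_one (norm_nonneg w) hw.le (by omega)
    gcongr
  have hrow : ∀ n : ℕ, HasSum (fun k : ℕ => ((Q : ℂ) ^ n * w) ^ (k + 1))
      ((Q : ℂ) ^ n * w / (1 - (Q : ℂ) ^ n * w)) := fun n => by
    have hn : ‖(Q : ℂ) ^ n * w‖ < 1 := by
      rw [norm_mul, norm_pow, norm_real, Real.norm_of_nonneg hQ0.le]
      have : Q ^ n ≤ 1 := pow_le_one₀ hQ0.le hQ1.le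
      nlinarith [norm_nonneg w]
    simpa only [pow_succ', div_eq_mul_inv] using (hasSum_geometric_of_norm_lt_one hn).mul_left _
  have hcol : ∀ k : ℕ, HasSum (fun n : ℕ => ((Q : ℂ) ^ n * w) ^ (k + 1))
      (w ^ (k + 1) / (1 - (Q : ℂ) ^ (k + 1))) := fun k => by
    have h := (hasSum_geometric_of_norm_lt_one (hQn k)).mul_right (w ^ (k + 1))
    rw [← div_eq_inv_mul] at h
    have he : (fun n : ℕ => ((Q : ℂ) ^ n * w) ^ (k + 1))
        = fun n : ℕ => ((Q : ℂ) ^ (k + 1)) ^ n * w ^ (k + 1) := by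
      funext n
      rw [mul_pow, ← pow_mul, ← pow_mul, mul_comm n]
    rw [he]
    exact h
  have h1 : HasSum (fun p : ℕ × ℕ => ((Q : ℂ) ^ p.1 * w) ^ (p.2 + 1)) (lambertSum Q w) := by
    rw [lambertSum, (hsum.hasSum.prod_fiberwise hrow).tsum_eq]
    exact hsum.hasSum
  have h2 := (Equiv.prodComm ℕ ℕ).hasSum_iff.mpr h1
  exact h2.prod_fiberwise hcol

end QProd

/-! ### The product formula for the theta function -/

/-- Contour shift for entire functions of period one. -/
theorem integral_add_mul_I_of_periodic {g : ℂ → ℂ} (hg : Differentiable ℂ g)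
    (hp : ∀ z, g (z + 1) = g z) (s : ℝ) :
    ∫ x in (-1 / 2 : ℝ)..(1 / 2), g (x + I * s) = ∫ x in (-1 / 2 : ℝ)..(1 / 2), g x := by
  have h := integral_boundary_rect_eq_zero_of_differentiableOn g (((-1 / 2 : ℝ) : ℂ))
    (((1 / 2 : ℝ) : ℂ) + s * I) hg.differentiableOn
  simp only [add_re, ofReal_re, mul_re, I_re, mul_zero, ofReal_im, I_im, mul_one, sub_self,
    add_zero, add_im, mul_im, zero_add, ofReal_zero, zero_mul] at h
  -- By periodicity the two vertical sides of the rectangle cancel.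
  have hv : ∀ y : ℝ, g (((1 / 2 : ℝ) : ℂ) + y * I) = g (((-1 / 2 : ℝ) : ℂ) + y * I) := by
    intro y
    rw [← hp (((-1 / 2 : ℝ) : ℂ) + y * I)]
    congr 1
    push_cast
    ring
  simp only [hv] at h
  simp only [mul_comm I]
  linear_combination -h

/-- An entire function with `f(z + 1) = f(z)` and `f(z + is) = -e^{-2πiz} f(z)` whose constant
Fourier coefficient vanishes is zero. -/
theorem eq_zero_of_quasiperiodic {f : ℂ → ℂ} (hf : Differentiable ℂ f) (s : ℝ)
    (h1 : ∀ z, f (z + 1) = f z)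
    (h2 : ∀ z, f (z + I * s) = -cexp (-(2 * Real.pi * I * z)) * f z)
    (h0 : ∫ x in (-1 / 2 : ℝ)..(1 / 2), f x = 0) : f = 0 := by
  -- Moving the contour by `is` and using the multiplier relates consecutive Fourier coefficients
  -- with a nonzero factor, so the constant coefficient determines all the others.
  have hrec : ∀ k : ℤ, coeff (fun x : ℝ => f x) k
      = -cexp (2 * Real.pi * k * s) * coeff (fun x : ℝ => f x) (k + 1) := by
    intro k
    have h := integral_add_mul_I_of_periodic
      (g := fun z => cexp (2 * Real.pi * I * (-k : ℤ) * z) * f z) (by fun_prop) (fun z => by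
        rw [h1, mul_add, Complex.exp_add, mul_one, mul_comm (2 * Real.pi * I) ((-k : ℤ) : ℂ),
          Complex.exp_int_mul_two_pi_mul_I, mul_one]) s
    rw [coeff]
    simp only [char]
    rw [← h, coeff, ← intervalIntegral.integral_const_mul]
    congr 1
    funext x
    rw [h2, char]
    have : cexp (2 * Real.pi * I * (-k : ℤ) * (x + I * s)) * -cexp (-(2 * Real.pi * I * x))
        = -cexp (2 * Real.pi * k * s) * cexp (2 * Real.pi * I * (-(k + 1) : ℤ) * x) := by
      rw [mul_neg, neg_mul, ← Complex.exp_add, ← Complex.exp_add]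
      congr 2
      push_cast
      linear_combination -2 * Real.pi * k * s * I_sq
    linear_combination f x * this
  have hall : ∀ k : ℤ, coeff (fun x : ℝ => f x) k = 0 := by
    intro k
    induction k using Int.induction_on with
    | zero => rw [coeff_zero_index, h0]
    | succ i ih =>
      rw [hrec] at ih
      exact (mul_eq_zero.mp ih).resolve_left (neg_ne_zero.mpr (Complex.exp_ne_zero _))
    | pred i ih => rw [hrec, sub_add_cancel, ih, mul_zero]
  have hreal : ∀ x : ℝ, f x = 0 := fun x => by
    have := eq_zero_of_coeff_eq_zero (f := fun x : ℝ => f x)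
      (hf.continuous.comp continuous_ofReal) (fun x => by
        show f ((x + 1 : ℝ) : ℂ) = f x
        rw [ofReal_add, ofReal_one, h1]) hall
    exact congrFun this x
  have hA : AnalyticOnNhd ℂ f Set.univ := hf.differentiableOn.analyticOnNhd isOpen_univ
  -- The function vanishes on the real axis, whose points accumulate at 0; the identity theorem does
  -- the rest.
  have hfr : ∃ᶠ z in nhdsWithin (0 : ℂ) {0}ᶜ, f z = 0 := by
    have ht : Filter.Tendsto (fun x : ℝ => (x : ℂ)) (nhdsWithin 0 {0}ᶜ)
        (nhdsWithin (0 : ℂ) {0}ᶜ) := by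
      refine tendsto_nhdsWithin_of_tendsto_nhds_of_eventually_within _ ?_ ?_
      · exact (continuous_ofReal.tendsto' 0 0 ofReal_zero).mono_left nhdsWithin_le_nhds
      · filter_upwards [self_mem_nhdsWithin] with x hx
        simpa using hx
    exact ht.frequently (Filter.Frequently.of_forall hreal)
  funext z
  exact hA.eqOn_zero_of_preconnected_of_frequently_eq_zero isPreconnected_univ
    (Set.mem_univ 0) hfr (Set.mem_univ z)

/-- The nome `Q = e^{-2πs}`, that is `e^{2πiτ}` for `τ = is`. -/
def nome (s : ℝ) : ℝ := Real.exp (-(2 * Real.pi * s))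

theorem nome_pos (s : ℝ) : 0 < nome s := Real.exp_pos _

theorem nome_lt_one {s : ℝ} (hs : 0 < s) : nome s < 1 :=
  Real.exp_lt_one_iff.mpr (by have := mul_pos Real.pi_pos hs; linarith)

/-- The multiplicative variable `e^{2πiz}`. -/
def expVar (z : ℂ) : ℂ := cexp (2 * Real.pi * I * z)

theorem expVar_add (z w : ℂ) : expVar (z + w) = expVar z * expVar w := by
  rw [expVar, mul_add, Complex.exp_add, expVar, expVar]

theorem expVar_neg (z : ℂ) : expVar (-z) = (expVar z)⁻¹ := by
  rw [expVar, mul_neg, Complex.exp_neg, expVar]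

theorem expVar_ne_zero (z : ℂ) : expVar z ≠ 0 := Complex.exp_ne_zero _

theorem expVar_one : expVar 1 = 1 := by
  rw [expVar, mul_one, Complex.exp_two_pi_mul_I]

theorem differentiable_expVar : Differentiable ℂ expVar := by
  unfold expVar
  fun_prop

theorem expVar_I_mul (s : ℝ) : expVar (I * s) = nome s := by
  rw [expVar, nome, ofReal_exp]
  congr 1
  push_cast
  linear_combination 2 * Real.pi * s * I_sq

/-- The product `∏_{n ≥ 0} (1 - Qⁿ w) ∏_{n ≥ 1} (1 - Qⁿ / w)`, `w = e^{2πiz}`. -/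
def thetaProd (s : ℝ) (z : ℂ) : ℂ :=
  qProd (nome s) (expVar z) * qProd (nome s) (nome s * (expVar z)⁻¹)

theorem differentiable_thetaProd {s : ℝ} (hs : 0 < s) : Differentiable ℂ (thetaProd s) := by
  have h := differentiable_qProd (nome_pos s) (nome_lt_one hs)
  have he := differentiable_expVar
  have hi : Differentiable ℂ fun z => (expVar z)⁻¹ := he.inv expVar_ne_zero
  unfold thetaProd
  exact (h.comp he).mul (h.comp (hi.const_mul _))

theorem thetaProd_add_one (s : ℝ) (z : ℂ) : thetaProd s (z + 1) = thetaProd s z := by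
  rw [thetaProd, expVar_add, expVar_one, mul_one, thetaProd]

theorem thetaProd_add {s : ℝ} (hs : 0 < s) (z : ℂ) :
    thetaProd s (z + I * s) = -cexp (-(2 * Real.pi * I * z)) * thetaProd s z := by
  have hQ0 := nome_pos s
  have hQ1 := nome_lt_one hs
  have hw := expVar_ne_zero z
  have hQ : (nome s : ℂ) ≠ 0 := ofReal_ne_zero.mpr hQ0.ne'
  rw [thetaProd, thetaProd, expVar_add, expVar_I_mul, Complex.exp_neg, ← expVar]
  have h1 := qProd_eq_mul hQ0 hQ1 (expVar z)
  have h2 := qProd_eq_mul hQ0 hQ1 (expVar z)⁻¹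
  rw [mul_comm (expVar z), mul_inv, mul_inv_cancel_left₀ hQ, h1, h2]
  field_simp
  ring

theorem expVar_half : expVar (1 / 2) = -1 := by
  rw [expVar, ← Complex.exp_pi_mul_I]
  congr 1
  ring

/-- At `z = 1/2` the variable `e^{2πiz}` is `-1`, so every factor has the form `1 + r` with `r > 0`.
-/
theorem thetaProd_half_ne_zero {s : ℝ} (hs : 0 < s) : thetaProd s (1 / 2) ≠ 0 := by
  have hQ0 := nome_pos s
  have hQ1 := nome_lt_one hs
  have key : ∀ r : ℝ, 0 < r → qProd (nome s) (-r) ≠ 0 := fun r hr =>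
    qProd_ne_zero hQ0 hQ1 fun n h => by
      have := congrArg Complex.re h
      rw [← ofReal_pow, ← ofReal_neg, ← ofReal_mul, ofReal_re, one_re] at this
      nlinarith [mul_pos (pow_pos hQ0 n) hr]
  rw [thetaProd, expVar_half, inv_neg, inv_one, mul_neg, mul_one]
  exact mul_ne_zero (by simpa using key 1 one_pos) (key _ hQ0)

theorem theta1_add_one (τ z : ℂ) : theta1 τ (z + 1) = -theta1 τ z := by
  rw [theta1_eq_jacobi, theta1_eq_jacobi, show z + 1 + τ / 2 + 1 / 2 = z + τ / 2 + 1 / 2 + 1 by ring,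
    jacobiTheta₂_add_left, mul_add, ← add_assoc, Complex.exp_add, mul_one, mul_comm I,
    Complex.exp_pi_mul_I]
  ring

theorem theta1_add_tau (τ z : ℂ) :
    theta1 τ (z + τ) = -cexp (-(Real.pi * I * τ) - 2 * Real.pi * I * z) * theta1 τ z := by
  rw [theta1_eq_jacobi, theta1_eq_jacobi,
    show z + τ + τ / 2 + 1 / 2 = z + τ / 2 + 1 / 2 + τ by ring, jacobiTheta₂_add_left']
  have : cexp (I * Real.pi * τ / 4 + I * Real.pi * (z + τ))
      * cexp (-Real.pi * I * (τ + 2 * (z + τ / 2 + 1 / 2)))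
      = -cexp (-(Real.pi * I * τ) - 2 * Real.pi * I * z)
        * cexp (I * Real.pi * τ / 4 + I * Real.pi * z) := by
    rw [neg_mul (cexp _), ← Complex.exp_add, ← Complex.exp_add, ← Complex.exp_sub_pi_mul_I]
    congr 1
    ring
  linear_combination (-I * jacobiTheta₂ (z + τ / 2 + 1 / 2) τ) * this

/-- The point `-τ/2 - 1/2` cancels the shift in Jacobi's function and leaves the sum of the positive
numbers `e^{-πn²s}`. -/
theorem exists_theta1_ne_zero {s : ℝ} (hs : 0 < s) : ∃ z, theta1 (I * s) z ≠ 0 := by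
  refine ⟨-(I * s / 2) - 1 / 2, ?_⟩
  rw [theta1_eq_jacobi, show -(I * s / 2) - 1 / 2 + I * s / 2 + 1 / 2 = (0 : ℂ) by ring]
  have hterm : ∀ n : ℤ, jacobiTheta₂_term n 0 (I * s)
      = ((Real.exp (-(Real.pi * n ^ 2 * s)) : ℝ) : ℂ) := fun n => by
    rw [jacobiTheta₂_term, ofReal_exp]
    congr 1
    push_cast
    linear_combination Real.pi * n ^ 2 * s * I_sq
  have hsum : Summable fun n : ℤ => Real.exp (-(Real.pi * n ^ 2 * s)) := by
    have h := (summable_jacobiTheta₂_term_iff 0 (I * s)).mpr (by simpa using hs)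
    simp only [hterm] at h
    exact Complex.summable_ofReal.mp h
  refine mul_ne_zero (mul_ne_zero (neg_ne_zero.mpr I_ne_zero) (Complex.exp_ne_zero _)) ?_
  rw [jacobiTheta₂]
  simp only [hterm]
  rw [← ofReal_tsum, ofReal_ne_zero]
  exact (hsum.tsum_pos (fun _ => (Real.exp_pos _).le) 0 (Real.exp_pos _)).ne'

/-- The product formula for `θ₁`, up to the normalization constant. -/
theorem exists_theta1_eq_thetaProd {s : ℝ} (hs : 0 < s) :
    ∃ c : ℂ, c ≠ 0 ∧ ∀ z, theta1 (I * s) z = c * (cexp (-(Real.pi * I * z)) * thetaProd s z) := by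
  have hτ : 0 < (I * s : ℂ).im := by simpa using hs
  set f : ℂ → ℂ := fun z => cexp (Real.pi * I * z) * theta1 (I * s) z with hf
  have hfd : Differentiable ℂ f := by
    have := differentiable_theta1 hτ
    fun_prop
  have hf1 : ∀ z, f (z + 1) = f z := fun z => by
    simp only [hf]
    rw [theta1_add_one, mul_add, Complex.exp_add, mul_one, Complex.exp_pi_mul_I]
    ring
  have hf2 : ∀ z, f (z + I * s) = -cexp (-(2 * Real.pi * I * z)) * f z := fun z => by
    simp only [hf]
    rw [theta1_add_tau]
    have : cexp (Real.pi * I * (z + I * s)) * cexp (-(Real.pi * I * (I * s)) - 2 * Real.pi * I * z)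
        = cexp (-(2 * Real.pi * I * z)) * cexp (Real.pi * I * z) := by
      rw [← Complex.exp_add, ← Complex.exp_add]
      congr 1
      ring
    linear_combination (-theta1 (I * s) z) * this
  have hPd := differentiable_thetaProd hs
  set a := ∫ x in (-1 / 2 : ℝ)..(1 / 2), f x with ha
  set b := ∫ x in (-1 / 2 : ℝ)..(1 / 2), thetaProd s x with hb
  have hb0 : b ≠ 0 := fun h => thetaProd_half_ne_zero hs (by
    rw [eq_zero_of_quasiperiodic hPd s (thetaProd_add_one s) (thetaProd_add hs) h]
    rfl)
  have ha0 : a ≠ 0 := fun h => by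
    obtain ⟨z, hz⟩ := exists_theta1_ne_zero hs
    have := congrFun (eq_zero_of_quasiperiodic hfd s hf1 hf2 h) z
    exact mul_ne_zero (Complex.exp_ne_zero _) hz this
  -- Both functions have the same multipliers, and this combination has constant coefficient `ba -
  -- ab = 0`: the space of such functions is one-dimensional.
  have hcomb : (fun z => b * f z - a * thetaProd s z) = 0 := by
    refine eq_zero_of_quasiperiodic (by fun_prop) s (fun z => ?_) (fun z => ?_) ?_
    · rw [hf1, thetaProd_add_one]
    · rw [hf2, thetaProd_add hs]
      ring
    · have c1 := hfd.continuous
      have c2 := hPd.continuous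
      rw [intervalIntegral.integral_sub, intervalIntegral.integral_const_mul,
        intervalIntegral.integral_const_mul, ← ha, ← hb]
      · ring
      all_goals exact Continuous.intervalIntegrable (by fun_prop) _ _
  refine ⟨a / b, div_ne_zero ha0 hb0, fun z => ?_⟩
  have h := congrFun hcomb z
  simp only [hf, Pi.zero_apply] at h
  rw [Complex.exp_neg]
  have he := Complex.exp_ne_zero (Real.pi * I * z)
  generalize cexp (Real.pi * I * z) = y at h he
  field_simp
  linear_combination h

/-! ### The logarithmic derivative of the theta function -/

theorem deriv_expVar (z : ℂ) : deriv expVar z = 2 * Real.pi * I * expVar z := by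
  have h : HasDerivAt (fun z : ℂ => 2 * Real.pi * I * z) (2 * Real.pi * I) z := by
    simpa using (hasDerivAt_id z).const_mul (2 * Real.pi * I : ℂ)
  rw [show expVar = fun z : ℂ => cexp (2 * Real.pi * I * z) from rfl, h.cexp.deriv, mul_comm]

theorem qProd_ne_zero_of_theta1 {s : ℝ} (hs : 0 < s) {z : ℂ} (hz : theta1 (I * s) z ≠ 0) :
    qProd (nome s) (expVar z) ≠ 0 ∧ qProd (nome s) (nome s * (expVar z)⁻¹) ≠ 0 := by
  obtain ⟨c, -, h⟩ := exists_theta1_eq_thetaProd hs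
  rw [h] at hz
  exact mul_ne_zero_iff.mp (right_ne_zero_of_mul (right_ne_zero_of_mul hz))

/-- The exponential prefactor gives the constant; the two products give the two Lambert sums, with
opposite signs because the second one depends on the inverse variable. -/
theorem logDeriv_theta1 {s : ℝ} (hs : 0 < s) {z : ℂ} (hz : theta1 (I * s) z ≠ 0) :
    logDeriv (theta1 (I * s)) z = -(Real.pi * I) - 2 * Real.pi * I *
      (lambertSum (nome s) (expVar z) - lambertSum (nome s) (nome s * (expVar z)⁻¹)) := by
  obtain ⟨c, hc, h⟩ := exists_theta1_eq_thetaProd hs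
  obtain ⟨n1, n2⟩ := qProd_ne_zero_of_theta1 hs hz
  have hQ0 := nome_pos s
  have hQ1 := nome_lt_one hs
  have hq := differentiable_qProd hQ0 hQ1
  have he := differentiable_expVar
  have hi : HasDerivAt (fun z => (nome s : ℂ) * (expVar z)⁻¹)
      (-(2 * Real.pi * I) * (nome s * (expVar z)⁻¹)) z := by
    have := ((he z).hasDerivAt.inv (expVar_ne_zero z)).const_mul (nome s : ℂ)
    rw [deriv_expVar] at this
    refine this.congr_deriv ?_
    have := expVar_ne_zero z
    field_simp
  have hx : HasDerivAt (fun z : ℂ => cexp (-(Real.pi * I * z)))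
      (cexp (-(Real.pi * I * z)) * -(Real.pi * I)) z := by
    have : HasDerivAt (fun z : ℂ => -(Real.pi * I * z)) (-(Real.pi * I)) z := by
      have := ((hasDerivAt_id z).const_mul (Real.pi * I : ℂ)).neg
      rw [mul_one] at this
      exact this
    exact this.cexp
  have d2 : DifferentiableAt ℂ (fun z => qProd (nome s) (expVar z)) z := (hq _).comp z (he z)
  have d3 : DifferentiableAt ℂ (fun z => qProd (nome s) (nome s * (expVar z)⁻¹)) z :=
    (hq _).comp z hi.differentiableAt
  have l1 : logDeriv (fun z : ℂ => cexp (-(Real.pi * I * z))) z = -(Real.pi * I) := by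
    rw [logDeriv_apply, hx.deriv, mul_div_cancel_left₀ _ (Complex.exp_ne_zero _)]
  have l2 : logDeriv (fun z => qProd (nome s) (expVar z)) z
      = logDeriv (qProd (nome s)) (expVar z) * (2 * Real.pi * I * expVar z) := by
    rw [← deriv_expVar]
    exact logDeriv_comp (hq _) (he z)
  have l3 : logDeriv (fun z => qProd (nome s) (nome s * (expVar z)⁻¹)) z
      = logDeriv (qProd (nome s)) (nome s * (expVar z)⁻¹)
        * (-(2 * Real.pi * I) * (nome s * (expVar z)⁻¹)) := by
    rw [← hi.deriv]
    exact logDeriv_comp (f := qProd (nome s)) (hq _) hi.differentiableAt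
  have hf : theta1 (I * s) = fun z => c * (cexp (-(Real.pi * I * z)) *
      (qProd (nome s) (expVar z) * qProd (nome s) (nome s * (expVar z)⁻¹))) := funext h
  have hl := logDeriv_mul (f := fun z : ℂ => cexp (-(Real.pi * I * z)))
    (g := fun z => qProd (nome s) (expVar z) * qProd (nome s) (nome s * (expVar z)⁻¹)) z
    (Complex.exp_ne_zero _) (mul_ne_zero n1 n2) hx.differentiableAt (d2.mul d3)
  have hl2 := logDeriv_mul (f := fun z => qProd (nome s) (expVar z))
    (g := fun z => qProd (nome s) (nome s * (expVar z)⁻¹)) z n1 n2 d2 d3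
  rw [hf, logDeriv_const_mul _ _ hc, hl, hl2, l1, l2, l3]
  have m1 := mul_logDeriv_qProd hQ0 hQ1 n1
  have m2 := mul_logDeriv_qProd hQ0 hQ1 n2
  linear_combination (2 * Real.pi * I) * m1 - (2 * Real.pi * I) * m2

theorem norm_expVar (z : ℂ) : ‖expVar z‖ = nome z.im := by
  rw [expVar, Complex.norm_exp, nome]
  simp [mul_assoc]

theorem nome_add (x y : ℝ) : nome (x + y) = nome x * nome y := by
  rw [nome, nome, nome, ← Real.exp_add]
  ring_nf

theorem norm_expVar_ofReal (z : ℝ) : ‖expVar z‖ = 1 := by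
  rw [norm_expVar, ofReal_im, nome, mul_zero, neg_zero, Real.exp_zero]

theorem expVar_shift (s κ z : ℝ) : expVar (z + I * s * κ) = expVar z * nome (s * κ) := by
  rw [expVar_add, ← expVar_I_mul]
  push_cast
  ring_nf

theorem expVar_shift_sub (s κ z : ℝ) : expVar (z - I * s * κ) = expVar z * (nome (s * κ) : ℂ)⁻¹ := by
  rw [sub_eq_add_neg, expVar_add, expVar_neg, ← expVar_I_mul]
  push_cast
  ring_nf

theorem nome_split (s κ : ℝ) : nome s = nome (s * κ) * nome (s * (1 - κ)) := by
  rw [← nome_add]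
  ring_nf

theorem _root_.HasSum.congr_terms {ι : Type*} {f g : ι → ℂ} {a : ℂ} (h : HasSum f a)
    (hfg : ∀ i, g i = f i) : HasSum g a := by
  rwa [show g = f from funext hfg]

section Phase

variable {s κ : ℝ} (hs : 0 < s) (hκ0 : 0 < κ) (hκ1 : κ < 1)
include hs hκ0 hκ1

/-- Since `0 < κ < 1`, both arguments of the products have modulus less than one. -/
theorem theta1_shift_ne_zero (z : ℝ) : theta1 (I * s) (z + I * s * κ) ≠ 0 := by
  obtain ⟨c, hc, h⟩ := exists_theta1_eq_thetaProd hs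
  have hQ0 := nome_pos s
  have hQ1 := nome_lt_one hs
  have n1 := norm_expVar_ofReal z
  rw [h, thetaProd, expVar_shift]
  refine mul_ne_zero hc (mul_ne_zero (Complex.exp_ne_zero _) (mul_ne_zero ?_ ?_))
  · refine qProd_ne_zero hQ0 hQ1 (pow_mul_ne_one_of_norm_lt hQ0 hQ1 ?_)
    rw [norm_mul, n1, one_mul, norm_real, Real.norm_of_nonneg (nome_pos _).le]
    exact nome_lt_one (mul_pos hs hκ0)
  · refine qProd_ne_zero hQ0 hQ1 (pow_mul_ne_one_of_norm_lt hQ0 hQ1 ?_)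
    have h0 := (nome_pos (s * κ)).ne'
    rw [norm_mul, norm_inv, norm_mul, n1, one_mul, norm_real, norm_real,
      Real.norm_of_nonneg (nome_pos _).le, Real.norm_of_nonneg (nome_pos _).le, nome_split s κ,
      mul_comm, inv_mul_cancel_left₀ h0]
    exact nome_lt_one (mul_pos hs (by linarith))

/-- The Fourier coefficients of the phase derivative, divided by `2π`. -/
def phaseCoeff (s κ : ℝ) (m : ℤ) : ℝ :=
  if m = 0 then 1 else
    (nome (s * κ) ^ m.natAbs - nome (s * (1 - κ)) ^ m.natAbs) / (1 - nome s ^ m.natAbs)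

/-- With `w = e^{2πiz}` and `r = e^{-2πsκ}`, the sum at `w/r` lies outside the unit disc. Splitting
off its first term, and adding the first term of the sum at `r/w`, costs `u/(1-u) + u⁻¹/(1-u⁻¹) =
-1` with `u = w/r`; this is where the constant mode `1` comes from. -/
theorem ofReal_phaseDeriv_shift (z : ℝ) : (phaseDeriv (I * s) (I * s * κ) z : ℂ) =
    2 * Real.pi * (1 + lambertSum (nome s) (expVar z * nome (s * κ))
      + lambertSum (nome s) ((expVar z)⁻¹ * nome (s * κ))
      - lambertSum (nome s) (expVar z * nome (s * (1 - κ)))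
      - lambertSum (nome s) ((expVar z)⁻¹ * nome (s * (1 - κ)))) := by
  have hQ0 := nome_pos s
  have hQ1 := nome_lt_one hs
  have hne := theta1_shift_ne_zero hs hκ0 hκ1
  have hne' := theta1_sub_ne (τ := I * s) (a := I * s * κ) hne
  rw [ofReal_phaseDeriv (by simp) (by simp), logDeriv_theta1 hs (hne z), logDeriv_theta1 hs (hne' z),
    expVar_shift, expVar_shift_sub]
  have he := expVar_ne_zero z
  have hr : (nome (s * κ) : ℂ) ≠ 0 := ofReal_ne_zero.mpr (nome_pos _).ne'
  have hQ : (nome s : ℂ) = nome (s * κ) * nome (s * (1 - κ)) := by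
    rw [← ofReal_mul, ← nome_split]
  have e1 := lambertSum_eq_add hQ0 hQ1 (expVar z * (nome (s * κ) : ℂ)⁻¹)
  have e2 := lambertSum_eq_add hQ0 hQ1 ((expVar z)⁻¹ * nome (s * κ))
  have f1 : (nome s : ℂ) * (expVar z * (nome (s * κ) : ℂ)⁻¹) = expVar z * nome (s * (1 - κ)) := by
    rw [hQ]
    field_simp
  have f2 : (nome s : ℂ) * (expVar z * (nome (s * κ) : ℂ)⁻¹)⁻¹
      = nome s * ((expVar z)⁻¹ * nome (s * κ)) := by
    rw [mul_inv, inv_inv]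
  have f3 : (nome s : ℂ) * (expVar z * (nome (s * κ) : ℂ))⁻¹
      = (expVar z)⁻¹ * nome (s * (1 - κ)) := by
    rw [hQ]
    field_simp
  rw [f1] at e1
  rw [f2, f3, e1, e2]
  have hx : expVar z ≠ nome (s * κ) := by
    intro h
    have := norm_expVar_ofReal z
    rw [h, norm_real, Real.norm_of_nonneg (nome_pos _).le] at this
    exact (nome_lt_one (mul_pos hs hκ0)).ne this
  have h5 : expVar z * (nome (s * κ) : ℂ)⁻¹ / (1 - expVar z * (nome (s * κ) : ℂ)⁻¹)
      + (expVar z)⁻¹ * nome (s * κ) / (1 - (expVar z)⁻¹ * nome (s * κ)) = -1 := by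
    have g1 : 1 - expVar z * (nome (s * κ) : ℂ)⁻¹ ≠ 0 := by
      intro h
      apply hx
      field_simp at h
      linear_combination -h
    have g2 : 1 - (expVar z)⁻¹ * (nome (s * κ) : ℂ) ≠ 0 := by
      intro h
      apply hx
      field_simp at h
      linear_combination h
    rw [div_add_div _ _ g1 g2, div_eq_iff (mul_ne_zero g1 g2)]
    field_simp
    ring
  linear_combination (-2 * Real.pi) * h5
    + 2 * Real.pi * (-lambertSum (nome s) (expVar z * nome (s * κ))
      + lambertSum (nome s) ((expVar z)⁻¹ * nome (s * (1 - κ)))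
      + expVar z * (nome (s * κ) : ℂ)⁻¹ / (1 - expVar z * (nome (s * κ) : ℂ)⁻¹)
      + lambertSum (nome s) (expVar z * nome (s * (1 - κ)))
      - lambertSum (nome s) (nome s * ((expVar z)⁻¹ * nome (s * κ)))) * I_sq

theorem hasSum_phaseDeriv (z : ℝ) : HasSum (fun m : ℤ => (phaseCoeff s κ m : ℂ) * char m z)
    ((phaseDeriv (I * s) (I * s * κ) z / (2 * Real.pi) : ℝ) : ℂ) := by
  have hQ0 := nome_pos s
  have hQ1 := nome_lt_one hs
  have key : ∀ {e : ℂ}, ‖e‖ = 1 → HasSum (fun n : ℕ => (((nome (s * κ) ^ (n + 1)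
      - nome (s * (1 - κ)) ^ (n + 1)) / (1 - nome s ^ (n + 1)) : ℝ) : ℂ) * e ^ (n + 1))
      (lambertSum (nome s) (e * nome (s * κ)) - lambertSum (nome s) (e * nome (s * (1 - κ)))) := by
    intro e he
    have hb : ∀ x : ℝ, 0 < x → ‖e * nome x‖ < 1 := fun x hx => by
      rw [norm_mul, he, one_mul, norm_real, Real.norm_of_nonneg (nome_pos _).le]
      exact nome_lt_one hx
    have h := (hasSum_lambertSum hQ0 hQ1 (hb _ (mul_pos hs hκ0))).sub
      (hasSum_lambertSum hQ0 hQ1 (hb _ (mul_pos hs (by linarith : 0 < 1 - κ))))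
    refine h.congr_terms fun n => ?_
    push_cast
    ring
  have hch : ∀ n : ℕ, char n z = expVar z ^ n := fun n => by
    rw [char, expVar, ← Complex.exp_nat_mul]
    push_cast
    ring_nf
  have hch' : ∀ n : ℕ, char (-n) z = (expVar z)⁻¹ ^ n := fun n => by
    rw [char, ← expVar_neg, expVar, ← Complex.exp_nat_mul]
    push_cast
    ring_nf
  have c1 : ∀ n : ℕ, phaseCoeff s κ ((n : ℤ) + 1) = (nome (s * κ) ^ (n + 1)
      - nome (s * (1 - κ)) ^ (n + 1)) / (1 - nome s ^ (n + 1)) := fun n => by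
    rw [phaseCoeff, if_neg (by omega), show ((n : ℤ) + 1).natAbs = n + 1 by omega]
  have c2 : ∀ n : ℕ, phaseCoeff s κ (-((n : ℤ) + 1)) = (nome (s * κ) ^ (n + 1)
      - nome (s * (1 - κ)) ^ (n + 1)) / (1 - nome s ^ (n + 1)) := fun n => by
    rw [phaseCoeff, if_neg (by omega), show (-((n : ℤ) + 1)).natAbs = n + 1 by omega]
  have h1 := key (norm_expVar_ofReal z)
  have h2 := key (e := (expVar z)⁻¹) (by rw [norm_inv, norm_expVar_ofReal, inv_one])
  have h := HasSum.of_add_one_of_neg_add_one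
    (f := fun m : ℤ => (phaseCoeff s κ m : ℂ) * char m z)
    (h1.congr_terms fun n => by
      rw [c1, ← hch]
      push_cast
      rfl)
    (h2.congr_terms fun n => by
      rw [c2, ← hch']
      push_cast
      rfl)
  convert h using 1
  rw [ofReal_div, ofReal_phaseDeriv_shift hs hκ0 hκ1, phaseCoeff, if_pos rfl, char_zero]
  have := Real.pi_ne_zero
  push_cast
  field_simp
  ring

end Phase

/-! ### The normalized phase derivative and its sign -/

/-- The phase derivative for `τ = is` and shift `isκ`, divided by `2π`; its mean is `1`. -/
def unitPhase (s κ z : ℝ) : ℝ := phaseDeriv (I * s) (I * s * κ) z / (2 * Real.pi)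

section UnitPhase

variable {s κ : ℝ} (hs : 0 < s) (hκ0 : 0 < κ) (hκ1 : κ < 1)

theorem unitPhase_neg (s κ z : ℝ) : unitPhase s κ (-z) = unitPhase s κ z := by
  have hodd : ∀ w, logDeriv (theta1 (I * s)) (-w) = -logDeriv (theta1 (I * s)) w := by
    intro w
    have h : (fun z => theta1 (I * s) (-z)) = fun z => -theta1 (I * s) z :=
      funext (theta1_neg _)
    have hd : deriv (theta1 (I * s)) (-w) = deriv (theta1 (I * s)) w := by
      have h1 := deriv_comp_neg (theta1 (I * s)) w
      rw [h, deriv.fun_neg] at h1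
      exact (neg_injective h1).symm
    rw [logDeriv_apply, logDeriv_apply, hd, theta1_neg, div_neg]
  rw [unitPhase, unitPhase, phaseDeriv, phaseDeriv, ofReal_neg,
    show (-z : ℂ) + I * s * κ = -(z - I * s * κ) by ring,
    show (-z : ℂ) - I * s * κ = -(z + I * s * κ) by ring, hodd, hodd]
  ring_nf

include hs hκ0 hκ1

/-- At `z = 0` all characters equal one, and in `ℂ` unconditional convergence is absolute. -/
theorem summable_phaseCoeff : Summable fun m : ℤ => ‖(phaseCoeff s κ m : ℂ)‖ := by
  have h := (hasSum_phaseDeriv hs hκ0 hκ1 0).summable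
  have h2 := summable_norm_iff.mpr h
  simpa only [norm_mul, norm_char, mul_one] using h2

theorem ofReal_unitPhase (z : ℝ) :
    (unitPhase s κ z : ℂ) = ∑' m : ℤ, (phaseCoeff s κ m : ℂ) * char m z :=
  (hasSum_phaseDeriv hs hκ0 hκ1 z).tsum_eq.symm

theorem unitPhase_periodic : Function.Periodic (unitPhase s κ) 1 := fun z => by
  rw [← ofReal_inj, ofReal_unitPhase hs hκ0 hκ1, ofReal_unitPhase hs hκ0 hκ1]
  exact periodic_charSeries _ z

theorem coeff_unitPhase (m : ℤ) :
    coeff (fun z => (unitPhase s κ z : ℂ)) m = phaseCoeff s κ m := by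
  simp only [ofReal_unitPhase hs hκ0 hκ1]
  exact coeff_charSeries (summable_phaseCoeff hs hκ0 hκ1) m

theorem contDiff_unitPhase : ContDiff ℝ ∞ (unitPhase s κ) := by
  have hd := differentiable_theta1 (τ := I * s) (by simpa using hs)
  have hne := theta1_shift_ne_zero hs hκ0 hκ1
  have hne' := theta1_sub_ne (τ := I * s) (a := I * s * κ) hne
  have c1 : ContDiff ℝ ∞ (theta1 (I * s)) := (hd.contDiff (n := ∞)).restrict_scalars ℝ
  have c2 : ContDiff ℝ ∞ (deriv (theta1 (I * s))) := by
    have h2 : Differentiable ℂ (deriv (theta1 (I * s))) := by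
      rw [← differentiableOn_univ] at hd ⊢
      exact hd.deriv isOpen_univ
    exact (h2.contDiff (n := ∞)).restrict_scalars ℝ
  have o : ContDiff ℝ ∞ fun z : ℝ => (z : ℂ) := ofRealCLM.contDiff
  have l1 : ContDiff ℝ ∞ fun z : ℝ => logDeriv (theta1 (I * s)) (z + I * s * κ) := by
    simp only [logDeriv_apply, div_eq_mul_inv]
    exact (c2.comp (o.add contDiff_const)).mul
      ((c1.comp (o.add contDiff_const)).inv hne)
  have l2 : ContDiff ℝ ∞ fun z : ℝ => logDeriv (theta1 (I * s)) (z - I * s * κ) := by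
    simp only [logDeriv_apply, div_eq_mul_inv]
    exact (c2.comp (o.sub contDiff_const)).mul
      ((c1.comp (o.sub contDiff_const)).inv hne')
  exact (reCLM.contDiff.comp (contDiff_const.mul (l1.sub l2))).div_const _

theorem continuous_unitPhase : Continuous (unitPhase s κ) :=
  (contDiff_unitPhase hs hκ0 hκ1).continuous

theorem integral_unitPhase : ∫ z in (-1 / 2 : ℝ)..(1 / 2), unitPhase s κ z = 1 := by
  have h := coeff_unitPhase hs hκ0 hκ1 0
  rw [coeff_zero_index, intervalIntegral.integral_ofReal] at h
  simpa [phaseCoeff] using h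

omit hκ0 hκ1 in
/-- The modular transformation of `θ₁`. -/
theorem exists_theta1_modular : ∃ A : ℂ, A ≠ 0 ∧ ∀ z, theta1 (I * s) z =
    A * (cexp (-(Real.pi * I * z ^ 2 / (I * s))) * theta1 (I * (s⁻¹ : ℝ)) (z / (I * s))) := by
  have hτ0 : (I * s : ℂ) ≠ 0 := mul_ne_zero I_ne_zero (ofReal_ne_zero.mpr hs.ne')
  have hinv : (I * (s⁻¹ : ℝ) : ℂ) = -1 / (I * s) := by
    have := ofReal_ne_zero.mpr hs.ne'
    push_cast
    field_simp
    exact I_sq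
  rw [hinv]
  generalize hτ : (I * s : ℂ) = τ at *
  refine ⟨1 / (-I * τ) ^ (1 / 2 : ℂ) * cexp (Real.pi * I / 2), ?_, fun z => ?_⟩
  · refine mul_ne_zero (one_div_ne_zero ?_) (Complex.exp_ne_zero _)
    rw [Complex.cpow_ne_zero_iff]
    exact Or.inl (mul_ne_zero (neg_ne_zero.mpr I_ne_zero) hτ0)
  · rw [theta1_eq_jacobi, theta1_eq_jacobi, jacobiTheta₂_functional_equation,
      show z / τ + -1 / τ / 2 + 1 / 2 = (z + τ / 2 + 1 / 2) / τ + -1 / τ by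
        field_simp
        ring, jacobiTheta₂_add_left']
    have : cexp (I * Real.pi * τ / 4 + I * Real.pi * z)
        * cexp (-Real.pi * I * (z + τ / 2 + 1 / 2) ^ 2 / τ)
        = cexp (Real.pi * I / 2) * cexp (-(Real.pi * I * z ^ 2 / τ))
          * cexp (I * Real.pi * (-1 / τ) / 4 + I * Real.pi * (z / τ))
          * cexp (-Real.pi * I * (-1 / τ + 2 * ((z + τ / 2 + 1 / 2) / τ))) := by
      simp only [← Complex.exp_add]
      rw [Complex.exp_eq_exp_iff_exists_int]
      refine ⟨0, ?_⟩
      field_simp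
      ring
    linear_combination (-I * (1 / (-I * τ) ^ (1 / 2 : ℂ))
      * jacobiTheta₂ ((z + τ / 2 + 1 / 2) / τ) (-1 / τ)) * this

omit hκ0 hκ1 in
-- The Gaussian factor gives a term linear in `z`, which becomes the constant `2κ` in the difference
-- between the shifts `±isκ`.
theorem logDeriv_theta1_modular {z : ℂ} (hz : theta1 (I * s) z ≠ 0) :
    logDeriv (theta1 (I * s)) z = -(2 * Real.pi * I * z / (I * s))
      + logDeriv (theta1 (I * (s⁻¹ : ℝ))) (z / (I * s)) / (I * s) := by
  obtain ⟨A, hA, h⟩ := exists_theta1_modular hs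
  have hd := differentiable_theta1 (τ := I * (s⁻¹ : ℝ)) (by simpa using hs)
  have hτ0 : (I * s : ℂ) ≠ 0 := mul_ne_zero I_ne_zero (ofReal_ne_zero.mpr hs.ne')
  have hz' := hz
  rw [h] at hz'
  have n2 : theta1 (I * (s⁻¹ : ℝ)) (z / (I * s)) ≠ 0 :=
    right_ne_zero_of_mul (right_ne_zero_of_mul hz')
  have hg : HasDerivAt (fun z : ℂ => z / (I * s)) (1 / (I * s)) z :=
    (hasDerivAt_id z).div_const _
  have hq : HasDerivAt (fun z : ℂ => -(Real.pi * I * z ^ 2 / (I * s)))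
      (-(2 * Real.pi * I * z / (I * s))) z := by
    have := ((((hasDerivAt_id z).pow 2).const_mul (Real.pi * I : ℂ)).div_const (I * s : ℂ)).neg
    refine this.congr_deriv ?_
    simp only [id]
    push_cast
    ring
  have hx := hq.cexp
  have l1 : logDeriv (fun z : ℂ => cexp (-(Real.pi * I * z ^ 2 / (I * s)))) z
      = -(2 * Real.pi * I * z / (I * s)) := by
    rw [logDeriv_apply, hx.deriv, mul_div_cancel_left₀ _ (Complex.exp_ne_zero _)]
  have l2 : logDeriv (fun z : ℂ => theta1 (I * (s⁻¹ : ℝ)) (z / (I * s))) z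
      = logDeriv (theta1 (I * (s⁻¹ : ℝ))) (z / (I * s)) * (1 / (I * s)) := by
    rw [← hg.deriv]
    exact logDeriv_comp (f := theta1 (I * (s⁻¹ : ℝ))) (hd _) hg.differentiableAt
  have hl := logDeriv_mul (f := fun z : ℂ => cexp (-(Real.pi * I * z ^ 2 / (I * s))))
    (g := fun z : ℂ => theta1 (I * (s⁻¹ : ℝ)) (z / (I * s))) z (Complex.exp_ne_zero _) n2
    hx.differentiableAt ((hd _).comp z hg.differentiableAt)
  have hf : theta1 (I * s) = fun z => A * (cexp (-(Real.pi * I * z ^ 2 / (I * s))) *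
      theta1 (I * (s⁻¹ : ℝ)) (z / (I * s))) := funext h
  rw [hf, logDeriv_const_mul _ _ hA, hl, l1, l2]
  ring

end UnitPhase

theorem conj_lambertSum (Q : ℝ) (w : ℂ) :
    lambertSum Q (starRingEnd ℂ w) = starRingEnd ℂ (lambertSum Q w) := by
  rw [lambertSum, lambertSum, Complex.conj_tsum]
  simp

/-- The map `x ↦ x/(1-x) = 1/(1-x) - 1` preserves the sign of the imaginary part; all positivity
statements rest on this. -/
theorem im_div_one_sub (x : ℂ) : (x / (1 - x)).im = x.im / normSq (1 - x) := by
  rw [Complex.div_im]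
  simp
  ring

section Sign

variable {Q : ℝ} (hQ0 : 0 < Q) (hQ1 : Q < 1)
include hQ0 hQ1

theorem hasSum_im_lambertSum (w : ℂ) :
    HasSum (fun n : ℕ => Q ^ n * w.im / normSq (1 - (Q : ℂ) ^ n * w)) (lambertSum Q w).im := by
  have h := Complex.hasSum_im (summable_lambertSum hQ0 hQ1 (w := w)).hasSum
  simp only [im_div_one_sub, ← ofReal_pow, im_ofReal_mul] at h
  simpa only [lambertSum, ← ofReal_pow] using h

theorem im_lambertSum_nonneg {w : ℂ} (hw : 0 ≤ w.im) : 0 ≤ (lambertSum Q w).im :=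
  (hasSum_im_lambertSum hQ0 hQ1 w).nonneg fun n =>
    div_nonneg (mul_nonneg (pow_nonneg hQ0.le n) hw) (normSq_nonneg _)

theorem im_lambertSum_pos {w : ℂ} (hw : 0 < w.im) : 0 < (lambertSum Q w).im := by
  have h := hasSum_im_lambertSum hQ0 hQ1 w
  rw [← h.tsum_eq]
  refine h.summable.tsum_pos (fun n =>
    div_nonneg (mul_nonneg (pow_nonneg hQ0.le n) hw.le) (normSq_nonneg _)) 0 ?_
  rw [pow_zero, pow_zero, one_mul, one_mul]
  refine div_pos hw (normSq_pos.mpr fun h => ?_)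
  have := congrArg Complex.im h
  simp at this
  linarith

theorem im_lambertSum_nonpos {w : ℂ} (hw : w.im ≤ 0) : (lambertSum Q w).im ≤ 0 := by
  have h := im_lambertSum_nonneg hQ0 hQ1 (w := starRingEnd ℂ w) (by simpa using hw)
  rw [conj_lambertSum, conj_im] at h
  linarith

end Sign

section UnitPhaseSign

variable {s κ : ℝ} (hs : 0 < s) (hκ0 : 0 < κ) (hκ1 : κ < 1)
include hs hκ0 hκ1

/-- In the dual variable the shifts `±isκ` become `±κ`, and `z/(is)` is purely imaginary. The two
exponentials are thus complex conjugate, and the difference of logarithmic derivatives is twice an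
imaginary part. -/
theorem unitPhase_eq_im (z : ℝ) : unitPhase s κ z = 2 * κ + 2 / s *
    ((lambertSum (nome s⁻¹) (expVar (z / (I * s) + κ))).im
      - (lambertSum (nome s⁻¹) (nome s⁻¹ * (expVar (z / (I * s) + κ))⁻¹)).im) := by
  have hs0 : (s : ℂ) ≠ 0 := ofReal_ne_zero.mpr hs.ne'
  have hτ0 : (I * s : ℂ) ≠ 0 := mul_ne_zero I_ne_zero hs0
  have hsi : 0 < s⁻¹ := inv_pos.mpr hs
  have hne := theta1_shift_ne_zero hs hκ0 hκ1 z
  have hne' := theta1_sub_ne (τ := I * s) (a := I * s * κ) (theta1_shift_ne_zero hs hκ0 hκ1) z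
  obtain ⟨A, hA, h⟩ := exists_theta1_modular hs
  have n1 : ∀ {z : ℂ}, theta1 (I * s) z ≠ 0 → theta1 (I * (s⁻¹ : ℝ)) (z / (I * s)) ≠ 0 := by
    intro z hz
    rw [h] at hz
    exact right_ne_zero_of_mul (right_ne_zero_of_mul hz)
  have ep : ((z : ℂ) + I * s * κ) / (I * s) = z / (I * s) + κ := by field_simp
  have em : ((z : ℂ) - I * s * κ) / (I * s) = z / (I * s) - κ := by field_simp
  have hconj : expVar (z / (I * s) - κ) = starRingEnd ℂ (expVar (z / (I * s) + κ)) := by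
    rw [expVar, expVar, ← Complex.exp_conj]
    congr 1
    simp only [map_mul, map_add, map_div₀, conj_I, conj_ofReal, map_ofNat]
    field_simp
    ring
  set X := lambertSum (nome s⁻¹) (expVar (z / (I * s) + κ))
    - lambertSum (nome s⁻¹) (nome s⁻¹ * (expVar (z / (I * s) + κ))⁻¹) with hX
  have hXc : lambertSum (nome s⁻¹) (expVar (z / (I * s) - κ))
    - lambertSum (nome s⁻¹) (nome s⁻¹ * (expVar (z / (I * s) - κ))⁻¹) = starRingEnd ℂ X := by
    rw [hX, map_sub, ← conj_lambertSum, ← conj_lambertSum, hconj, map_mul, map_inv₀, conj_ofReal]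
  have hdiff : X - starRingEnd ℂ X = 2 * I * X.im := by
    apply Complex.ext <;> simp
    ring
  rw [← sub_im, ← hX, ← ofReal_inj, unitPhase, ofReal_div,
    ofReal_phaseDeriv (by simp) (by simp), logDeriv_theta1_modular hs hne,
    logDeriv_theta1_modular hs hne', logDeriv_theta1 hsi (n1 hne), logDeriv_theta1 hsi (n1 hne'),
    ep, em, ← hX, hXc]
  have hpi : (Real.pi : ℂ) ≠ 0 := ofReal_ne_zero.mpr Real.pi_ne_zero
  push_cast
  field_simp
  linear_combination (-2 * I) * hdiff - 4 * (s * κ + X.im) * I_sq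

omit hκ0 hκ1 in
theorem expVar_im (z : ℝ) : (expVar (z / (I * s) + κ)).im
    = Real.exp (2 * Real.pi * z / s) * Real.sin (2 * Real.pi * κ) := by
  have hs0 : (s : ℂ) ≠ 0 := ofReal_ne_zero.mpr hs.ne'
  have : 2 * Real.pi * I * (z / (I * s) + κ)
      = ((2 * Real.pi * z / s : ℝ) : ℂ) + ((2 * Real.pi * κ : ℝ) : ℂ) * I := by
    push_cast
    field_simp
  rw [expVar, this, Complex.exp_im]
  simp

omit hs hκ0 hκ1 in
theorem im_mul_inv (r : ℝ) (w : ℂ) : ((r : ℂ) * w⁻¹).im = -(r * w.im / normSq w) := by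
  rw [im_ofReal_mul, Complex.inv_im]
  ring

/-- For `0 < κ < 1/2` one has `sin 2πκ > 0`, so the dual variable is in the upper half-plane and its
inverse in the lower one: both Lambert sums contribute with the same sign. -/
theorem two_mul_lt_unitPhase (hκ : κ < 1 / 2) (z : ℝ) : 2 * κ < unitPhase s κ z := by
  have hsi : 0 < s⁻¹ := inv_pos.mpr hs
  have hw : 0 < (expVar (z / (I * s) + κ)).im := by
    rw [expVar_im hs]
    refine mul_pos (Real.exp_pos _) (Real.sin_pos_of_pos_of_lt_pi ?_ ?_)
    · have := Real.pi_pos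
      positivity
    · nlinarith [Real.pi_pos]
  have h1 := im_lambertSum_pos (nome_pos s⁻¹) (nome_lt_one hsi) hw
  have h2 := im_lambertSum_nonpos (nome_pos s⁻¹) (nome_lt_one hsi)
    (w := nome s⁻¹ * (expVar (z / (I * s) + κ))⁻¹) (by
      rw [im_mul_inv, neg_nonpos]
      exact div_nonneg (mul_nonneg (nome_pos _).le hw.le) (normSq_nonneg _))
  rw [unitPhase_eq_im hs hκ0 hκ1]
  have : 0 < 2 / s := by positivity
  nlinarith

theorem unitPhase_le_two_mul (hκ : 1 / 2 ≤ κ) (z : ℝ) : unitPhase s κ z ≤ 2 * κ := by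
  have hsi : 0 < s⁻¹ := inv_pos.mpr hs
  have hw : (expVar (z / (I * s) + κ)).im ≤ 0 := by
    rw [expVar_im hs]
    refine mul_nonpos_of_nonneg_of_nonpos (Real.exp_pos _).le ?_
    rw [← neg_nonneg, ← Real.sin_sub_pi]
    exact Real.sin_nonneg_of_nonneg_of_le_pi (by nlinarith [Real.pi_pos])
      (by nlinarith [Real.pi_pos])
  have h1 := im_lambertSum_nonpos (nome_pos s⁻¹) (nome_lt_one hsi) hw
  have h2 := im_lambertSum_nonneg (nome_pos s⁻¹) (nome_lt_one hsi)
    (w := nome s⁻¹ * (expVar (z / (I * s) + κ))⁻¹) (by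
      rw [im_mul_inv, neg_nonneg]
      exact div_nonpos_of_nonpos_of_nonneg (mul_nonpos_of_nonneg_of_nonpos (nome_pos _).le hw)
        (normSq_nonneg _))
  rw [unitPhase_eq_im hs hκ0 hκ1]
  have : 0 < 2 / s := by positivity
  nlinarith

end UnitPhaseSign

/-! ### Periodic functions and smoothness of convolutions -/

theorem exists_norm_le_of_periodic {E : Type*} [NormedAddCommGroup E] {f : ℝ → E}
    (hf : Continuous f) (hp : Function.Periodic f 1) : ∃ C, ∀ x, ‖f x‖ ≤ C := by
  obtain ⟨C, hC⟩ := (isCompact_Icc (a := (0 : ℝ)) (b := 1)).exists_bound_of_continuousOn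
    hf.continuousOn
  refine ⟨C, fun x => ?_⟩
  obtain ⟨y, hy, hxy⟩ := hp.exists_mem_Ico₀ one_pos x
  rw [hxy]
  exact hC y (Set.Ico_subset_Icc_self hy)

theorem periodic_deriv {E : Type*} [NormedAddCommGroup E] [NormedSpace ℝ E] {f : ℝ → E}
    (hp : Function.Periodic f 1) : Function.Periodic (deriv f) 1 := fun x => by
  rw [← deriv_comp_add_const, show (fun x => f (x + 1)) = f from funext hp]

theorem hasDerivAt_conv {f g : ℝ → ℂ} (hf : ContDiff ℝ 1 f) (hp : Function.Periodic f 1)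
    (hg : Continuous g) (z : ℝ) : HasDerivAt (conv f g) (conv (deriv f) g z) z := by
  have hfc := hf.continuous
  have hfd : Continuous (deriv f) := hf.continuous_deriv le_rfl
  obtain ⟨C, hC⟩ := exists_norm_le_of_periodic hfd (periodic_deriv hp)
  refine (intervalIntegral.hasDerivAt_integral_of_dominated_loc_of_deriv_le
    (F := fun z w => f (z - w) * g w) (F' := fun z w => deriv f (z - w) * g w)
    (bound := fun w => C * ‖g w‖) (s := Set.univ) Filter.univ_mem ?_ ?_ ?_ ?_ ?_ ?_).2
  · exact Filter.Eventually.of_forall fun x => Continuous.aestronglyMeasurable (by fun_prop)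
  · exact Continuous.intervalIntegrable (by fun_prop) _ _
  · exact Continuous.aestronglyMeasurable (by fun_prop)
  · refine Filter.Eventually.of_forall fun w _ x _ => ?_
    rw [norm_mul]
    gcongr
    exact hC _
  · exact Continuous.intervalIntegrable (by fun_prop) _ _
  · refine Filter.Eventually.of_forall fun w _ x _ => ?_
    have h := ((hf.differentiable one_ne_zero) (x - w)).hasDerivAt.comp_sub_const x w
    exact h.mul_const _

/-- All derivatives fall on the first factor, so the second one need only be continuous. -/
theorem contDiff_conv {f g : ℝ → ℂ} (hf : ContDiff ℝ ∞ f) (hp : Function.Periodic f 1)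
    (hg : Continuous g) : ContDiff ℝ ∞ (conv f g) := by
  rw [contDiff_infty]
  intro n
  induction n generalizing f with
  | zero =>
    rw [Nat.cast_zero, contDiff_zero]
    exact continuous_conv hf.continuous hg
  | succ n ih =>
    have hd := hasDerivAt_conv (hf.of_le (by exact_mod_cast le_top)) hp hg
    rw [Nat.cast_add, Nat.cast_one, contDiff_succ_iff_deriv]
    refine ⟨fun z => (hd z).differentiableAt, by simp, ?_⟩
    rw [show deriv (conv f g) = conv (deriv f) g from funext fun z => (hd z).deriv]
    exact ih (contDiff_infty_iff_deriv.mp hf).2 (periodic_deriv hp)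

theorem ofReal_integral_conv (f g : ℝ → ℝ) (z : ℝ) :
    ((∫ w in (-1 / 2 : ℝ)..(1 / 2), f (z - w) * g w : ℝ) : ℂ)
      = conv (fun w => (f w : ℂ)) (fun w => (g w : ℂ)) z := by
  rw [conv, ← intervalIntegral.integral_ofReal]
  simp only [ofReal_mul]

theorem eq_of_coeff_ofReal_eq {f g : ℝ → ℝ} (hf : Continuous f) (hfp : Function.Periodic f 1)
    (hg : Continuous g) (hgp : Function.Periodic g 1)
    (h : ∀ m, coeff (fun x => (f x : ℂ)) m = coeff (fun x => (g x : ℂ)) m) : f = g := by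
  have := eq_of_coeff_eq (f := fun x => (f x : ℂ)) (g := fun x => (g x : ℂ)) (by fun_prop)
    (fun x => by simp only [hfp x]) (by fun_prop) (fun x => by simp only [hgp x]) h
  funext x
  exact ofReal_injective (congrFun this x)

theorem coeff_comp_sub {f : ℝ → ℂ} (hf : Function.Periodic f 1) (a : ℝ) (m : ℤ) :
    coeff (fun x => f (x - a)) m = char (-m) a * coeff f m := by
  have h : ∀ x, char (-m) x * f (x - a)
      = char (-m) a * (fun y => char (-m) y * f y) (x - a) := fun x => by
    have := char_add (-m) (x - a) a
    rw [sub_add_cancel] at this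
    rw [this]
    ring
  simp only [coeff, h, intervalIntegral.integral_const_mul]
  congr 1
  exact integral_period_sub (f := fun y => char (-m) y * f y) ((char_periodic _).mul hf) a

/-! ### The root density and the kernel -/

theorem nome_half_sq (x : ℝ) : nome x = nome (x / 2) ^ 2 := by
  rw [pow_two, ← nome_add, add_halves]

section Kernel

variable {s η : ℝ} (hs : 0 < s) (hη0 : 0 < η) (hη1 : η < 1)

/-- The density of Bethe roots. -/
def rootDensity (s η z : ℝ) : ℝ := unitPhase (2 * s * η) (1 / 4) z - 1 / 2

theorem rootDensity_neg (s η z : ℝ) : rootDensity s η (-z) = rootDensity s η z := by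
  rw [rootDensity, unitPhase_neg, rootDensity]

/-- The Fourier coefficients of the kernels for a nonzero index, in terms of
`x = e^{-πsη|m|}` and `y = e^{-2πs|m|}`. -/
theorem exists_coeff_variables (hs : 0 < s) (hη0 : 0 < η) (hη1 : η < 1) {m : ℤ} (hm : m ≠ 0) :
    ∃ x y : ℝ, 0 < x ∧ x < 1 ∧ 0 < y ∧ y < 1 ∧ y < x ^ 2 ∧
      phaseCoeff s (η / 2) m = (x - y / x) / (1 - y) ∧
      phaseCoeff s η m = (x ^ 2 - y / x ^ 2) / (1 - y) ∧
      phaseCoeff (2 * s * η) (1 / 4) m = x / (1 + x ^ 2) ∧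
      phaseCoeff (s * (1 - η)) (η / (2 * (1 - η))) m = (x - y / x ^ 3) / (1 - y / x ^ 2) := by
  have hk : m.natAbs ≠ 0 := Int.natAbs_ne_zero.mpr hm
  set k := m.natAbs with hkdef
  have hsη : 0 < s * η := mul_pos hs hη0
  have hpow : ∀ a : ℝ, 0 < a → nome a ^ k < 1 := fun a ha =>
    pow_lt_one₀ (nome_pos a).le (nome_lt_one ha) hk
  set x := nome (s * η / 2) ^ k with hx
  set y := nome s ^ k with hy
  have hx0 : 0 < x := pow_pos (nome_pos _) k
  have hy0 : 0 < y := pow_pos (nome_pos _) k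
  have hx1 : x < 1 := hpow _ (by positivity)
  have hx2 : nome (s * η) ^ k = x ^ 2 := by
    rw [nome_half_sq (s * η), hx, ← pow_mul, ← pow_mul, Nat.mul_comm 2 k]
  have hmul : ∀ a b : ℝ, nome (a + b) ^ k = nome a ^ k * nome b ^ k := fun a b => by
    rw [nome_add, mul_pow]
  have hsplit : y = x ^ 2 * nome (s * (1 - η)) ^ k := by
    rw [← hx2, ← hmul, hy]
    ring_nf
  have hd : nome (s * (1 - η)) ^ k = y / x ^ 2 := by
    rw [hsplit, mul_div_cancel_left₀ _ (by positivity)]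
  have hyx : y < x ^ 2 := by
    have := hpow (s * (1 - η)) (mul_pos hs (by linarith))
    rw [hsplit]
    nlinarith [pow_pos hx0 2]
  have hη : 1 - η ≠ 0 := by linarith
  refine ⟨x, y, hx0, hx1, hy0, hpow _ hs, hyx, ?_, ?_, ?_, ?_⟩
  · have : nome (s * (1 - η / 2)) ^ k = y / x := by
      rw [show s * (1 - η / 2) = s * η / 2 + s * (1 - η) by ring, hmul, hd, ← hx]
      field_simp
    rw [phaseCoeff, if_neg hm, ← hkdef, this, show s * (η / 2) = s * η / 2 by ring]
  · rw [phaseCoeff, if_neg hm, ← hkdef, hd, hx2]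
  · have h3 : nome (2 * s * η * (1 - 1 / 4)) ^ k = x ^ 3 := by
      rw [show 2 * s * η * (1 - 1 / 4) = s * η + s * η / 2 by ring, hmul, hx2]
      ring
    have h4 : nome (2 * s * η) ^ k = x ^ 4 := by
      rw [show 2 * s * η = s * η + s * η by ring, hmul, hx2]
      ring
    rw [phaseCoeff, if_neg hm, ← hkdef, h3, h4, show 2 * s * η * (1 / 4) = s * η / 2 by ring,
      ← hx, div_eq_div_iff (by nlinarith [pow_lt_one₀ hx0.le hx1 (n := 4) (by norm_num)])
      (by positivity)]
    ring
  · have h5 : s * (1 - η) * (η / (2 * (1 - η))) = s * η / 2 := by field_simp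
    have h6 : nome (s * (1 - η) * (1 - η / (2 * (1 - η)))) ^ k = y / x ^ 3 := by
      have e : nome (s * (1 - η)) ^ k
          = nome (s * η / 2) ^ k * nome (s * (1 - η) * (1 - η / (2 * (1 - η)))) ^ k := by
        rw [← hmul, mul_sub (s * (1 - η)), h5]
        congr 2
        ring
      rw [hd, ← hx] at e
      rw [eq_div_iff (by positivity)]
      rw [div_eq_iff (by positivity)] at e
      linear_combination -e
    rw [phaseCoeff, if_neg hm, ← hkdef, h5, h6, hd, ← hx]

include hs hη0

theorem contDiff_rootDensity : ContDiff ℝ ∞ (rootDensity s η) :=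
  (contDiff_unitPhase (by positivity) (by norm_num) (by norm_num)).sub contDiff_const

theorem continuous_rootDensity : Continuous (rootDensity s η) :=
  (contDiff_rootDensity hs hη0).continuous

theorem rootDensity_periodic : Function.Periodic (rootDensity s η) 1 := fun z => by
  rw [rootDensity, unitPhase_periodic (by positivity) (by norm_num) (by norm_num), rootDensity]

/-- The subtracted constant `1/2` is the bound `2κ` at `κ = 1/4`. -/
theorem rootDensity_pos (z : ℝ) : 0 < rootDensity s η z := by
  have := two_mul_lt_unitPhase (s := 2 * s * η) (κ := 1 / 4) (by positivity) (by norm_num)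
    (by norm_num) (by norm_num) z
  rw [rootDensity]
  linarith

/-- In closed form these are `1 / (2 cosh(πsηm))`; the subtracted constant brings the zero mode to
`1/2`, the ratio of the number of roots to the length. -/
theorem coeff_rootDensity (m : ℤ) : coeff (fun z => (rootDensity s η z : ℂ)) m
    = ((phaseCoeff (2 * s * η) (1 / 4) m - if m = 0 then 1 / 2 else 0 : ℝ) : ℂ) := by
  have h1 : (0 : ℝ) < 2 * s * η := by positivity
  have hc := continuous_unitPhase h1 (κ := 1 / 4) (by norm_num) (by norm_num)
  simp only [rootDensity, ofReal_sub]
  rw [coeff_sub (by fun_prop) (by fun_prop), coeff_unitPhase h1 (by norm_num) (by norm_num),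
    coeff_const]
  split_ifs <;> simp

include hη1

/-- The Lieb equation. -/
theorem rootDensity_add_integral (z : ℝ) : rootDensity s η z
    + ∫ w in (-1 / 2 : ℝ)..(1 / 2), unitPhase s η (z - w) * rootDensity s η w
      = unitPhase s (η / 2) z := by
  have cK := continuous_unitPhase hs hη0 hη1
  have pK := unitPhase_periodic hs hη0 hη1
  have cp := continuous_unitPhase hs (κ := η / 2) (by linarith) (by linarith)
  have pp := unitPhase_periodic hs (κ := η / 2) (by linarith) (by linarith)
  have cr := continuous_rootDensity hs hη0
  have pr := rootDensity_periodic hs hη0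
  have h : (fun z => (rootDensity s η z : ℂ)
      + conv (fun w => (unitPhase s η w : ℂ)) (fun w => (rootDensity s η w : ℂ)) z)
      = fun z => (unitPhase s (η / 2) z : ℂ) := by
    refine eq_of_coeff_eq ?_ ?_ (by fun_prop) (fun x => by simp only [pp x]) fun m => ?_
    · have := continuous_conv (f := fun w => (unitPhase s η w : ℂ))
        (g := fun w => (rootDensity s η w : ℂ)) (by fun_prop) (by fun_prop)
      fun_prop
    · intro x
      have hc := periodic_conv (f := fun w => (unitPhase s η w : ℂ))
        (fun x => by simp only [pK x]) (fun w => (rootDensity s η w : ℂ)) x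
      simp only [pr x, hc]
    · rw [coeff_add (by fun_prop) (continuous_conv (by fun_prop) (by fun_prop)),
        coeff_conv (by fun_prop) (fun x => by rw [pK x]) (by fun_prop),
        coeff_rootDensity hs hη0, coeff_unitPhase hs hη0 hη1,
        coeff_unitPhase hs (by linarith) (by linarith)]
      norm_cast
      rcases eq_or_ne m 0 with rfl | hm
      · simp only [phaseCoeff, if_true]
        norm_num
      · obtain ⟨x, y, hx0, hx1, hy0, hy1, hyx, e1, e2, e3, -⟩ :=
          exists_coeff_variables hs hη0 hη1 hm
        rw [e1, e2, e3, if_neg hm]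
        have : 1 - y ≠ 0 := by linarith
        field_simp
        ring
  have := congrFun h z
  rw [← ofReal_integral_conv] at this
  exact_mod_cast this

/-- For `η > 1/2` the nonzero modes of the kernel are negative, but the factorization `(1+x²)(x²-y)
/ (x²(1-y))` shows that they stay above `-1`. -/
theorem one_add_phaseCoeff_ne_zero (m : ℤ) : 1 + phaseCoeff s η m ≠ 0 := by
  rcases eq_or_ne m 0 with rfl | hm
  · norm_num [phaseCoeff]
  · obtain ⟨x, y, hx0, hx1, hy0, hy1, hyx, -, e2, -, -⟩ := exists_coeff_variables hs hη0 hη1 hm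
    have h1 : 0 < 1 - y := by linarith
    have h2 : 1 + (x ^ 2 - y / x ^ 2) / (1 - y) = (1 + x ^ 2) * (x ^ 2 - y) / (x ^ 2 * (1 - y)) := by
      field_simp
      ring
    rw [e2, h2]
    have : 0 < x ^ 2 - y := by linarith
    positivity

theorem eq_zero_of_add_conv_eq_zero {D : ℝ → ℂ} (hD : Continuous D) (hp : Function.Periodic D 1)
    (h : ∀ z, D z + conv (fun w => (unitPhase s η w : ℂ)) D z = 0) : D = 0 := by
  have cK := continuous_unitPhase hs hη0 hη1
  have pK := unitPhase_periodic hs hη0 hη1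
  refine eq_zero_of_coeff_eq_zero hD hp fun m => ?_
  have h1 : coeff (fun z => D z + conv (fun w => (unitPhase s η w : ℂ)) D z) m = 0 := by
    simp only [h]
    rw [coeff_const]
    simp
  rw [coeff_add hD (continuous_conv (by fun_prop) hD),
    coeff_conv (by fun_prop) (fun x => by rw [pK x]) hD, coeff_unitPhase hs hη0 hη1] at h1
  have h2 : (1 + phaseCoeff s η m : ℂ) * coeff D m = 0 := by linear_combination h1
  refine (mul_eq_zero.mp h2).resolve_left ?_
  exact_mod_cast one_add_phaseCoeff_ne_zero hs hη0 hη1 m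

/-- Uniqueness for the Lieb equation among integrable functions. -/
theorem eqOn_of_add_integral_eq {r r' : ℝ → ℝ} {p : ℝ → ℝ}
    (hr : IntervalIntegrable r volume (-1 / 2) (1 / 2))
    (hr' : IntervalIntegrable r' volume (-1 / 2) (1 / 2))
    (e : ∀ z ∈ Set.Icc (-1 / 2 : ℝ) (1 / 2),
      r z + ∫ w in (-1 / 2 : ℝ)..(1 / 2), unitPhase s η (z - w) * r w = p z)
    (e' : ∀ z ∈ Set.Icc (-1 / 2 : ℝ) (1 / 2),
      r' z + ∫ w in (-1 / 2 : ℝ)..(1 / 2), unitPhase s η (z - w) * r' w = p z) :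
    Set.EqOn r' r (Set.Icc (-1 / 2) (1 / 2)) := by
  have cK := continuous_unitPhase hs hη0 hη1
  have pK := unitPhase_periodic hs hη0 hη1
  obtain ⟨C, hC⟩ := exists_norm_le_of_periodic cK pK
  set d := fun w => r' w - r w with hd
  have hdi : IntervalIntegrable d volume (-1 / 2) (1 / 2) := hr'.sub hr
  -- The difference `d` of two solutions is only integrable, but it equals `-K*d` on the interval,
  -- and `-K*d` is continuous and periodic on the whole line. Fourier uniqueness applies to the
  -- latter.
  set D : ℝ → ℝ := fun z => -∫ w in (-1 / 2 : ℝ)..(1 / 2), unitPhase s η (z - w) * d w with hD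
  have hKi : ∀ z, ∀ {r : ℝ → ℝ}, IntervalIntegrable r volume (-1 / 2) (1 / 2) →
      IntervalIntegrable (fun w => unitPhase s η (z - w) * r w) volume (-1 / 2) (1 / 2) :=
    fun z r hr => hr.continuousOn_mul (by fun_prop)
  have hDd : ∀ z ∈ Set.Icc (-1 / 2 : ℝ) (1 / 2), D z = d z := by
    intro z hz
    have h1 : ∫ w in (-1 / 2 : ℝ)..(1 / 2), unitPhase s η (z - w) * d w
        = (∫ w in (-1 / 2 : ℝ)..(1 / 2), unitPhase s η (z - w) * r' w)
          - ∫ w in (-1 / 2 : ℝ)..(1 / 2), unitPhase s η (z - w) * r w := by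
      rw [← intervalIntegral.integral_sub (hKi z hr') (hKi z hr)]
      simp only [hd, mul_sub]
    have h2 := e z hz
    have h3 := e' z hz
    simp only [hD, hd] at h1 ⊢
    linarith
  have hDc : Continuous D := by
    refine Continuous.neg (intervalIntegral.continuous_of_dominated_interval
      (bound := fun w => C * ‖d w‖) (fun z => ?_) (fun z => ?_) ?_ ?_)
    · exact (intervalIntegrable_iff.mp (hKi z hdi)).aestronglyMeasurable
    · refine Filter.Eventually.of_forall fun w _ => ?_
      rw [norm_mul]
      gcongr
      exact hC _
    · exact hdi.norm.const_mul C
    · exact Filter.Eventually.of_forall fun w _ => by fun_prop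
  have hDp : Function.Periodic D 1 := fun z => by
    simp only [hD, show ∀ w, z + 1 - w = z - w + 1 from fun w => by ring, pK _]
  have hDz : ∀ z, D z + ∫ w in (-1 / 2 : ℝ)..(1 / 2), unitPhase s η (z - w) * D w = 0 := by
    intro z
    have : ∫ w in (-1 / 2 : ℝ)..(1 / 2), unitPhase s η (z - w) * D w
        = ∫ w in (-1 / 2 : ℝ)..(1 / 2), unitPhase s η (z - w) * d w := by
      refine intervalIntegral.integral_congr fun w hw => ?_
      rw [Set.uIcc_of_le (by norm_num)] at hw
      simp only [hDd w hw]
    rw [this]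
    simp only [hD]
    ring
  have h0 := eq_zero_of_add_conv_eq_zero hs hη0 hη1 (D := fun z => (D z : ℂ)) (by fun_prop)
    (fun z => by simp only [hDp z]) fun z => by
      rw [← ofReal_integral_conv, ← ofReal_add, hDz, ofReal_zero]
  intro z hz
  have h1 := hDd z hz
  have h2 : D z = 0 := ofReal_eq_zero.mp (congrFun h0 z)
  rw [h2] at h1
  simp only [hd] at h1
  linarith

/-- Smooth solutions of the adjoint equation. -/
theorem exists_add_conv_eq {f : ℝ → ℂ} (hf : ContDiff ℝ ∞ f) (hfp : Function.Periodic f 1) :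
    ∃ ψ : ℝ → ℂ, ContDiff ℝ ∞ ψ ∧ Function.Periodic ψ 1 ∧
      ∀ z, ψ z + conv (fun w => (unitPhase s η w : ℂ)) ψ z = f z := by
  have cK := continuous_unitPhase hs hη0 hη1
  have pK := unitPhase_periodic hs hη0 hη1
  have cf := hf.continuous
  set k : ℤ → ℂ := fun m => (phaseCoeff s η m : ℂ) with hk
  have hk1 : ∀ m, 1 + k m ≠ 0 := fun m => by
    have := one_add_phaseCoeff_ne_zero hs hη0 hη1 m
    simp only [hk]
    exact_mod_cast this
  have hks : Summable fun m => ‖k m‖ := summable_phaseCoeff hs hη0 hη1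
  have hls : Summable fun m => ‖k m / (1 + k m)‖ := by
    have ht : ∀ᶠ m in Filter.cofinite, ‖k m‖ ≤ 1 / 2 :=
      (hks.tendsto_cofinite_zero.eventually_lt_const (by norm_num : (0 : ℝ) < 1 / 2)).mono
        fun _ => le_of_lt
    refine Summable.of_norm_bounded_eventually (hks.mul_left 2) (ht.mono fun m hm => ?_)
    have h1 : 1 / 2 ≤ ‖1 + k m‖ := by
      have := norm_sub_norm_le 1 (-k m)
      rw [norm_one, norm_neg, sub_neg_eq_add] at this
      linarith
    rw [norm_norm, norm_div, div_le_iff₀ (by linarith)]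
    nlinarith [norm_nonneg (k m)]
  -- The kernel with coefficients `K̂/(1+K̂)`, so that `f - R*f` inverts `1 + K*`.
  set R : ℝ → ℂ := fun x => ∑' m, k m / (1 + k m) * char m x with hR
  have cR : Continuous R := continuous_charSeries hls
  have pR : Function.Periodic R 1 := periodic_charSeries _
  set ψ := fun z => f z - conv R f z with hψ
  have cRf := continuous_conv cR cf
  have cψ : Continuous ψ := cf.sub cRf
  have pψ : Function.Periodic ψ 1 := hfp.sub (periodic_conv pR f)
  have heq : (fun z => ψ z + conv (fun w => (unitPhase s η w : ℂ)) ψ z) = f := by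
    have cKψ := continuous_conv (f := fun w => (unitPhase s η w : ℂ)) (by fun_prop) cψ
    refine eq_of_coeff_eq (by fun_prop) (pψ.add (periodic_conv (fun x => by rw [pK x]) _)) cf hfp
      fun m => ?_
    rw [coeff_add cψ cKψ, coeff_conv (by fun_prop) (fun x => by rw [pK x]) cψ,
      coeff_unitPhase hs hη0 hη1, hψ, coeff_sub cf cRf, coeff_conv cR pR cf, coeff_charSeries hls]
    have := hk1 m
    simp only [hk] at this ⊢
    field_simp
    ring
  refine ⟨ψ, ?_, pψ, congrFun heq⟩
  -- The equation itself shows that `ψ` is smooth: `ψ = f - K*ψ`, and `K` is smooth.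
  rw [show ψ = fun z => f z - conv (fun w => (unitPhase s η w : ℂ)) ψ z from
    funext fun z => by rw [← congrFun heq z]; ring]
  exact hf.sub (contDiff_conv (ofRealCLM.contDiff.comp (contDiff_unitPhase hs hη0 hη1))
    (fun x => by simp only [pK x]) cψ)

end Kernel

/-! ### A nonnegative resolvent for `η < 1/2` -/

section Resolvent

variable {s η : ℝ}

/-- The resolvent of the kernel shifted to mean `1 - 2η`, a positive kernel for `η < 1/2`. -/
theorem exists_resolvent (hs : 0 < s) (hη0 : 0 < η) (hη : η < 1 / 2) :
    ∃ R : ℝ → ℝ, Continuous R ∧ Function.Periodic R 1 ∧ (∀ z, 0 ≤ R z) ∧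
      ∫ z in (-1 / 2 : ℝ)..(1 / 2), R z = (1 - 2 * η) / (2 * (1 - η)) ∧
      ∀ m, coeff (fun z => (R z : ℂ)) m * (1 + coeff (fun z => ((unitPhase s η z - 2 * η : ℝ) : ℂ)) m)
        = coeff (fun z => ((unitPhase s η z - 2 * η : ℝ) : ℂ)) m := by
  have hη1 : η < 1 := by linarith
  have h1η : 0 < 1 - η := by linarith
  -- For `m ≠ 0` the resolvent has coefficients `sinh(πs(1-2η)m) / (2 sinh(πs(1-η)m) cosh(πsηm))`.
  -- This factors as the phase derivative with parameters `s(1-η)` and `κ`, where `(1-η)(1-2κ) =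
  -- 1-2η`, times the root density. The condition `κ < 1/2` is equivalent to `η < 1/2`, so both
  -- factors of the convolution are positive.
  set κ := η / (2 * (1 - η)) with hκ
  have hκ0 : 0 < κ := by positivity
  have hκh : κ < 1 / 2 := by
    rw [hκ, div_lt_div_iff₀ (by linarith) (by norm_num)]
    linarith
  have hκ1 : κ < 1 := by linarith
  have hs' : 0 < s * (1 - η) := mul_pos hs h1η
  have c1 := continuous_unitPhase hs' hκ0 hκ1
  have p1 := unitPhase_periodic hs' hκ0 hκ1
  have cr := continuous_rootDensity hs hη0
  set T : ℝ → ℝ := fun z => unitPhase (s * (1 - η)) κ z - 2 * κ with hT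
  have cT : Continuous T := c1.sub continuous_const
  have pT : Function.Periodic T 1 := fun z => by simp only [hT, p1 z]
  set R : ℝ → ℝ := fun z => ∫ w in (-1 / 2 : ℝ)..(1 / 2), T (z - w) * rootDensity s η w with hR
  have hRc : (fun z => (R z : ℂ)) = conv (fun w => (T w : ℂ)) (fun w => (rootDensity s η w : ℂ)) :=
    funext fun z => ofReal_integral_conv _ _ z
  have hcT : ∀ m, coeff (fun w => (T w : ℂ)) m
      = ((phaseCoeff (s * (1 - η)) κ m - if m = 0 then 2 * κ else 0 : ℝ) : ℂ) := fun m => by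
    simp only [hT, ofReal_sub]
    rw [coeff_sub (by fun_prop) (by fun_prop), coeff_unitPhase hs' hκ0 hκ1, coeff_const]
    split_ifs <;> simp
  have hcK : ∀ m, coeff (fun z => ((unitPhase s η z - 2 * η : ℝ) : ℂ)) m
      = ((phaseCoeff s η m - if m = 0 then 2 * η else 0 : ℝ) : ℂ) := fun m => by
    have := continuous_unitPhase hs hη0 hη1
    simp only [ofReal_sub]
    rw [coeff_sub (by fun_prop) (by fun_prop), coeff_unitPhase hs hη0 hη1, coeff_const]
    split_ifs <;> simp
  have hcR : ∀ m, coeff (fun z => (R z : ℂ)) m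
      = (((phaseCoeff (s * (1 - η)) κ m - if m = 0 then 2 * κ else 0)
        * (phaseCoeff (2 * s * η) (1 / 4) m - if m = 0 then 1 / 2 else 0) : ℝ) : ℂ) := fun m => by
    rw [hRc, coeff_conv (by fun_prop) (fun x => by rw [pT x]) (by fun_prop), hcT,
      coeff_rootDensity hs hη0, ofReal_mul]
  refine ⟨R, by fun_prop, fun z => ?_, fun z => ?_, ?_, fun m => ?_⟩
  · simp only [hR, show ∀ w, z + 1 - w = z - w + 1 from fun w => by ring, pT _]
  · refine intervalIntegral.integral_nonneg (by norm_num) fun w _ => ?_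
    have h := two_mul_lt_unitPhase hs' hκ0 hκ1 hκh (z - w)
    exact mul_nonneg (by simp only [hT]; linarith) (rootDensity_pos hs hη0 w).le
  · have h := hcR 0
    rw [coeff_zero_index, intervalIntegral.integral_ofReal, ofReal_inj] at h
    rw [h, phaseCoeff, phaseCoeff]
    simp only [if_true, hκ]
    field_simp
    ring
  · rw [hcR, hcK]
    norm_cast
    rcases eq_or_ne m 0 with rfl | hm
    · simp only [phaseCoeff, if_true, hκ]
      field_simp
      ring
    · obtain ⟨x, y, hx0, hx1, hy0, hy1, hyx, -, e2, e3, e4⟩ :=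
        exists_coeff_variables hs hη0 hη1 hm
      rw [hκ, e2, e3, e4]
      simp only [if_neg hm, sub_zero]
      have h1 : 1 - y ≠ 0 := by linarith
      have h2 : x ^ 2 - y ≠ 0 := by linarith
      have h3 : 1 - y / x ^ 2 ≠ 0 := by
        have : 1 - y / x ^ 2 = (x ^ 2 - y) / x ^ 2 := by field_simp
        rw [this]
        positivity
      rw [show (x - y / x ^ 3) / (1 - y / x ^ 2) = (x ^ 4 - y) / (x * (x ^ 2 - y)) by
        rw [div_eq_div_iff h3 (by positivity)]
        field_simp]
      field_simp
      ring

end Resolvent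

/-! ### Riemann sums of smooth periodic functions -/

/-- The Riemann sums of a periodic function, together with its chain of derivatives, converge
faster than any power of the mesh. -/
theorem norm_riemannSum_sub_integral_le {G : ℕ → ℝ → ℂ}
    (hd : ∀ k y, HasDerivAt (G k) (G (k + 1) y) y) (hp : ∀ k, Function.Periodic (G k) 1)
    {n : ℕ} (hn : 0 < n) {B : ℝ} (k : ℕ) (hB : ∀ y, ‖G k y‖ ≤ B) (y : ℝ) :
    ‖1 / (n : ℂ) * ∑ i ∈ Finset.range n, G 0 (y + i / n)
      - ∫ t in (-1 / 2 : ℝ)..(1 / 2), G 0 t‖ ≤ 2 * B / (n : ℝ) ^ k := by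
  have hnR : (0 : ℝ) < n := Nat.cast_pos.mpr hn
  have hnC : (n : ℂ) ≠ 0 := Nat.cast_ne_zero.mpr hn.ne'
  have hc : ∀ k, Continuous (G k) := fun k =>
    (Differentiable.continuous (𝕜 := ℝ) fun y => (hd k y).differentiableAt)
  induction k generalizing G y with
  | zero =>
    have h1 : ‖1 / (n : ℂ) * ∑ i ∈ Finset.range n, G 0 (y + i / n)‖ ≤ B := by
      have h2 : ‖∑ i ∈ Finset.range n, G 0 (y + i / n)‖ ≤ n * B := by
        refine (norm_sum_le_of_le _ fun i _ => hB _).trans ?_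
        rw [Finset.sum_const, Finset.card_range, nsmul_eq_mul]
      rw [norm_mul, norm_div, norm_one, norm_natCast, one_div, inv_mul_le_iff₀ hnR]
      exact h2
    have h3 : ‖∫ t in (-1 / 2 : ℝ)..(1 / 2), G 0 t‖ ≤ B := by
      have := intervalIntegral.norm_integral_le_of_norm_le_const (a := (-1 / 2 : ℝ)) (b := 1 / 2)
        (f := G 0) (C := B) fun t _ => hB t
      norm_num at this
      norm_num
      exact this
    refine (norm_sub_le _ _).trans ?_
    rw [pow_zero, div_one]
    linarith
  -- The derivative of the Riemann sum, as a function of the offset, is the Riemann sum of `G 1`,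
  -- whose integral vanishes; by induction it is `O(n^{-k})`. As the Riemann sum has period `1/n` in
  -- the offset, its oscillation gains a further factor `1/n`, and its mean is the integral.
  | succ k ih =>
    set H : ℝ → ℂ := fun y => 1 / (n : ℂ) * ∑ i ∈ Finset.range n, G 0 (y + i / n) with hH
    have hHd : ∀ y, HasDerivAt H (1 / (n : ℂ) * ∑ i ∈ Finset.range n, G 1 (y + i / n)) y := by
      intro y
      refine HasDerivAt.const_mul _ (HasDerivAt.fun_sum fun i _ => ?_)
      exact (hd 0 (y + i / n)).comp_add_const y (i / n)
    have h0 : ∫ t in (-1 / 2 : ℝ)..(1 / 2), G 1 t = 0 := by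
      rw [intervalIntegral.integral_eq_sub_of_hasDerivAt (fun t _ => hd 0 t)
        ((hc 1).intervalIntegrable _ _)]
      have := hp 0 (-1 / 2)
      rw [show (-1 / 2 + 1 : ℝ) = 1 / 2 by norm_num] at this
      rw [this, sub_self]
    have hH1 : ∀ y, ‖1 / (n : ℂ) * ∑ i ∈ Finset.range n, G 1 (y + i / n)‖ ≤ 2 * B / (n : ℝ) ^ k := by
      intro y
      have := ih (G := fun k => G (k + 1)) (fun k => hd (k + 1)) (fun k => hp (k + 1)) hB y
        (fun k => hc (k + 1))
      rwa [h0, sub_zero] at this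
    have hHc : Continuous H := by
      have := hc 0
      fun_prop
    have hHi : ∫ t in (-1 / 2 : ℝ)..(1 / 2), H t = ∫ t in (-1 / 2 : ℝ)..(1 / 2), G 0 t := by
      simp only [hH]
      rw [intervalIntegral.integral_const_mul, intervalIntegral.integral_finsetSum]
      · have : ∀ i ∈ Finset.range n, ∫ t in (-1 / 2 : ℝ)..(1 / 2), G 0 (t + i / n)
            = ∫ t in (-1 / 2 : ℝ)..(1 / 2), G 0 t := fun i _ => by
          have := integral_period_sub (hp 0) (-(i / n : ℝ))
          simpa only [sub_neg_eq_add] using this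
        rw [Finset.sum_congr rfl this, Finset.sum_const, Finset.card_range, nsmul_eq_mul]
        field_simp
      · intro i _
        have := hc 0
        exact Continuous.intervalIntegrable (by fun_prop) _ _
    have hHp : Function.Periodic H (1 / n) := by
      intro y
      simp only [hH]
      congr 1
      have h1 := Finset.sum_range_succ (fun i : ℕ => G 0 (y + i / n)) n
      have h2 := Finset.sum_range_succ' (fun i : ℕ => G 0 (y + i / n)) n
      rw [h1] at h2
      rw [div_self hnR.ne', hp 0, Nat.cast_zero, zero_div, add_zero] at h2
      rw [add_right_cancel h2]
      refine Finset.sum_congr rfl fun i _ => ?_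
      push_cast
      congr 1
      ring
    have hdist : ∀ t, ‖H y - H t‖ ≤ 2 * B / (n : ℝ) ^ (k + 1) := by
      intro t
      obtain ⟨t', ht', he⟩ := hHp.exists_mem_Ico (by positivity) t y
      have h1 := convex_univ.norm_image_sub_le_of_norm_hasDerivWithin_le
        (fun x _ => (hHd x).hasDerivWithinAt) (fun x _ => hH1 x) (Set.mem_univ t') (Set.mem_univ y)
      rw [he]
      refine h1.trans ?_
      have h2 : ‖y - t'‖ ≤ 1 / n := by
        rw [Real.norm_eq_abs, abs_le]
        have h3 : (0 : ℝ) ≤ 1 / n := by positivity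
        exact ⟨by linarith [ht'.2], by linarith [ht'.1]⟩
      have h3 : 0 ≤ 2 * B / (n : ℝ) ^ k := (norm_nonneg _).trans (hH1 0)
      calc _ ≤ 2 * B / (n : ℝ) ^ k * (1 / n) := mul_le_mul_of_nonneg_left h2 h3
        _ = _ := by
          rw [pow_succ]
          field_simp
    have hfin : H y - ∫ t in (-1 / 2 : ℝ)..(1 / 2), G 0 t
        = ∫ t in (-1 / 2 : ℝ)..(1 / 2), (H y - H t) := by
      rw [intervalIntegral.integral_sub (by simp) (hHc.intervalIntegrable _ _), hHi,
        intervalIntegral.integral_const]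
      norm_num
    change ‖H y - _‖ ≤ _
    rw [hfin]
    have := intervalIntegral.norm_integral_le_of_norm_le_const (a := (-1 / 2 : ℝ)) (b := 1 / 2)
      (f := fun t => H y - H t) fun t _ => hdist t
    refine this.trans (le_of_eq ?_)
    norm_num

/-! ### Families of functions with uniformly bounded derivatives -/

/-- The derivatives of order at most `k` of the members of the family are bounded, uniformly over
the family. -/
def UnifBdd {ι : Type*} : ℕ → (ι → ℝ → ℂ) → Prop
  | 0, F => ∃ C : ℝ, ∀ i x, ‖F i x‖ ≤ C
  | k + 1, F => (∃ C : ℝ, ∀ i x, ‖F i x‖ ≤ C) ∧ (∀ i, Differentiable ℝ (F i)) ∧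
      UnifBdd k fun i => deriv (F i)

namespace UnifBdd

variable {ι : Type*} {F G : ι → ℝ → ℂ} {k : ℕ}

theorem bound (h : UnifBdd k F) : ∃ C : ℝ, ∀ i x, ‖F i x‖ ≤ C := by
  cases k with
  | zero => exact h
  | succ k => exact h.1

theorem of_succ (h : UnifBdd (k + 1) F) : UnifBdd k F := by
  induction k generalizing F with
  | zero => exact h.1
  | succ k ih => exact ⟨h.1, h.2.1, ih h.2.2⟩

theorem bound_add (hF : UnifBdd k F) (hG : UnifBdd k G) :
    ∃ C : ℝ, ∀ i x, ‖F i x + G i x‖ ≤ C := by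
  obtain ⟨A, hA⟩ := hF.bound
  obtain ⟨B, hB⟩ := hG.bound
  exact ⟨A + B, fun i x => (norm_add_le _ _).trans (add_le_add (hA i x) (hB i x))⟩

theorem bound_mul (hF : UnifBdd k F) (hG : UnifBdd k G) :
    ∃ C : ℝ, ∀ i x, ‖F i x * G i x‖ ≤ C := by
  obtain ⟨A, hA⟩ := hF.bound
  obtain ⟨B, hB⟩ := hG.bound
  refine ⟨A * B, fun i x => ?_⟩
  rw [norm_mul]
  exact mul_le_mul (hA i x) (hB i x) (norm_nonneg _) ((norm_nonneg _).trans (hA i x))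

theorem add (hF : UnifBdd k F) (hG : UnifBdd k G) : UnifBdd k fun i x => F i x + G i x := by
  induction k generalizing F G with
  | zero => exact bound_add hF hG
  | succ k ih =>
    refine ⟨bound_add hF hG, fun i => (hF.2.1 i).add (hG.2.1 i), ?_⟩
    have he : (fun i => deriv fun x => F i x + G i x) = fun i x => deriv (F i) x + deriv (G i) x :=
      funext fun i => funext fun x => deriv_fun_add (hF.2.1 i x) (hG.2.1 i x)
    rw [he]
    exact ih hF.2.2 hG.2.2

theorem mul (hF : UnifBdd k F) (hG : UnifBdd k G) : UnifBdd k fun i x => F i x * G i x := by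
  induction k generalizing F G with
  | zero => exact bound_mul hF hG
  | succ k ih =>
    refine ⟨bound_mul hF hG, fun i => (hF.2.1 i).mul (hG.2.1 i), ?_⟩
    have he : (fun i => deriv fun x => F i x * G i x)
        = fun i x => deriv (F i) x * G i x + F i x * deriv (G i) x :=
      funext fun i => funext fun x => deriv_fun_mul (hF.2.1 i x) (hG.2.1 i x)
    rw [he]
    exact (ih hF.2.2 hG.of_succ).add (ih hF.of_succ hG.2.2)

theorem const (a : ℂ) : UnifBdd k fun (_ : ι) (_ : ℝ) => a := by
  induction k generalizing a with
  | zero => exact ⟨‖a‖, fun _ _ => le_rfl⟩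
  | succ k ih =>
    refine ⟨⟨‖a‖, fun _ _ => le_rfl⟩, fun _ => differentiable_const _, ?_⟩
    simpa using ih 0

theorem inv {c : ℝ} (hc : 0 < c) (hF : UnifBdd k F) (h : ∀ i x, c ≤ ‖F i x‖) :
    UnifBdd k fun i x => (F i x)⁻¹ := by
  have hb : ∃ C : ℝ, ∀ i x, ‖(F i x)⁻¹‖ ≤ C := ⟨c⁻¹, fun i x => by
    rw [norm_inv]
    exact inv_anti₀ hc (h i x)⟩
  have hne : ∀ i x, F i x ≠ 0 := fun i x => norm_pos_iff.mp (hc.trans_le (h i x))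
  induction k with
  | zero => exact hb
  | succ k ih =>
    refine ⟨hb, fun i => (hF.2.1 i).inv (hne i), ?_⟩
    have he : (fun i => deriv fun x => (F i x)⁻¹)
        = fun i x => deriv (F i) x * (-1 * ((F i x)⁻¹ * (F i x)⁻¹)) := by
      funext i x
      rw [deriv_fun_inv'' (hF.2.1 i x) (hne i x)]
      have := hne i x
      field_simp
    rw [he]
    have h1 := ih hF.of_succ
    exact hF.2.2.mul ((const (-1)).mul (h1.mul h1))

/-- If `U' = G` and `V` is the inverse of `U`, then `F ∘ V` has derivative `(F'/G) ∘ V`; iterating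
this operation controls all derivatives in the straightened variable. -/
theorem derivDiv {c : ℝ} (hc : 0 < c) (hF : ∀ k, UnifBdd k F) (hG : ∀ k, UnifBdd k G)
    (h : ∀ i x, c ≤ ‖G i x‖) (k : ℕ) : UnifBdd k fun i x => deriv (F i) x * (G i x)⁻¹ :=
  (hF (k + 1)).2.2.mul ((hG k).inv hc h)

end UnifBdd

/-- There are `n` translates with weight `1/(2n)`, so the bound depends neither on their number nor
on their positions. -/
theorem exists_norm_sub_average_le {P K : ℝ → ℂ} (hP : Continuous P)
    (hPp : Function.Periodic P 1) (hK : Continuous K) (hKp : Function.Periodic K 1) :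
    ∃ C : ℝ, ∀ (n : ℕ) (x : Fin n → ℝ) (z : ℝ),
      ‖P z - 1 / ((2 * n : ℕ) : ℂ) * ∑ l, K (z - x l)‖ ≤ C := by
  obtain ⟨A, hA⟩ := exists_norm_le_of_periodic hP hPp
  obtain ⟨B, hB⟩ := exists_norm_le_of_periodic hK hKp
  have hB0 : 0 ≤ B := (norm_nonneg _).trans (hB 0)
  refine ⟨A + B, fun n x z => (norm_sub_le _ _).trans (add_le_add (hA z) ?_)⟩
  have h1 : ‖∑ l, K (z - x l)‖ ≤ n * B := by
    refine (norm_sum_le_of_le _ fun l _ => hB _).trans ?_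
    rw [Finset.sum_const, Finset.card_univ, Fintype.card_fin, nsmul_eq_mul]
  rw [norm_mul, norm_div, norm_one, norm_natCast]
  rcases Nat.eq_zero_or_pos n with h0 | h0
  · subst h0
    simpa using hB0
  · have h2 : (0 : ℝ) < n := Nat.cast_pos.mpr h0
    rw [one_div, inv_mul_le_iff₀ (by push_cast; positivity)]
    push_cast
    nlinarith

/-- Averages of translates of a smooth periodic function form a family with bounded derivatives. -/
theorem unifBdd_sub_average {ι : Type*} {P K : ℝ → ℂ} (hP : ContDiff ℝ ∞ P)
    (hPp : Function.Periodic P 1) (hK : ContDiff ℝ ∞ K) (hKp : Function.Periodic K 1)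
    (n : ι → ℕ) (x : (i : ι) → Fin (n i) → ℝ) (k : ℕ) :
    UnifBdd k fun i z => P z - 1 / ((2 * n i : ℕ) : ℂ) * ∑ l, K (z - x i l) := by
  have hb : ∃ C : ℝ, ∀ i z, ‖P z - 1 / ((2 * n i : ℕ) : ℂ) * ∑ l, K (z - x i l)‖ ≤ C := by
    obtain ⟨C, hC⟩ := exists_norm_sub_average_le hP.continuous hPp hK.continuous hKp
    exact ⟨C, fun i z => hC _ _ z⟩
  induction k generalizing P K with
  | zero => exact hb
  | succ k ih =>
    have hd := fun z => (hP.differentiable (by simp) z).hasDerivAt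
    have hdK := fun z => (hK.differentiable (by simp) z).hasDerivAt
    have hD : ∀ i z, HasDerivAt (fun z => P z - 1 / ((2 * n i : ℕ) : ℂ) * ∑ l, K (z - x i l))
        (deriv P z - 1 / ((2 * n i : ℕ) : ℂ) * ∑ l, deriv K (z - x i l)) z := fun i z =>
      (hd z).sub (HasDerivAt.const_mul _ (HasDerivAt.fun_sum fun l _ =>
        (hdK _).comp_sub_const z (x i l)))
    refine ⟨hb, fun i z => (hD i z).differentiableAt, ?_⟩
    rw [show (fun i => deriv fun z => P z - 1 / ((2 * n i : ℕ) : ℂ) * ∑ l, K (z - x i l))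
      = fun i z => deriv P z - 1 / ((2 * n i : ℕ) : ℂ) * ∑ l, deriv K (z - x i l) from
      funext fun i => funext fun z => (hD i z).deriv]
    have hP' := (contDiff_infty_iff_deriv.mp hP).2
    have hK' := (contDiff_infty_iff_deriv.mp hK).2
    obtain ⟨C, hC⟩ := exists_norm_sub_average_le hP'.continuous (periodic_deriv hPp)
      hK'.continuous (periodic_deriv hKp)
    exact ih hP' (periodic_deriv hPp) hK' (periodic_deriv hKp) ⟨C, fun i z => hC _ _ z⟩

/-! ### Sums over equidistributed points -/

/-- The inverse of an increasing function that commutes with the unit translation. -/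
theorem exists_inverse_of_hasDerivAt {U W : ℝ → ℝ} (hU : ∀ z, HasDerivAt U (W z) z)
    (hW : ∀ z, 0 < W z) (h1 : ∀ z, U (z + 1) = U z + 1) :
    ∃ V : ℝ → ℝ, (∀ z, V (U z) = z) ∧ (∀ y, U (V y) = y) ∧ (∀ y, V (y + 1) = V y + 1) ∧
      ∀ y, HasDerivAt V (W (V y))⁻¹ y := by
  have hmono : StrictMono U := strictMono_of_hasDerivAt_pos hU hW
  have hc : Continuous U := Differentiable.continuous (𝕜 := ℝ) fun z => (hU z).differentiableAt
  have hint : ∀ m : ℤ, U m = U 0 + m := by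
    intro m
    induction m using Int.induction_on with
    | zero => simp
    | succ i ih =>
      push_cast at ih ⊢
      rw [h1, ih]
      ring
    | pred i ih =>
      push_cast at ih ⊢
      have := h1 (-(i : ℝ) - 1)
      rw [sub_add_cancel] at this
      linarith
  have hsurj : Function.Surjective U := by
    intro y
    have ha : U ⌊y - U 0⌋ ≤ y := by
      rw [hint]
      linarith [Int.floor_le (y - U 0)]
    have hb : y ≤ U ⌈y - U 0⌉ := by
      rw [hint]
      linarith [Int.le_ceil (y - U 0)]
    exact mem_range_of_exists_le_of_exists_ge hc ⟨_, ha⟩ ⟨_, hb⟩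
  set e := hmono.orderIsoOfSurjective U hsurj with he
  have hUe : ∀ z, e z = U z := fun z => rfl
  have hUV : ∀ y, U (e.symm y) = y := fun y => by rw [← hUe, e.apply_symm_apply]
  have hVU : ∀ z, e.symm (U z) = z := fun z => by rw [← hUe, e.symm_apply_apply]
  refine ⟨e.symm, hVU, hUV, fun y => ?_, fun y => ?_⟩
  · rw [← hVU (e.symm y + 1), h1, hUV]
  · exact HasDerivAt.of_local_left_inverse e.symm.continuous.continuousAt (hU _) (hW _).ne'
      (Filter.Eventually.of_forall hUV)

/-- If `U` maps the points `x_j` to `j / n`, the sums over the `x_j` of a smooth periodic function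
are given by the integral against `U'`, up to `O(n^{-∞})`. -/
theorem exists_norm_average_sub_integral_le {ι : Type*} {n : ι → ℕ} (hn : ∀ i, 0 < n i)
    (x : (i : ι) → Fin (n i) → ℝ) {U W : ι → ℝ → ℝ} {c : ℝ} (hc : 0 < c)
    (hU : ∀ i z, HasDerivAt (U i) (W i z) z) (hUp : ∀ i z, U i (z + 1) = U i z + 1)
    (hUx : ∀ i j, U i (x i j) = (j : ℕ) / n i) (hWc : ∀ i z, c ≤ W i z)
    (hW : ∀ k, UnifBdd k fun i z => (W i z : ℂ))
    {ψ : ℝ → ℂ} (hψ : ContDiff ℝ ∞ ψ) (hψp : Function.Periodic ψ 1) (k : ℕ) :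
    ∃ C : ℝ, ∀ i, ‖1 / (n i : ℂ) * ∑ j, ψ (x i j)
      - ∫ z in (-1 / 2 : ℝ)..(1 / 2), ψ z * (W i z : ℂ)‖ ≤ C / (n i : ℝ) ^ k := by
  -- Differentiation with respect to `y = U i z`, written in the variable `z`. The bounds on its
  -- iterates are uniform over the family because `W` is bounded below by `c`.
  set D : (ι → ℝ → ℂ) → ι → ℝ → ℂ := fun F i z => deriv (F i) z * ((W i z : ℝ) : ℂ)⁻¹ with hD
  set Φ : ℕ → ι → ℝ → ℂ := fun m => D^[m] fun _ => ψ with hΦ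
  have hΦs : ∀ m, Φ (m + 1) = D (Φ m) := fun m => Function.iterate_succ_apply' D m _
  have hWp : ∀ i, Function.Periodic (W i) 1 := fun i z => by
    have h2 : HasDerivAt (fun y => U i (y + 1)) (W i (z + 1)) z := (hU i (z + 1)).comp_add_const z 1
    rw [show (fun y => U i (y + 1)) = fun y => U i y + 1 from funext (hUp i)] at h2
    exact h2.unique ((hU i z).add_const 1)
  have hWn : ∀ i z, c ≤ ‖(W i z : ℂ)‖ := fun i z => by
    rw [norm_real]
    exact (hWc i z).trans (le_abs_self _)
  have hΦu : ∀ m k, UnifBdd k (Φ m) := by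
    intro m
    induction m with
    -- The constant family `ψ` is the case of vanishing translates.
    | zero =>
      intro k
      have := unifBdd_sub_average (ι := ι) hψ hψp (contDiff_const (c := (0 : ℂ))) (fun _ => rfl)
        n x k
      simp only [Finset.sum_const_zero, mul_zero, sub_zero] at this
      exact this
    | succ m ih =>
      intro k
      rw [hΦs]
      exact UnifBdd.derivDiv hc ih hW hWn k
  have hΦp : ∀ m i, Function.Periodic (Φ m i) 1 := by
    intro m
    induction m with
    | zero => exact fun i => hψp
    | succ m ih =>
      intro i z
      rw [hΦs]
      simp only [hD, hWp i z, periodic_deriv (ih i) z]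
  obtain ⟨B, hB⟩ := (hΦu k 0).bound
  refine ⟨2 * B, fun i => ?_⟩
  have hW0 : ∀ z, 0 < W i z := fun z => hc.trans_le (hWc i z)
  obtain ⟨V, hVU, hUV, hV1, hVd⟩ := exists_inverse_of_hasDerivAt (hU i) hW0 (hUp i)
  -- These are the successive derivatives of `ψ ∘ V`, and the points are `x_j = V(j/n)`.
  set G : ℕ → ℝ → ℂ := fun m y => Φ m i (V y) with hG
  have hGd : ∀ m y, HasDerivAt (G m) (G (m + 1) y) y := fun m y => by
    have h2 := ((hΦu m 1).2.1 i (V y)).hasDerivAt.scomp y (hVd y)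
    refine h2.congr_deriv ?_
    simp only [hG, hΦs, hD, real_smul, ofReal_inv]
    ring
  have hGp : ∀ m, Function.Periodic (G m) 1 := fun m y => by
    simp only [hG, hV1, hΦp m i _]
  have key := norm_riemannSum_sub_integral_le hGd hGp (hn i) k (fun y => hB i _) 0
  have e1 : ∑ j ∈ Finset.range (n i), G 0 (0 + j / n i) = ∑ j, ψ (x i j) := by
    rw [Finset.sum_range]
    refine Finset.sum_congr rfl fun j _ => ?_
    simp only [hG, zero_add, ← hUx, hVU]
    rfl
  have e2 : ∫ t in (-1 / 2 : ℝ)..(1 / 2), G 0 t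
      = ∫ z in (-1 / 2 : ℝ)..(1 / 2), ψ z * (W i z : ℂ) := by
    have hWcont : Continuous (W i) := by
      have : Continuous fun z => (W i z : ℂ) := ((hW 1).2.1 i).continuous
      exact continuous_re.comp this
    have hGc : Continuous (G 0) :=
      Differentiable.continuous (𝕜 := ℝ) fun y => (hGd 0 y).differentiableAt
    -- Substitution `t = U i z`; the image of the period is an interval of length one, possibly
    -- translated.
    have h2 := intervalIntegral.integral_deriv_smul_comp (a := (-1 / 2 : ℝ)) (b := 1 / 2)
      (f := U i) (f' := W i) (g := G 0) (fun z _ => hU i z) hWcont.continuousOn hGc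
    have h3 := hUp i (-1 / 2)
    rw [show (-1 / 2 + 1 : ℝ) = 1 / 2 by norm_num] at h3
    rw [h3, integral_period (hGp 0)] at h2
    rw [← h2]
    refine intervalIntegral.integral_congr fun z _ => ?_
    simp only [Function.comp, hG, hVU, real_smul]
    rw [mul_comm]
    rfl
  rw [e1, e2] at key
  exact key

/-- Points with distinct integer heights in an interval are controlled by the variation. -/
theorem card_le_integral_abs_add_one {ι : Type*} (S : Finset ι) {u u' : ℝ → ℝ}
    (hu : ∀ z, HasDerivAt u (u' z) z) (hu' : Continuous u') {a b : ℝ} (hab : a ≤ b) {x : ι → ℝ}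
    (hx : ∀ j ∈ S, x j ∈ Set.Icc a b) {h : ι → ℤ} (hh : Set.InjOn h S)
    (hux : ∀ j ∈ S, u (x j) = h j) : (S.card : ℝ) ≤ (∫ z in a..b, |u' z|) + 1 := by
  rcases S.eq_empty_or_nonempty with rfl | hS
  · simpa using add_nonneg (intervalIntegral.integral_nonneg hab fun z _ => abs_nonneg (u' z))
      zero_le_one
  -- Distinct integers spread over at least their number minus one, and the variation of `u` must
  -- cover that spread.
  set T := S.image h with hT
  have hTn : T.Nonempty := hS.image h
  have hcard : T.card = S.card := Finset.card_image_of_injOn hh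
  have hsub : T ⊆ Finset.Icc (T.min' hTn) (T.max' hTn) := fun m hm =>
    Finset.mem_Icc.mpr ⟨T.min'_le m hm, T.le_max' m hm⟩
  have h1 := Finset.card_le_card hsub
  rw [Int.card_Icc, hcard] at h1
  have hle : T.min' hTn ≤ T.max' hTn := T.min'_le _ (T.max'_mem hTn)
  have h2 : (S.card : ℤ) ≤ T.max' hTn - T.min' hTn + 1 := by omega
  obtain ⟨j, hj, ej⟩ := Finset.mem_image.mp (T.max'_mem hTn)
  obtain ⟨i, hi, ei⟩ := Finset.mem_image.mp (T.min'_mem hTn)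
  have h3 : (S.card : ℝ) ≤ u (x j) - u (x i) + 1 := by
    rw [hux j hj, hux i hi, ej, ei]
    exact_mod_cast h2
  have h4 : u (x j) - u (x i) = ∫ z in x i..x j, u' z :=
    (intervalIntegral.integral_eq_sub_of_hasDerivAt (fun z _ => hu z)
      (hu'.intervalIntegrable _ _)).symm
  have h5 : |∫ z in x i..x j, u' z| ≤ ∫ z in a..b, |u' z| := by
    have h6 := intervalIntegral.norm_integral_le_integral_norm_uIoc (f := u') (a := x i) (b := x j)
      (μ := volume)
    rw [Real.norm_eq_abs] at h6
    refine h6.trans ?_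
    rw [intervalIntegral.integral_of_le hab]
    refine setIntegral_mono_set ?_ ?_ ?_
    · exact (hu'.abs.intervalIntegrable a b).1
    · exact Filter.Eventually.of_forall fun z => abs_nonneg _
    · refine Filter.Eventually.of_forall fun z hz => ?_
      have hxi := hx i hi
      have hxj := hx j hj
      rcases Set.mem_uIoc.mp hz with hz | hz
      · exact ⟨hxi.1.trans_lt hz.1, hz.2.trans hxj.2⟩
      · exact ⟨hxj.1.trans_lt hz.1, hz.2.trans hxi.2⟩
  have h7 := le_abs_self (∫ z in x i..x j, u' z)
  linarith

/-- Sums of a nonnegative periodic function over points whose heights are distinct are bounded by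
the integral against the absolute density, up to a discretization error. -/
theorem sum_le_integral_mul_abs {n : ℕ} (hn : 0 < n) {x : Fin n → ℝ} {U W : ℝ → ℝ}
    (hU : ∀ z, HasDerivAt U (W z) z) (hW : Continuous W) (hUp : ∀ z, U (z + 1) = U z + 1)
    (hUx : ∀ j, U (x j) = (j : ℕ) / n) {φ : ℝ → ℝ} (hφ : Continuous φ)
    (hφp : Function.Periodic φ 1) (hφ0 : ∀ z, 0 ≤ φ z) {B : ℝ} (hB : ∀ z, φ z ≤ B)
    {M : ℕ} (hM : 0 < M) {ε : ℝ} (hε : ∀ y z : ℝ, |y - z| ≤ 1 / M → φ y ≤ φ z + ε) :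
    1 / (n : ℝ) * ∑ j, φ (x j)
      ≤ (∫ z in (-1 / 2 : ℝ)..(1 / 2), (φ z + 2 * ε) * |W z|) + M * B / n := by
  have hnR : (0 : ℝ) < n := Nat.cast_pos.mpr hn
  have hMR : (0 : ℝ) < M := Nat.cast_pos.mpr hM
  have hB0 : 0 ≤ B := (hφ0 0).trans (hB 0)
  -- The points are not assumed to lie in one period, so they are reduced modulo 1; their heights
  -- `nU` then change by multiples of `n`.
  set y : Fin n → ℝ := fun j => Int.fract (x j) with hy
  have hUint : ∀ (m : ℤ) z, U (z + m) = U z + m := by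
    intro m z
    induction m using Int.induction_on with
    | zero => simp
    | succ i ih =>
      push_cast at ih ⊢
      rw [← add_assoc, hUp, ih]
      ring
    | pred i ih =>
      push_cast at ih ⊢
      have := hUp (z + (-(i : ℝ) - 1))
      rw [show z + (-(i : ℝ) - 1) + 1 = z + -(i : ℝ) by ring] at this
      linarith
  have hφy : ∀ j, φ (y j) = φ (x j) := fun j => by
    simp only [hy, Int.fract]
    have := hφp.int_mul ⌊x j⌋ (x j - ⌊x j⌋)
    rw [mul_one, sub_add_cancel] at this
    exact this.symm
  have hUy : ∀ j, n * U (y j) = (((j : ℕ) : ℤ) - n * ⌊x j⌋ : ℤ) := fun j => by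
    have := hUint ⌊x j⌋ (y j)
    simp only [hy, Int.fract_add_floor] at this
    rw [hUx] at this
    have h2 : U (y j) = (j : ℕ) / n - ⌊x j⌋ := by
      simp only [hy]
      linarith
    rw [h2]
    push_cast
    field_simp
  -- The heights remain distinct, because their residues modulo `n` are the indices `j < n`.
  have hinj : Function.Injective fun j : Fin n => ((j : ℕ) : ℤ) - n * ⌊x j⌋ := by
    intro i j hij
    have h1 := congrArg (fun t : ℤ => t % n) hij
    simp only [Int.sub_mul_emod_self_left] at h1
    rw [Int.emod_eq_of_lt (by positivity) (by exact_mod_cast i.2),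
      Int.emod_eq_of_lt (by positivity) (by exact_mod_cast j.2)] at h1
    exact Fin.ext (by exact_mod_cast h1)
  set cell : Fin n → ℕ := fun j => ⌊M * y j⌋₊ with hcell
  have hy0 : ∀ j, 0 ≤ y j := fun j => Int.fract_nonneg _
  have hcellM : ∀ j ∈ Finset.univ, cell j ∈ Finset.range M := fun j _ => by
    rw [Finset.mem_range, hcell, Nat.floor_lt (mul_nonneg hMR.le (hy0 j))]
    have := Int.fract_lt_one (x j)
    simp only [hy]
    nlinarith
  have hyc : ∀ j, y j ∈ Set.Icc ((cell j : ℝ) / M) ((cell j + 1 : ℕ) / M) := fun j => by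
    constructor
    · rw [div_le_iff₀ hMR, mul_comm]
      exact Nat.floor_le (mul_nonneg hMR.le (hy0 j))
    · rw [le_div_iff₀ hMR, mul_comm]
      push_cast
      exact (Nat.lt_floor_add_one _).le
  have hsum : ∑ j, φ (x j) = ∑ i ∈ Finset.range M, ∑ j with cell j = i, φ (y j) := by
    rw [Finset.sum_fiberwise_of_maps_to hcellM]
    exact Finset.sum_congr rfl fun j _ => (hφy j).symm
  have hcellbd : ∀ i ∈ Finset.range M, ∑ j with cell j = i, φ (y j)
      ≤ n * (∫ z in ((i : ℝ) / M)..((i + 1 : ℕ) / M), (φ z + 2 * ε) * |W z|) + B := by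
    intro i _
    set a : ℝ := (i : ℝ) / M with ha
    set b : ℝ := ((i + 1 : ℕ) : ℝ) / M with hb
    have hab : b - a = 1 / M := by
      rw [ha, hb]
      push_cast
      ring
    have hab' : a ≤ b := by
      have : 0 < 1 / (M : ℝ) := by positivity
      linarith
    -- A bound for `φ` on the cell with two uses: `t ≤ φ + 2ε` under the integral, and `t ≤ B` for
    -- the extra point allowed by the count.
    set t := min B (φ a + ε) with ht
    have hε0 : 0 ≤ ε := by
      have := hε 0 0 (by rw [sub_self, abs_zero]; positivity)
      linarith
    have ht0 : 0 ≤ t := le_min hB0 (add_nonneg (hφ0 a) hε0)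
    have hclose : ∀ z ∈ Set.Icc a b, |z - a| ≤ 1 / M ∧ |a - z| ≤ 1 / M := fun z hz => by
      rw [abs_sub_comm a z, abs_of_nonneg (by linarith [hz.1])]
      constructor <;> linarith [hz.2]
    have hyi : ∀ j ∈ Finset.univ.filter (fun j => cell j = i), y j ∈ Set.Icc a b := fun j hj => by
      have := hyc j
      rwa [(Finset.mem_filter.mp hj).2] at this
    have hc := card_le_integral_abs_add_one (Finset.univ.filter fun j => cell j = i)
      (u := fun z => n * U z) (u' := fun z => n * W z) (fun z => (hU z).const_mul _)
      (by fun_prop) hab' (x := y) hyi (h := fun j : Fin n => ((j : ℕ) : ℤ) - n * ⌊x j⌋)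
      hinj.injOn (fun j _ => hUy j)
    have h1 : ∑ j with cell j = i, φ (y j)
        ≤ ((Finset.univ.filter fun j => cell j = i).card : ℝ) * t := by
      rw [← nsmul_eq_mul]
      refine Finset.sum_le_card_nsmul _ _ _ fun j hj => le_min (hB _) ?_
      exact hε _ _ (hclose _ (hyi j hj)).1
    have h2 : (∫ z in a..b, |n * W z|) * t ≤ n * ∫ z in a..b, (φ z + 2 * ε) * |W z| := by
      rw [← intervalIntegral.integral_mul_const, ← intervalIntegral.integral_const_mul]
      refine intervalIntegral.integral_mono_on hab' (Continuous.intervalIntegrable (by fun_prop) _ _)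
        (Continuous.intervalIntegrable (by fun_prop) _ _) fun z hz => ?_
      have h3 : t ≤ φ z + 2 * ε := by
        have := hε a z (hclose z hz).2
        exact (min_le_right _ _).trans (by linarith)
      rw [abs_mul, abs_of_pos hnR]
      have := mul_le_mul_of_nonneg_left h3 (mul_nonneg hnR.le (abs_nonneg (W z)))
      linarith
    calc _ ≤ ((∫ z in a..b, |n * W z|) + 1) * t := h1.trans (mul_le_mul_of_nonneg_right hc ht0)
      _ ≤ _ := by
        have := min_le_left B (φ a + ε)
        rw [add_mul, one_mul]
        exact add_le_add h2 this
  have hWp : Function.Periodic W 1 := fun z => by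
    have h2 : HasDerivAt (fun y => U (y + 1)) (W (z + 1)) z := (hU (z + 1)).comp_add_const z 1
    rw [show (fun y => U (y + 1)) = fun y => U y + 1 from funext hUp] at h2
    exact h2.unique ((hU z).add_const 1)
  have hint : ∑ i ∈ Finset.range M, (∫ z in ((i : ℝ) / M)..((i + 1 : ℕ) / M),
      (φ z + 2 * ε) * |W z|) = ∫ z in (-1 / 2 : ℝ)..(1 / 2), (φ z + 2 * ε) * |W z| := by
    rw [intervalIntegral.sum_integral_adjacent_intervals (a := fun i : ℕ => (i : ℝ) / M)
      (fun i _ => Continuous.intervalIntegrable (by fun_prop) _ _)]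
    rw [Nat.cast_zero, zero_div, div_self hMR.ne',
      ← integral_period (f := fun z => (φ z + 2 * ε) * |W z|) (fun z => by
        simp only [hφp z, hWp z]) 0, zero_add]
  have htot := Finset.sum_le_sum hcellbd
  rw [← hsum, Finset.sum_add_distrib, ← Finset.mul_sum, hint, Finset.sum_const, Finset.card_range,
    nsmul_eq_mul] at htot
  rw [one_div, inv_mul_le_iff₀ hnR]
  calc _ ≤ _ := htot
    _ = _ := by field_simp

/-! ### The counting function of a ground state -/

theorem dualTau_eq {τ : ℂ} (hτ : τ.re = 0) : dualTau τ = I * ((1 / τ.im : ℝ) : ℂ) := by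
  have h : τ = I * τ.im := by apply Complex.ext <;> simp [hτ]
  rw [dualTau, h]
  simp only [mul_im, I_re, I_im, ofReal_re, ofReal_im, zero_mul, one_mul, zero_add]
  push_cast
  rw [neg_div, one_div, mul_inv, inv_I]
  ring

theorem dualEta_eq (η : ℝ) {τ : ℂ} (hτ : τ.re = 0) :
    dualEta η τ = I * ((1 / τ.im : ℝ) : ℂ) * η := by
  rw [← dualTau_eq hτ, dualEta, dualTau]
  ring

theorem p0Deriv_eq (η : ℝ) {τ : ℂ} (hτ : τ.re = 0) (z : ℝ) :
    p0Deriv η τ z / (2 * Real.pi) = unitPhase (1 / τ.im) (η / 2) z := by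
  rw [p0Deriv, unitPhase, dualTau_eq hτ, dualEta_eq η hτ]
  push_cast
  rw [mul_div_assoc]

theorem kernelK_eq (η : ℝ) {τ : ℂ} (hτ : τ.re = 0) (z : ℝ) :
    kernelK η τ z = unitPhase (1 / τ.im) η z := by
  rw [kernelK, unitPhase, dualTau_eq hτ, dualEta_eq η hτ]

/-- The density `ξ'/2π` of the counting function of the points `x`. -/
def countingDensity (s η : ℝ) (n : ℕ) (x : Fin n → ℝ) (z : ℝ) : ℝ :=
  unitPhase s (η / 2) z - 1 / ((2 * n : ℕ) : ℝ) * ∑ l, unitPhase s η (z - x l)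

/-- The normalized counting function of the points `x`: its derivative is twice the counting
density, and it maps the points to the multiples of `1/n`. -/
def IsCountingFunction (s η : ℝ) (n : ℕ) (x : Fin n → ℝ) (U : ℝ → ℝ) : Prop :=
  (∀ z, HasDerivAt U (2 * countingDensity s η n x z) z) ∧ (∀ z, U (z + 1) = U z + 1) ∧
    ∀ j, U (x j) = (j : ℕ) / n

section Phase

variable {s κ : ℝ} (hs : 0 < s) (hκ0 : 0 < κ) (hκ1 : κ < 1)
include hs hκ0 hκ1

theorem hasDerivAt_phase_shift (z : ℝ) :
    HasDerivAt (phase (I * s) (I * s * κ)) (2 * Real.pi * unitPhase s κ z) z := by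
  have hc := continuous_phaseDeriv (τ := I * s) (by simpa using hs)
    (theta1_shift_ne_zero hs hκ0 hκ1)
  have h : HasDerivAt (phase (I * s) (I * s * κ)) (phaseDeriv (I * s) (I * s * κ) z) z :=
    intervalIntegral.integral_hasDerivAt_right (hc.intervalIntegrable _ _)
      hc.stronglyMeasurable.stronglyMeasurableAtFilter hc.continuousAt
  have := Real.pi_pos
  rw [unitPhase, mul_div_cancel₀ _ (by positivity)]
  exact h

theorem phase_shift_add_one (z : ℝ) :
    phase (I * s) (I * s * κ) (z + 1) = phase (I * s) (I * s * κ) z + 2 * Real.pi := by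
  have h := intervalIntegral.integral_eq_sub_of_hasDerivAt (a := z) (b := z + 1)
    (fun y _ => hasDerivAt_phase_shift hs hκ0 hκ1 y)
    (Continuous.intervalIntegrable
      (continuous_const.mul (continuous_unitPhase hs hκ0 hκ1)) _ _)
  rw [intervalIntegral.integral_const_mul, integral_period (unitPhase_periodic hs hκ0 hκ1),
    integral_unitPhase hs hκ0 hκ1] at h
  linarith

end Phase

/-- The right side of the Bethe equations depends on `j` only through the quantum number, so
subtracting the constant for the first root leaves the consecutive integers `0, …, n-1`. Over a
period the phases advance by `2π(2n - n)`, which after division by `2πn` is one. -/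
theorem exists_isCountingFunction {η : ℝ} (hη0 : 0 < η) (hη1 : η < 1) {τ : ℂ} (hτ : τ.re = 0)
    (hτ' : 0 < τ.im) {n : ℕ} (hn : 0 < n) {x : Fin n → ℝ} (hx : IsGroundState η τ n x) :
    ∃ U, IsCountingFunction (1 / τ.im) η n x U := by
  obtain ⟨β, q, hq, hB⟩ := hx
  set s : ℝ := 1 / τ.im with hs_def
  have hs : 0 < s := by positivity
  have hnR : (0 : ℝ) < n := Nat.cast_pos.mpr hn
  have hp : p0 η τ = phase (I * s) (I * s * (η / 2 : ℝ)) := by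
    rw [p0, dualTau_eq hτ, dualEta_eq η hτ, ← hs_def]
    push_cast
    rw [mul_div_assoc]
  have hb : bareTheta η τ = phase (I * s) (I * s * η) := by
    rw [bareTheta, dualTau_eq hτ, dualEta_eq η hτ]
  have hqj : ∀ m (hm : m < n), (q ⟨m, hm⟩ : ℤ) = q ⟨0, hn⟩ + m := by
    intro m
    induction m with
    | zero => simp
    | succ m ih =>
      intro hm
      have := hq ⟨m, by omega⟩ ⟨m + 1, hm⟩ rfl
      rw [ih (by omega)] at this
      push_cast
      omega
  set d : ℝ := (q ⟨0, hn⟩ : ℝ) - ((n : ℝ) + 1) / 2 + β + 2 * η * ∑ l, x l with hd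
  have hpi := Real.pi_pos
  refine ⟨fun z => 1 / (n : ℝ) * (1 / (2 * Real.pi) *
    (((2 * n : ℕ) : ℝ) * p0 η τ z - ∑ l, bareTheta η τ (z - x l)) - d), fun z => ?_, fun z => ?_,
    fun j => ?_⟩
  · have h1 : HasDerivAt (p0 η τ) (2 * Real.pi * unitPhase s (η / 2) z) z := by
      rw [hp]
      exact hasDerivAt_phase_shift hs (by linarith) (by linarith) z
    have h2 : ∀ l, HasDerivAt (fun z => bareTheta η τ (z - x l))
        (2 * Real.pi * unitPhase s η (z - x l)) z := fun l => by
      rw [hb]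
      exact (hasDerivAt_phase_shift hs hη0 hη1 (z - x l)).comp_sub_const z (x l)
    have h3 := ((((h1.const_mul ((2 * n : ℕ) : ℝ)).sub
      (HasDerivAt.fun_sum (u := Finset.univ) fun l _ => h2 l)).const_mul
        (1 / (2 * Real.pi))).sub_const d).const_mul (1 / (n : ℝ))
    refine h3.congr_deriv ?_
    rw [countingDensity, ← Finset.mul_sum]
    push_cast
    field_simp
  · have h1 : p0 η τ (z + 1) = p0 η τ z + 2 * Real.pi := by
      rw [hp]
      exact phase_shift_add_one hs (by linarith) (by linarith) z
    have h2 : ∀ l, bareTheta η τ (z + 1 - x l) = bareTheta η τ (z - x l) + 2 * Real.pi := fun l => by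
      rw [hb, show z + 1 - x l = z - x l + 1 by ring]
      exact phase_shift_add_one hs hη0 hη1 _
    simp only [h1, h2, Finset.sum_add_distrib, Finset.sum_const, Finset.card_univ,
      Fintype.card_fin, nsmul_eq_mul]
    push_cast
    field_simp
    ring
  · have h1 := hB j
    have h2 := hqj j j.2
    have h3 : (q j : ℝ) = q ⟨0, hn⟩ + (j : ℕ) := by exact_mod_cast h2
    simp only [h1, h3, hd]
    field_simp
    ring

/-! ### Positivity of the counting density -/

theorem exists_pos_le_of_periodic {f : ℝ → ℝ} (hf : Continuous f) (hp : Function.Periodic f 1)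
    (h0 : ∀ z, 0 < f z) : ∃ c, 0 < c ∧ ∀ z, c ≤ f z := by
  obtain ⟨z0, -, hz0⟩ := (isCompact_Icc (a := (0 : ℝ)) (b := 1)).exists_isMinOn
    (Set.nonempty_Icc.mpr zero_le_one) hf.continuousOn
  refine ⟨f z0, h0 z0, fun z => ?_⟩
  obtain ⟨y, hy, hzy⟩ := hp.exists_mem_Ico₀ one_pos z
  rw [hzy]
  exact hz0 (Set.Ico_subset_Icc_self hy)

theorem exists_forall_le_of_periodic {f : ℝ → ℝ} (hf : Continuous f)
    (hp : Function.Periodic f 1) : ∃ z0, ∀ z, f z0 ≤ f z := by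
  obtain ⟨z0, -, hz0⟩ := (isCompact_Icc (a := (0 : ℝ)) (b := 1)).exists_isMinOn
    (Set.nonempty_Icc.mpr zero_le_one) hf.continuousOn
  refine ⟨z0, fun z => ?_⟩
  obtain ⟨y, hy, hzy⟩ := hp.exists_mem_Ico₀ one_pos z
  rw [hzy]
  exact hz0 (Set.Ico_subset_Icc_self hy)

/-- The modulus of continuity of a periodic function. -/
theorem exists_modulus_of_periodic {f : ℝ → ℝ} (hf : Continuous f) (hp : Function.Periodic f 1)
    {ε : ℝ} (hε : 0 < ε) : ∃ M : ℕ, 0 < M ∧ ∀ y z : ℝ, |y - z| ≤ 1 / M → f y ≤ f z + ε := by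
  -- The period `[0,1]` is enlarged by one on each side: after translation `z` lies in `[0,1)` and
  -- `y` within distance `1/M ≤ 1` of it.
  have hu := (isCompact_Icc (a := (-1 : ℝ)) (b := 2)).uniformContinuousOn_of_continuous
    hf.continuousOn
  obtain ⟨δ, hδ, h⟩ := Metric.uniformContinuousOn_iff.mp hu ε hε
  obtain ⟨M, hM⟩ := exists_nat_gt (max 1 (1 / δ))
  have hM1 : (1 : ℝ) < M := (le_max_left _ _).trans_lt hM
  have hMδ : 1 / (M : ℝ) < δ := by
    have h1 : 1 / δ < M := (le_max_right _ _).trans_lt hM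
    rw [div_lt_iff₀ hδ] at h1
    rw [div_lt_iff₀ (by linarith)]
    linarith
  have hMle : 1 / (M : ℝ) ≤ 1 := by
    rw [div_le_one (by linarith)]
    exact hM1.le
  refine ⟨M, by exact_mod_cast (zero_lt_one.trans hM1), fun y z hyz => ?_⟩
  have e : ∀ w, f (w - ⌊z⌋) = f w := fun w => by
    have := hp.int_mul ⌊z⌋ (w - ⌊z⌋)
    rw [mul_one, sub_add_cancel] at this
    exact this.symm
  rw [← e y, ← e z]
  have h0 : 0 ≤ z - ⌊z⌋ := Int.fract_nonneg z
  have h1 : z - ⌊z⌋ < 1 := Int.fract_lt_one z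
  have h2 := abs_le.mp hyz
  have := h (y - ⌊z⌋) ⟨by linarith, by linarith⟩ (z - ⌊z⌋) ⟨by linarith, by linarith⟩ (by
    rw [Real.dist_eq, sub_sub_sub_cancel_right]
    exact hyz.trans_lt hMδ)
  rw [Real.dist_eq] at this
  linarith [(abs_lt.mp this).2]

theorem integral_comp_sub_left_period {f : ℝ → ℝ} (hp : Function.Periodic f 1) (z : ℝ) :
    ∫ w in (-1 / 2 : ℝ)..(1 / 2), f (z - w) = ∫ w in (-1 / 2 : ℝ)..(1 / 2), f w := by
  rw [intervalIntegral.integral_comp_sub_left, ← integral_period hp (z - 1 / 2)]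
  congr 1
  ring

section Density

variable {s η : ℝ} (hs : 0 < s) (hη0 : 0 < η) (hη1 : η < 1)
include hs hη0 hη1

theorem continuous_countingDensity (n : ℕ) (x : Fin n → ℝ) :
    Continuous (countingDensity s η n x) := by
  have c1 := continuous_unitPhase hs hη0 hη1
  have c2 := continuous_unitPhase hs (κ := η / 2) (by linarith) (by linarith)
  unfold countingDensity
  fun_prop

theorem countingDensity_periodic (n : ℕ) (x : Fin n → ℝ) :
    Function.Periodic (countingDensity s η n x) 1 := fun z => by
  have p1 := unitPhase_periodic hs hη0 hη1
  have p2 := unitPhase_periodic hs (κ := η / 2) (by linarith) (by linarith)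
  simp only [countingDensity, p2 z, show ∀ l, z + 1 - x l = z - x l + 1 from fun l => by ring, p1 _]

omit hs hη0 hη1 in
theorem ofReal_countingDensity (n : ℕ) (x : Fin n → ℝ) (z : ℝ) :
    (countingDensity s η n x z : ℂ) = (unitPhase s (η / 2) z : ℂ)
      - 1 / ((2 * n : ℕ) : ℂ) * ∑ l, (unitPhase s η (z - x l) : ℂ) := by
  rw [countingDensity]
  push_cast
  rfl

theorem exists_abs_countingDensity_le :
    ∃ C : ℝ, ∀ (n : ℕ) (x : Fin n → ℝ) (z : ℝ), |countingDensity s η n x z| ≤ C := by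
  have c1 := continuous_unitPhase hs hη0 hη1
  have c2 := continuous_unitPhase hs (κ := η / 2) (by linarith) (by linarith)
  have p1 := unitPhase_periodic hs hη0 hη1
  have p2 := unitPhase_periodic hs (κ := η / 2) (by linarith) (by linarith)
  obtain ⟨C, hC⟩ := exists_norm_sub_average_le (P := fun z => (unitPhase s (η / 2) z : ℂ))
    (K := fun z => (unitPhase s η z : ℂ)) (by fun_prop) (fun z => by simp only [p2 z])
    (by fun_prop) (fun z => by simp only [p1 z])
  refine ⟨C, fun n x z => ?_⟩
  have := hC n x z
  rw [← ofReal_countingDensity, norm_real] at this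
  exact this

omit hs hη0 hη1 in
theorem coeff_average {n : ℕ} (x : Fin n → ℝ) {f : ℝ → ℝ} (hf : Continuous f)
    (hp : Function.Periodic f 1) (m : ℤ) :
    coeff (fun z => ((1 / ((2 * n : ℕ) : ℝ) * ∑ l, f (z - x l) : ℝ) : ℂ)) m
      = 1 / ((2 * n : ℕ) : ℂ) * (∑ l, char (-m) (x l)) * coeff (fun z => (f z : ℂ)) m := by
  have h : ∀ l, coeff (fun z => (f (z - x l) : ℂ)) m
      = char (-m) (x l) * coeff (fun z => (f z : ℂ)) m := fun l =>
    coeff_comp_sub (f := fun z => (f z : ℂ)) (fun z => by simp only [hp z]) (x l) m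
  have hsum : coeff (fun z => ∑ l, (f (z - x l) : ℂ)) m
      = ∑ l, coeff (fun z => (f (z - x l) : ℂ)) m := by
    simp only [coeff, Finset.mul_sum]
    refine intervalIntegral.integral_finsetSum fun l _ => ?_
    exact ((continuous_char _).mul (by fun_prop)).intervalIntegrable _ _
  simp only [ofReal_mul, ofReal_sum]
  rw [coeff_const_mul, hsum, Finset.sum_congr rfl fun l _ => h l, ← Finset.sum_mul]
  push_cast
  ring

/-- The counting density in terms of the root density and the resolvent. -/
theorem countingDensity_sub_integral {R : ℝ → ℝ} (cR : Continuous R)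
    (pR : Function.Periodic R 1)
    (hR : ∀ m, coeff (fun z => (R z : ℂ)) m
        * (1 + coeff (fun z => ((unitPhase s η z - 2 * η : ℝ) : ℂ)) m)
      = coeff (fun z => ((unitPhase s η z - 2 * η : ℝ) : ℂ)) m)
    {n : ℕ} (hn : 0 < n) (x : Fin n → ℝ) (z : ℝ) :
    countingDensity s η n x z
      - ∫ w in (-1 / 2 : ℝ)..(1 / 2), R (z - w) * countingDensity s η n x w
      = rootDensity s η z - 1 / ((2 * n : ℕ) : ℝ) * ∑ l, R (z - x l) := by
  have cK := continuous_unitPhase hs hη0 hη1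
  have pK := unitPhase_periodic hs hη0 hη1
  have cP := continuous_unitPhase hs (κ := η / 2) (by linarith) (by linarith)
  have cr := continuous_rootDensity hs hη0
  have pr := rootDensity_periodic hs hη0
  have cσ := continuous_countingDensity hs hη0 hη1 n x
  have pσ := countingDensity_periodic hs hη0 hη1 n x
  have hconv : (fun z => ((∫ w in (-1 / 2 : ℝ)..(1 / 2),
      R (z - w) * countingDensity s η n x w : ℝ) : ℂ))
      = conv (fun w => (R w : ℂ)) (fun w => (countingDensity s η n x w : ℂ)) :=
    funext fun z => ofReal_integral_conv _ _ z
  have cI : Continuous fun z => ∫ w in (-1 / 2 : ℝ)..(1 / 2),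
      R (z - w) * countingDensity s η n x w := by fun_prop
  refine congrFun (eq_of_coeff_ofReal_eq (f := fun z => countingDensity s η n x z
      - ∫ w in (-1 / 2 : ℝ)..(1 / 2), R (z - w) * countingDensity s η n x w)
    (g := fun z => rootDensity s η z - 1 / ((2 * n : ℕ) : ℝ) * ∑ l, R (z - x l))
    (cσ.sub cI) (fun z => ?_) (by fun_prop) (fun z => ?_) fun m => ?_) z
  · simp only [pσ z, show ∀ w, z + 1 - w = z - w + 1 from fun w => by ring, pR _]
  · simp only [pr z, show ∀ l, z + 1 - x l = z - x l + 1 from fun l => by ring, pR _]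
  · set A : ℂ := 1 / ((2 * n : ℕ) : ℂ) * ∑ l, char (-m) (x l) with hA
    have hσ : coeff (fun z => (countingDensity s η n x z : ℂ)) m
        = coeff (fun z => (unitPhase s (η / 2) z : ℂ)) m
          - A * coeff (fun z => (unitPhase s η z : ℂ)) m := by
      rw [hA, ← coeff_average x cK pK, ← coeff_sub (by fun_prop) (by fun_prop)]
      simp only [countingDensity, ofReal_sub]
    have hρ : coeff (fun z => (rootDensity s η z : ℂ)) m
        * (1 + coeff (fun z => (unitPhase s η z : ℂ)) m)
        = coeff (fun z => (unitPhase s (η / 2) z : ℂ)) m := by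
      have hc := continuous_conv (f := fun w => (unitPhase s η w : ℂ))
        (g := fun w => (rootDensity s η w : ℂ)) (by fun_prop) (by fun_prop)
      simp only [← rootDensity_add_integral hs hη0 hη1, ofReal_add, ofReal_integral_conv]
      rw [coeff_add (by fun_prop) hc, coeff_conv (by fun_prop) (fun z => by simp only [pK z])
        (by fun_prop)]
      ring
    have hk : coeff (fun z => ((unitPhase s η z - 2 * η : ℝ) : ℂ)) m
        = coeff (fun z => (unitPhase s η z : ℂ)) m - if m = 0 then (2 * η : ℂ) else 0 := by
      rw [← coeff_const, ← coeff_sub (by fun_prop) (by fun_prop)]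
      push_cast
      rfl
    -- Replacing `K` by `K - 2η` changes only the zero mode, where the roots and `ρ` have the same
    -- mass `n/(2n) = 1/2`.
    have hzero : (coeff (fun z => (rootDensity s η z : ℂ)) m - A)
        * (if m = 0 then (2 * η : ℂ) else 0) = 0 := by
      split_ifs with hm
      · subst hm
        have hnC : (n : ℂ) ≠ 0 := Nat.cast_ne_zero.mpr hn.ne'
        rw [coeff_rootDensity hs hη0, hA]
        simp only [phaseCoeff, if_true, neg_zero, char_zero, Finset.sum_const, Finset.card_univ,
          Fintype.card_fin, nsmul_eq_mul]
        push_cast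
        field_simp
        norm_num
      · rw [mul_zero]
    have h1 := hR m
    rw [hk] at h1
    simp only [ofReal_sub]
    rw [coeff_sub (by fun_prop) (by fun_prop), coeff_sub (by fun_prop) (by fun_prop), hconv,
      coeff_conv (by fun_prop) (fun z => by simp only [pR z]) (by fun_prop),
      coeff_average x cR pR, hσ, ← hρ, ← hA]
    generalize coeff (fun z => (R z : ℂ)) m = r at *
    generalize coeff (fun z => (rootDensity s η z : ℂ)) m = ρ at *
    generalize coeff (fun z => (unitPhase s η z : ℂ)) m = K at *
    linear_combination (-ρ + A) * h1 + (1 - r) * hzero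

/-- The counting density of a ground state is bounded below for large `n`. -/
theorem exists_pos_le_countingDensity : ∃ c : ℝ, 0 < c ∧ ∃ n₀ : ℕ, ∀ n : ℕ, n₀ ≤ n → 0 < n →
    ∀ (x : Fin n → ℝ) (U : ℝ → ℝ), IsCountingFunction s η n x U →
      ∀ z, c ≤ countingDensity s η n x z := by
  have cP := continuous_unitPhase hs (κ := η / 2) (by linarith) (by linarith)
  have pP := unitPhase_periodic hs (κ := η / 2) (by linarith) (by linarith)
  -- For `η ≥ 1/2` the signs suffice: `K ≤ 2η` bounds the average with weight `1/(2n)` by `η`, while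
  -- `p₀'/2π > η`.
  rcases le_or_gt (1 / 2) η with hη | hη
  · obtain ⟨c, hc, h⟩ := exists_pos_le_of_periodic (f := fun z => unitPhase s (η / 2) z - η)
      (by fun_prop) (fun z => by simp only [pP z]) fun z => by
        have := two_mul_lt_unitPhase hs (κ := η / 2) (by linarith) (by linarith) (by linarith) z
        linarith
    refine ⟨c, hc, 0, fun n _ hn x _ _ z => ?_⟩
    have hnR : (0 : ℝ) < n := Nat.cast_pos.mpr hn
    have h1 : ∑ l, unitPhase s η (z - x l) ≤ n * (2 * η) := by
      have := Finset.sum_le_card_nsmul Finset.univ (fun l => unitPhase s η (z - x l)) (2 * η)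
        fun l _ => unitPhase_le_two_mul hs hη0 hη1 hη _
      simpa using this
    have h2 : 1 / ((2 * n : ℕ) : ℝ) * ∑ l, unitPhase s η (z - x l) ≤ η := by
      push_cast
      rw [one_div, inv_mul_le_iff₀ (by positivity)]
      linarith
    rw [countingDensity]
    linarith [h z]
  · obtain ⟨R, cR, pR, R0, hRi, hRc⟩ := exists_resolvent hs hη0 hη
    obtain ⟨r, hr, hrρ⟩ := exists_pos_le_of_periodic (continuous_rootDensity hs hη0)
      (rootDensity_periodic hs hη0) (rootDensity_pos hs hη0)
    obtain ⟨C, hC⟩ := exists_abs_countingDensity_le hs hη0 hη1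
    obtain ⟨B, hB⟩ := exists_norm_le_of_periodic cR pR
    have hC0 : 0 ≤ C := (abs_nonneg _).trans (hC 0 (fun _ => 0) 0)
    -- This `ε` makes the smoothing error `4εC` at most `r/2`; the choice of `n₀` below makes the
    -- counting error `MB/n` at most `r/4`. The final factor `1/2` leaves a total below `r/2`, half
    -- the lower bound `r` of `ρ`.
    obtain ⟨M, hM, hMR⟩ := exists_modulus_of_periodic cR pR
      (ε := r / (8 * (C + 1))) (by positivity)
    set ε := r / (8 * (C + 1)) with hε
    obtain ⟨n₀, hn₀⟩ := exists_nat_gt (4 * (M * B) / r)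
    refine ⟨r / 2, by positivity, n₀, fun n hnn hn x U hU => ?_⟩
    have hnR : (0 : ℝ) < n := Nat.cast_pos.mpr hn
    have cσ := continuous_countingDensity hs hη0 hη1 n x
    have pσ := countingDensity_periodic hs hη0 hη1 n x
    set σ := countingDensity s η n x with hσ
    have hsum : ∀ z, 1 / ((2 * n : ℕ) : ℝ) * ∑ l, R (z - x l)
        ≤ (∫ w in (-1 / 2 : ℝ)..(1 / 2), R (z - w) * |σ w|) + r / 2 := by
      intro z
      have h1 := sum_le_integral_mul_abs hn hU.1 (continuous_const.mul cσ) hU.2.1 hU.2.2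
        (φ := fun w => R (z - w)) (by fun_prop)
        (fun w => by
          have := pR (z - (w + 1))
          rw [show z - (w + 1) + 1 = z - w by ring] at this
          exact this.symm) (fun w => R0 _) (B := B)
        (fun w => (le_abs_self _).trans (hB _)) hM (ε := ε) fun y w hyw => hMR _ _ (by
          rwa [sub_sub_sub_cancel_left, abs_sub_comm])
      have h2 : ∫ w in (-1 / 2 : ℝ)..(1 / 2), (R (z - w) + 2 * ε) * |2 * σ w|
          ≤ ∫ w in (-1 / 2 : ℝ)..(1 / 2), (2 * (R (z - w) * |σ w|) + 4 * ε * C) := by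
        refine intervalIntegral.integral_mono_on (by norm_num)
          (Continuous.intervalIntegrable (by fun_prop) _ _)
          (Continuous.intervalIntegrable (by fun_prop) _ _) fun w _ => ?_
        rw [abs_mul, abs_two]
        have h3 := hC n x w
        have h4 : 0 < ε := by positivity
        nlinarith
      rw [intervalIntegral.integral_add (Continuous.intervalIntegrable (by fun_prop) _ _)
        (by simp), intervalIntegral.integral_const_mul, intervalIntegral.integral_const] at h2
      have h5 : (4 : ℝ) * ε * C ≤ r / 2 := by
        rw [hε, mul_comm, ← mul_assoc, mul_div_assoc', div_le_div_iff₀ (by positivity) two_pos]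
        nlinarith
      have h6 : M * B / n ≤ r / 4 := by
        rw [div_le_div_iff₀ hnR (by norm_num)]
        have h7 : (n₀ : ℝ) ≤ n := Nat.cast_le.mpr hnn
        rw [div_lt_iff₀ hr] at hn₀
        nlinarith
      have h8 : 1 / ((2 * n : ℕ) : ℝ) * ∑ l, R (z - x l)
          = 1 / 2 * (1 / (n : ℝ) * ∑ l, R (z - x l)) := by
        push_cast
        field_simp
      norm_num at h2 h1 h8 ⊢
      rw [h8]
      linarith
    obtain ⟨z0, hz0⟩ := exists_forall_le_of_periodic cσ pσ
    set μ := min (σ z0) 0 with hμ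
    have hμ0 : μ ≤ 0 := min_le_right _ _
    -- Since `σ ≥ |σ| + 2μ`, the term `R*|σ|` from the sum over the roots cancels, leaving `2μ∫R`.
    have hlow : r / 2 + 2 * μ * ((1 - 2 * η) / (2 * (1 - η))) ≤ σ z0 := by
      have h1 := countingDensity_sub_integral hs hη0 hη1 cR pR hRc hn x z0
      have h2 := hsum z0
      have h3 := hrρ z0
      have h4 : ∫ w in (-1 / 2 : ℝ)..(1 / 2), (R (z0 - w) * |σ w| + 2 * μ * R (z0 - w))
          ≤ ∫ w in (-1 / 2 : ℝ)..(1 / 2), R (z0 - w) * σ w := by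
        refine intervalIntegral.integral_mono_on (by norm_num)
          (Continuous.intervalIntegrable (by fun_prop) _ _)
          (Continuous.intervalIntegrable (by fun_prop) _ _) fun w _ => ?_
        have h5 : |σ w| + 2 * μ ≤ σ w := by
          rcases abs_cases (σ w) with ⟨ha, -⟩ | ⟨ha, -⟩
          · linarith
          · have : μ ≤ σ w := (min_le_left _ _).trans (hz0 w)
            linarith
        nlinarith [R0 (z0 - w)]
      rw [intervalIntegral.integral_add (Continuous.intervalIntegrable (by fun_prop) _ _)
        (Continuous.intervalIntegrable (by fun_prop) _ _), intervalIntegral.integral_const_mul,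
        integral_comp_sub_left_period pR, hRi] at h4
      linarith
    have hlam : 2 * ((1 - 2 * η) / (2 * (1 - η))) ≤ 1 := by
      rw [mul_div_assoc', div_le_one (by linarith)]
      linarith
    -- If the minimum were negative, it would equal `μ`, and `2∫R ≤ 1` would give `μ ≥ r/2 + μ`.
    have hz0' : r / 2 ≤ σ z0 := by
      rcases le_or_gt 0 (σ z0) with h | h
      · rw [hμ, min_eq_right h] at hlow
        linarith
      · rw [hμ, min_eq_left h.le] at hlow
        nlinarith
    exact fun z => hz0'.trans (hz0 z)

end Density

/-! ### Condensation of the Bethe roots -/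

section Condensation

variable {s η : ℝ} (hs : 0 < s) (hη0 : 0 < η) (hη1 : η < 1)
include hs hη0 hη1

/-- Passing from a test function to the solution of the adjoint equation replaces the root density
by the counting density. -/
theorem average_sub_integral_eq {f ψ : ℝ → ℂ} (cψ : Continuous ψ)
    (h : ∀ z, ψ z + conv (fun w => (unitPhase s η w : ℂ)) ψ z = f z) (n : ℕ) (x : Fin n → ℝ) :
    1 / ((2 * n : ℕ) : ℂ) * ∑ j, f (x j)
        - ∫ z in (-1 / 2 : ℝ)..(1 / 2), f z * (rootDensity s η z : ℂ)
      = 1 / ((2 * n : ℕ) : ℂ) * ∑ j, ψ (x j)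
        - ∫ z in (-1 / 2 : ℝ)..(1 / 2), ψ z * (countingDensity s η n x z : ℂ) := by
  have cK := continuous_unitPhase hs hη0 hη1
  have cP := continuous_unitPhase hs (κ := η / 2) (by linarith) (by linarith)
  have cr := continuous_rootDensity hs hη0
  have cσ := continuous_countingDensity hs hη0 hη1 n x
  have hsym : ∀ a b : ℝ, unitPhase s η (a - b) = unitPhase s η (b - a) := fun a b => by
    rw [← unitPhase_neg, neg_sub]
  -- By evenness of `K`, averaging `K*ψ` over the roots tests `ψ` against the averaged kernel, which
  -- is `p₀'/2π - σ`.
  have e1 : 1 / ((2 * n : ℕ) : ℂ) * ∑ j, conv (fun w => (unitPhase s η w : ℂ)) ψ (x j)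
      = (∫ w in (-1 / 2 : ℝ)..(1 / 2), ψ w * (unitPhase s (η / 2) w : ℂ))
        - ∫ w in (-1 / 2 : ℝ)..(1 / 2), ψ w * (countingDensity s η n x w : ℂ) := by
    rw [← intervalIntegral.integral_sub (Continuous.intervalIntegrable (by fun_prop) _ _)
      (Continuous.intervalIntegrable (by fun_prop) _ _)]
    simp only [conv]
    rw [← intervalIntegral.integral_finsetSum fun j _ =>
      Continuous.intervalIntegrable (by fun_prop) _ _, ← intervalIntegral.integral_const_mul]
    refine intervalIntegral.integral_congr fun w _ => ?_
    simp only [ofReal_countingDensity, hsym w, ← Finset.sum_mul]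
    ring
  -- Convolution with the even kernel is self-adjoint, so the operator passes from `ψ` to `ρ`, where
  -- the integral equation applies.
  have e2 : ∫ z in (-1 / 2 : ℝ)..(1 / 2), f z * (rootDensity s η z : ℂ)
      = ∫ w in (-1 / 2 : ℝ)..(1 / 2), ψ w * (unitPhase s (η / 2) w : ℂ) := by
    have cc := continuous_conv (f := fun w => (unitPhase s η w : ℂ)) (by fun_prop) cψ
    have e3 : ∫ z in (-1 / 2 : ℝ)..(1 / 2),
        conv (fun w => (unitPhase s η w : ℂ)) ψ z * (rootDensity s η z : ℂ)
        = ∫ w in (-1 / 2 : ℝ)..(1 / 2), ψ w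
          * conv (fun w => (unitPhase s η w : ℂ)) (fun w => (rootDensity s η w : ℂ)) w := by
      simp only [conv, ← intervalIntegral.integral_mul_const, ← intervalIntegral.integral_const_mul]
      rw [integral_integral_swap_of_continuous (by fun_prop)]
      refine intervalIntegral.integral_congr fun w _ =>
        intervalIntegral.integral_congr fun z _ => ?_
      simp only [hsym w]
      ring
    have cc' := continuous_conv (f := fun w => (unitPhase s η w : ℂ))
      (g := fun w => (rootDensity s η w : ℂ)) (by fun_prop) (by fun_prop)
    simp only [← h, add_mul]
    rw [intervalIntegral.integral_add (Continuous.intervalIntegrable (by fun_prop) _ _)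
      (Continuous.intervalIntegrable (by fun_prop) _ _), e3,
      ← intervalIntegral.integral_add (Continuous.intervalIntegrable (by fun_prop) _ _)
      (Continuous.intervalIntegrable (by fun_prop) _ _)]
    refine intervalIntegral.integral_congr fun w _ => ?_
    simp only [← rootDensity_add_integral hs hη0 hη1, ofReal_add, ofReal_integral_conv]
    ring
  rw [e2]
  simp only [← h, Finset.sum_add_distrib, mul_add]
  rw [e1]
  ring

/-- Condensation of the points of a counting function, with the error uniform over all of them. -/
theorem exists_norm_average_sub_integral_rootDensity_le {f : ℝ → ℂ} (hf : ContDiff ℝ ∞ f)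
    (hp : Function.Periodic f 1) (k : ℕ) :
    ∃ C : ℝ, ∀ n : ℕ, 0 < n → ∀ x : Fin n → ℝ, (∃ U, IsCountingFunction s η n x U) →
      ‖1 / ((2 * n : ℕ) : ℂ) * ∑ j, f (x j)
        - ∫ z in (-1 / 2 : ℝ)..(1 / 2), f z * (rootDensity s η z : ℂ)‖
        ≤ C / ((2 * n : ℕ) : ℝ) ^ k := by
  obtain ⟨c, hc, n₀, hpos⟩ := exists_pos_le_countingDensity hs hη0 hη1
  obtain ⟨ψ, hψ, pψ, hψf⟩ := exists_add_conv_eq hs hη0 hη1 hf hp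
  obtain ⟨B, hB⟩ := exists_norm_le_of_periodic hf.continuous hp
  have hB0 : 0 ≤ B := (norm_nonneg _).trans (hB 0)
  set J := ∫ z in (-1 / 2 : ℝ)..(1 / 2), f z * (rootDensity s η z : ℂ) with hJ
  -- All sufficiently large systems are treated as one family, which yields a constant independent
  -- of the ground state.
  let ι := {p : (n : ℕ) × (Fin n → ℝ) × (ℝ → ℝ) //
    n₀ ≤ p.1 ∧ 0 < p.1 ∧ IsCountingFunction s η p.1 p.2.1 p.2.2}
  have hUB : ∀ k, UnifBdd k fun (i : ι) z =>
      ((2 * countingDensity s η i.1.1 i.1.2.1 z : ℝ) : ℂ) := fun k => by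
    have hP := contDiff_unitPhase hs (κ := η / 2) (by linarith) (by linarith)
    have hK := contDiff_unitPhase hs hη0 hη1
    have pP := unitPhase_periodic hs (κ := η / 2) (by linarith) (by linarith)
    have pK := unitPhase_periodic hs hη0 hη1
    have h := unifBdd_sub_average (ι := ι) (P := fun z => (unitPhase s (η / 2) z : ℂ))
      (K := fun z => (unitPhase s η z : ℂ)) (ofRealCLM.contDiff.comp hP)
      (fun z => by simp only [pP z]) (ofRealCLM.contDiff.comp hK) (fun z => by simp only [pK z])
      (fun i => i.1.1) (fun i => i.1.2.1) k
    simpa only [ofReal_mul, ofReal_countingDensity, ofReal_ofNat] using (UnifBdd.const 2).mul h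
  obtain ⟨C, hC⟩ := exists_norm_average_sub_integral_le (ι := ι) (n := fun i => i.1.1)
    (fun i => i.2.2.1) (fun i => i.1.2.1) (U := fun i => i.1.2.2)
    (W := fun i z => 2 * countingDensity s η i.1.1 i.1.2.1 z) (c := 2 * c) (by positivity)
    (fun i => i.2.2.2.1) (fun i => i.2.2.2.2.1) (fun i => i.2.2.2.2.2)
    (fun i z => by
      have := hpos _ i.2.1 i.2.2.1 _ _ i.2.2.2 z
      linarith) hUB hψ pψ k
  have hJ0 : 0 ≤ B + ‖J‖ := add_nonneg hB0 (norm_nonneg _)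
  refine ⟨|C| * 2 ^ k + (B + ‖J‖) * ((2 * n₀ : ℕ) : ℝ) ^ k, fun n hn x hx => ?_⟩
  have hnR : (0 : ℝ) < n := Nat.cast_pos.mpr hn
  have hNR : (0 : ℝ) < ((2 * n : ℕ) : ℝ) := by positivity
  rw [le_div_iff₀ (pow_pos hNR k)]
  rcases le_or_gt n₀ n with hnn | hnn
  · obtain ⟨U, hU⟩ := hx
    have h1 := hC ⟨⟨n, x, U⟩, hnn, hn, hU⟩
    have h_eq := average_sub_integral_eq hs hη0 hη1 hψ.continuous hψf n x
    rw [← hJ] at h_eq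
    rw [h_eq]
    have h2 : 1 / ((2 * n : ℕ) : ℂ) * ∑ j, ψ (x j)
        - ∫ z in (-1 / 2 : ℝ)..(1 / 2), ψ z * (countingDensity s η n x z : ℂ)
        = 1 / 2 * (1 / (n : ℂ) * ∑ j, ψ (x j) - ∫ z in (-1 / 2 : ℝ)..(1 / 2), ψ z
          * ((2 * countingDensity s η n x z : ℝ) : ℂ)) := by
      have h3 : ∫ z in (-1 / 2 : ℝ)..(1 / 2), ψ z * ((2 * countingDensity s η n x z : ℝ) : ℂ)
          = 2 * ∫ z in (-1 / 2 : ℝ)..(1 / 2), ψ z * (countingDensity s η n x z : ℂ) := by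
        rw [← intervalIntegral.integral_const_mul]
        refine intervalIntegral.integral_congr fun z _ => ?_
        push_cast
        ring
      rw [h3]
      push_cast
      field_simp
    rw [h2, norm_mul]
    simp only [le_div_iff₀ (pow_pos hnR k)] at h1
    have h4 : ‖(1 / 2 : ℂ)‖ ≤ 1 := by norm_num
    have h5 : 0 ≤ (B + ‖J‖) * ((2 * n₀ : ℕ) : ℝ) ^ k := by positivity
    push_cast at h1 h5 ⊢
    rw [mul_pow]
    set E := ‖1 / (n : ℂ) * ∑ j, ψ (x j) - ∫ z in (-1 / 2 : ℝ)..(1 / 2), ψ z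
          * (2 * (countingDensity s η n x z : ℂ))‖ with hE
    have h6 : ‖(1 / 2 : ℂ)‖ * E ≤ E := mul_le_of_le_one_left (norm_nonneg _) h4
    have h7 : ‖(1 / 2 : ℂ)‖ * E * (2 ^ k * (n : ℝ) ^ k) ≤ E * (2 ^ k * (n : ℝ) ^ k) :=
      mul_le_mul_of_nonneg_right h6 (by positivity)
    have h8 : E * (2 ^ k * (n : ℝ) ^ k) ≤ |C| * 2 ^ k := by
      rw [mul_left_comm, mul_comm]
      exact mul_le_mul_of_nonneg_right (h1.trans (le_abs_self C)) (by positivity)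
    linarith
  -- For `n < n₀` the trivial bound suffices: the powers of `2n` are at most those of `2n₀` and go
  -- into the constant.
  · have h1 : ‖∑ j, f (x j)‖ ≤ n * B := by
      refine (norm_sum_le_of_le _ fun l _ => hB _).trans ?_
      rw [Finset.sum_const, Finset.card_univ, Fintype.card_fin, nsmul_eq_mul]
    have h2 : ‖1 / ((2 * n : ℕ) : ℂ) * ∑ j, f (x j) - J‖ ≤ B + ‖J‖ := by
      refine (norm_sub_le _ _).trans (add_le_add ?_ le_rfl)
      rw [norm_mul, norm_div, norm_one, Complex.norm_natCast, one_div, inv_mul_le_iff₀ hNR]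
      push_cast
      nlinarith
    have h3 : ((2 * n : ℕ) : ℝ) ^ k ≤ ((2 * n₀ : ℕ) : ℝ) ^ k := by
      gcongr
    have h4 : 0 ≤ |C| * 2 ^ k := by positivity
    have h5 := mul_le_mul h2 h3 (by positivity) hJ0
    linarith

omit hs hη0 hη1 in
-- The density is even, so the integrand is odd.
theorem integral_mul_rootDensity :
    ∫ z in (-1 / 2 : ℝ)..(1 / 2), (z : ℂ) * (rootDensity s η z : ℂ) = 0 := by
  have h := intervalIntegral.integral_comp_neg (a := (-1 / 2 : ℝ)) (b := 1 / 2)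
    fun z : ℝ => (z : ℂ) * (rootDensity s η z : ℂ)
  simp only [rootDensity_neg, ofReal_neg, neg_mul, intervalIntegral.integral_neg] at h
  rw [show -(-1 / 2 : ℝ) = 1 / 2 by norm_num, show -(1 / 2 : ℝ) = -1 / 2 by norm_num] at h
  exact self_eq_neg.mp h.symm

end Condensation

end CyclicSOS

end

/-! ### The main theorem -/

theorem mainTheorem3 (η : ℝ) (hη0 : 0 < η) (hη1 : η < 1)
    (τ : ℂ) (hτre : τ.re = 0) (hτim : 0 < τ.im) :
    ∃ ρ : ℝ → ℝ,
      Continuous ρ ∧ Function.Periodic ρ 1 ∧ (∀ z, 0 < ρ z) ∧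
      CyclicSOS.IsLiebSolution η τ ρ ∧
      (∀ ρ' : ℝ → ℝ, CyclicSOS.IsLiebSolution η τ ρ' →
        Set.EqOn ρ' ρ (Set.Icc (-1 / 2) (1 / 2))) ∧
      (∀ f : ℝ → ℂ, ContDiff ℝ ∞ f → Function.Periodic f 1 →
        CyclicSOS.IsBigONegInfty η τ fun n x =>
          1 / ((2 * n : ℕ) : ℂ) * ∑ j, f (x j)
            - ∫ z in (-1 / 2 : ℝ)..(1 / 2), f z * (ρ z : ℂ)) ∧
      (∀ g : ℝ → ℂ, ContDiff ℝ ∞ g → Function.Periodic (deriv g) 1 →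
        (∫ z in (-1 / 2 : ℝ)..(1 / 2), deriv g z) = g (1 / 2) - g (-1 / 2) ∧
        CyclicSOS.IsBigONegInfty η τ fun n x =>
          1 / ((2 * n : ℕ) : ℂ) * ∑ j, g (x j)
            - ((∫ z in (-1 / 2 : ℝ)..(1 / 2), g z * (ρ z : ℂ))
              + (g (1 / 2) - g (-1 / 2)) / ((2 * n : ℕ) : ℂ) * ∑ j, (x j : ℂ))) := by
  have hs : 0 < 1 / τ.im := by positivity
  set s : ℝ := 1 / τ.im with hs_def
  have hK := CyclicSOS.kernelK_eq η hτre
  have hP := CyclicSOS.p0Deriv_eq η hτre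
  have cr := CyclicSOS.continuous_rootDensity hs hη0
  have hsol : CyclicSOS.IsLiebSolution η τ (CyclicSOS.rootDensity s η) := by
    refine ⟨cr.intervalIntegrable _ _, fun z _ => ?_⟩
    simp only [hK, hP]
    exact CyclicSOS.rootDensity_add_integral hs hη0 hη1 z
  have hmain : ∀ f : ℝ → ℂ, ContDiff ℝ ∞ f → Function.Periodic f 1 →
      CyclicSOS.IsBigONegInfty η τ fun n x => 1 / ((2 * n : ℕ) : ℂ) * ∑ j, f (x j)
        - ∫ z in (-1 / 2 : ℝ)..(1 / 2), f z * (CyclicSOS.rootDensity s η z : ℂ) := by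
    intro f hf hp k
    obtain ⟨C, hC⟩ :=
      CyclicSOS.exists_norm_average_sub_integral_rootDensity_le hs hη0 hη1 hf hp k
    exact ⟨C, fun n hn x hx => hC n hn x
      (CyclicSOS.exists_isCountingFunction hη0 hη1 hτre hτim hn hx)⟩
  refine ⟨CyclicSOS.rootDensity s η, cr, CyclicSOS.rootDensity_periodic hs hη0,
    CyclicSOS.rootDensity_pos hs hη0, hsol, fun ρ' hρ' => ?_, hmain, fun g hg hgp => ?_⟩
  · refine CyclicSOS.eqOn_of_add_integral_eq hs hη0 hη1
      (p := fun z => CyclicSOS.p0Deriv η τ z / (2 * Real.pi)) hsol.1 hρ'.1 ?_ ?_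
    · simpa only [hK] using hsol.2
    · simpa only [hK] using hρ'.2
  · have hgd : ∀ z, HasDerivAt g (deriv g z) z := fun z =>
      (hg.differentiable (by simp) z).hasDerivAt
    have hcd : Continuous (deriv g) := hg.continuous_deriv (by simp)
    have hint : ∀ a b : ℝ, ∫ z in a..b, deriv g z = g b - g a := fun a b =>
      intervalIntegral.integral_eq_sub_of_hasDerivAt (fun z _ => hgd z)
        (hcd.intervalIntegrable _ _)
    refine ⟨hint _ _, ?_⟩
    set c : ℂ := g (1 / 2) - g (-1 / 2) with hc
    have hf : ContDiff ℝ ∞ fun z : ℝ => g z - c * (z : ℂ) :=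
      hg.sub (contDiff_const.mul Complex.ofRealCLM.contDiff)
    -- The increment of `g` over any period is the integral of the periodic function `g'`, namely
    -- `c`; subtracting `c z` makes it periodic.
    have hp : Function.Periodic (fun z : ℝ => g z - c * (z : ℂ)) 1 := fun z => by
      have h1 := CyclicSOS.integral_period hgp z
      rw [hint, hint, ← hc] at h1
      have h2 : g (z + 1) = g z + c := by linear_combination h1
      simp only [h2]
      push_cast
      ring
    have h := hmain _ hf hp
    have he : ∫ z in (-1 / 2 : ℝ)..(1 / 2),
        (g z - c * (z : ℂ)) * (CyclicSOS.rootDensity s η z : ℂ)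
        = ∫ z in (-1 / 2 : ℝ)..(1 / 2), g z * (CyclicSOS.rootDensity s η z : ℂ) := by
      have cg := hg.continuous
      have h0 := CyclicSOS.integral_mul_rootDensity (s := s) (η := η)
      simp only [sub_mul, mul_assoc]
      rw [intervalIntegral.integral_sub (Continuous.intervalIntegrable (by fun_prop) _ _)
        (Continuous.intervalIntegrable (by fun_prop) _ _), intervalIntegral.integral_const_mul,
        h0, mul_zero, sub_zero]
    intro k
    obtain ⟨C, hC⟩ := h k
    refine ⟨C, fun n hn x hx => ?_⟩
    have h1 := hC n hn x hx
    simp only [he, Finset.sum_sub_distrib, ← Finset.mul_sum] at h1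
    convert h1 using 2
    ring
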